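/- Let $K$ be a global function field of characteristic $p>0$, and let $X$ be a smooth separated $K$-scheme of finite type which descends along the Frobenius $F_K$ of $K$: fix a $K$-scheme $Y$ and an isomorphism $X\cong Y^{(1)}=Y\times_{\operatorname{Spec}K,F_K}\operatorname{Spec}K$, let $F\colon Y\to X$ be the relative Frobenius of $Y$, and put $X(R)^p:=F(Y(R))$ for every $K$-algebra $R$. Write $\Omega^1_R$ for absolute Kähler differentials. A field extension $\kappa\subset L$ in characteristic $p$ is separable if $L\otimes_\kappa\kappa^{1/p}$ is reduced, and weakly separable if $\Omega^1_\kappa\to\Omega^1_L$ is injective. For an extension $L/K$, a point $a\in X(L)$ with image $x\in X$ is called pure if $K\subset\kappa(x)$ is separable, $\kappa(x)\subset L$ is weakly separable and $a\notin X(L)^p$; let $X^0(L)\subset X(L)$ be the set of pure points. For a place $v$ of $K$ and $x\in X$ let $X(K_v,x)\subset X(K_v)$ be the set of points with image $x$, and $X^0(K_v,x)=X^0(K_v)\cap X(K_v,x)$. A function on $X(K_v)$ is $p$-analytic at a point if near that point it is analytic over the subfield $K_v^p\subset K_v$, that is, on the Weil restriction of $X$ from $K_v$ to $K_v^p$; in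 terms of regular functions $s_1,\dots,s_N$ on an open subset of $X$, it is $G(s_1,\dots,s_N)$ with $G$ given by a convergent power series on the $K_v^p$-vector space $K_v^N$. A $p$-analytic subset of $X(K_v)$ is one which, near every point of $X(K_v)$, is the common zero set of finitely many $p$-analytic functions. **(1)** Let $v$ be a place of $K$ and let $x\in X$ be a point such that $\kappa(x)/K$ is separable, the canonical point $\operatorname{Spec}\kappa(x)\to X$ is not in $X(\kappa(x))^p$, and $X(K_v,x)\ne\emptyset$. Let $Z$ be the closure of $x$ in $X$, with its reduced structure, and $Z^{\mathrm{sm}}$ its smooth locus over $K$. Then there are countably many $p$-analytic subsets $W_i$ of $X(K_v)$ $(i\in\mathbb N)$, each contained in $Z(K_v)$ and proper in the sense that $W_i$ contains no nonempty open subset of the $K_v$-analytic manifold $Z^{\mathrm{sm}}(K_v)$, such that $$X^0(K_v,x)=Z(K_v)\setminus\bigcup_{i} W_i .$$ **(2)** Suppose that $X$ has no isolated points, i.e. that every irreducible component of $X$ has positive dimension. Let $X^0(\mathbf A_K)=X(\mathbf A_K)\cap\prod_v X^0(K_v)$ be the set of adelic points all of whose components are pure. If $X(\mathbf A_K)\neq\emptyset$,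 then $X^0(\mathbf A_K)$ is dense in $X(\mathbf A_K)$ for the adelic topology. -/

import Mathlib

open CategoryTheory AlgebraicGeometry Topology Filter
open scoped TensorProduct RestrictedProduct

universe u

noncomputable section

namespace PurePoints

/-! ### Places of a field and their completions -/

/-- Two nontrivial real absolute values are identified when they are equivalent. -/
instance placeSetoid (K : Type u) [Field K] :
    Setoid {v : AbsoluteValue K ℝ // v.IsNontrivial} :=
  Setoid.comap Subtype.val inferInstance

/-- The places of `K`: equivalence classes of nontrivial real absolute values. -/
def Place (K : Type u) [Field K] : Type u := Quotient (placeSetoid K)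

namespace Place

variable {K : Type u} [Field K]

/-- An absolute value representing the place `v`. -/
def absVal (v : Place K) : AbsoluteValue K ℝ := (Quotient.out v).1

lemma absVal_isNontrivial (v : Place K) : v.absVal.IsNontrivial := (Quotient.out v).2

/-- The completion `K_v`. -/
abbrev Completion (v : Place K) : Type u := v.absVal.Completion

/-- The embedding `K → K_v`. -/
def toCompletion (v : Place K) : K →+* v.Completion :=
  (UniformSpace.Completion.coeRingHom (α := WithAbs v.absVal)).comp
    (WithAbs.equiv v.absVal).symm.toRingHom

lemma norm_toCompletion (v : Place K) (x : K) : ‖v.toCompletion x‖ = v.absVal x :=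
  UniformSpace.Completion.norm_coe _

instance instNontriviallyNormedField (v : Place K) : NontriviallyNormedField v.Completion where
  __ := (inferInstance : NormedField v.Completion)
  non_trivial := by
    obtain ⟨x, hx⟩ := v.absVal_isNontrivial.exists_abv_gt_one
    exact ⟨v.toCompletion x, by
      have := v.norm_toCompletion x
      rw [← this] at hx
      exact hx⟩

instance instAlgebra (v : Place K) : Algebra K v.Completion := v.toCompletion.toAlgebra

end Place

/-! ### Separable and weakly separable field extensions, absolute differentials -/

/-- The field `κ^{1/p}`: a copy of `κ`, regarded as an extension of `κ` through the
`p`-th power map. -/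
def PthRootField (_p : ℕ) (κ : Type u) : Type u := κ

instance (p : ℕ) (κ : Type u) [Field κ] : Field (PthRootField p κ) :=
  inferInstanceAs (Field κ)

instance (p : ℕ) (κ : Type u) [Field κ] [ExpChar κ p] : Algebra κ (PthRootField p κ) :=
  RingHom.toAlgebra (S := PthRootField p κ) (frobenius κ p)

/-- A (not necessarily algebraic) field extension `κ → L` in characteristic `p`
is separable if `L ⊗ κ^{1/p}` is reduced. -/
def IsSeparableExt (p : ℕ) {κ L : Type u} [Field κ] [Field L] [ExpChar κ p]
    (φ : κ →+* L) : Prop :=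
  letI : Algebra κ L := φ.toAlgebra
  IsReduced (L ⊗[κ] PthRootField p κ)

/-- A field extension `κ → L` is weakly separable if `Ω¹_κ → Ω¹_L` is injective. Here `Ω¹` are
the absolute Kähler differentials (differentials over `ℤ` and over `𝔽_p` are the same). -/
def IsWeaklySeparableExt {κ L : Type u} [Field κ] [Field L] (φ : κ →+* L) : Prop :=
  letI : Algebra κ L := φ.toAlgebra
  Function.Injective (KaehlerDifferential.map ℤ ℤ κ L)

/-! ### Points of a scheme over a field -/

section Points

variable {K : Type u} [Field K] {X : Scheme.{u}}

/-- `X(L)`: the morphisms `Spec L ⟶ X` over `K`, for a field extension `L` of `K`. -/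
def Points (f : X ⟶ Spec (.of K)) (L : Type u) [Field L] [Algebra K L] : Type u :=
  {a : Spec (.of L) ⟶ X // a ≫ f = Spec.map (CommRingCat.ofHom (algebraMap K L))}

/-- The structure map `K → κ(x)`. -/
def residueStructure (f : X ⟶ Spec (.of K)) (x : X) : K →+* X.residueField x :=
  (Spec.preimage (X.fromSpecResidueField x ≫ f)).hom

variable {f : X ⟶ Spec (.of K)} {L : Type u} [Field L] [Algebra K L]

/-- The image in `X` of an `L`-point. -/
def Points.image (a : Points f L) : X := a.1 (IsLocalRing.closedPoint L)

/-- The embedding `κ(x) → L` given by an `L`-point with image `x`. -/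
def Points.residueMap (a : Points f L) : X.residueField a.image →+* L :=
  (X.descResidueField (Scheme.stalkClosedPointTo a.1)).hom

/-- The value at `a ∈ U(L)` of a function on the open `U`. -/
def Points.eval (a : Points f L) {U : X.Opens} (ha : a.image ∈ U) (s : Γ(X, U)) : L :=
  a.residueMap (X.evaluation U a.image ha s)

variable (f L) in
/-- `X(L, x)`: the `L`-points with image `x`. -/
def pointsOver (x : X) : Set (Points f L) := {a | a.image = x}

variable (f L) in
/-- `T(L)` for a subset `T` of `X`. When `T` is the support of a (locally) closed subscheme, these
are the `L`-points of that subscheme. -/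
def pointsIn (T : Set X) : Set (Points f L) := {a | a.image ∈ T}

/-- The topology on `X(L)` for a topological field `L`: the sets
`{a ∈ U(L) | s(a) ∈ V}` for `U ⊆ X` open, `s` a function on `U` and `V ⊆ L` open, form a subbasis. -/
instance [TopologicalSpace L] : TopologicalSpace (Points f L) :=
  TopologicalSpace.generateFrom
    {S | ∃ (U : X.Opens) (s : Γ(X, U)) (V : Set L), IsOpen V ∧
      S = {a | ∃ ha : a.image ∈ U, a.eval ha s ∈ V}}

/-- A point `a ∈ X(L)` with image `x` is weakly separable if `κ(x)/K` is separable and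
`L/κ(x)` is weakly separable. -/
def Points.IsWeaklySeparable (p : ℕ) [ExpChar K p] (a : Points f L) : Prop :=
  IsSeparableExt p (residueStructure f a.image) ∧ IsWeaklySeparableExt a.residueMap

variable (f) in
/-- The smooth locus over `K` of the closure `Z` of `x` in `X` (with its reduced structure), as
a subset of `X`. -/
def smoothLocusClosure [LocallyOfFiniteType f] (x : X) : Set X :=
  letI Z := Scheme.IdealSheafData.vanishingIdeal
    (⟨closure {x}, isClosed_closure⟩ : TopologicalSpace.Closeds X)
  haveI : LocallyOfFinitePresentation (Z.subschemeι ≫ f) :=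
    LocallyOfFinitePresentation.iff_locallyOfFiniteType.2 inferInstance
  Z.subschemeι '' ((Z.subschemeι ≫ f).smoothLocus : Set Z.subscheme)

end Points

/-! ### Frobenius and `p`-power points -/

section Frobenius

variable (p : ℕ)

/-- Scalars of `K`, regarded as functions on an open of a scheme over `K`. -/
def scalar {K : Type u} [Field K] {Y : Scheme.{u}} (g : Y ⟶ Spec (.of K)) (U : Y.Opens) :
    K →+* Γ(Y, U) :=
  ((Scheme.ΓSpecIso (.of K)).inv ≫ g.appTop ≫ Y.presheaf.map (homOfLE le_top).op).hom

/-- A scheme over a field of characteristic `p` has characteristic `p`. -/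
lemma cast_eq_zero {K : Type u} [Field K] [CharP K p] {Y : Scheme.{u}} (g : Y ⟶ Spec (.of K))
    (U : Y.Opens) : (p : Γ(Y, U)) = 0 := by
  rw [← map_natCast (scalar g U), CharP.cast_eq_zero K p, map_zero]

variable [hp : Fact p.Prime]

/-- The `p`-th power map of a ring in which `p = 0`. -/
def powHom (R : Type u) [CommRing R] (h : (p : R) = 0) : R →+* R where
  toFun r := r ^ p
  map_one' := one_pow p
  map_mul' a b := mul_pow a b p
  map_zero' := zero_pow hp.out.ne_zero
  map_add' a b := by
    rcases subsingleton_or_nontrivial R with hR | hR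
    · exact Subsingleton.elim _ _
    · have : CharP R p := (CharP.charP_iff_prime_eq_zero hp.out).2 h
      exact add_pow_char a b p

/-- The absolute Frobenius of a scheme of characteristic `p`, as a morphism of ringed spaces. -/
def absFrobeniusPre (Y : Scheme.{u}) (h : ∀ U : Y.Opens, (p : Γ(Y, U)) = 0) :
    Y.toPresheafedSpace ⟶ Y.toPresheafedSpace where
  base := 𝟙 _
  c :=
    { app := fun U => CommRingCat.ofHom (powHom p Γ(Y, U.unop) (h U.unop))
      naturality := by
        intro U V i
        ext s
        exact (map_pow (Y.presheaf.map i).hom s p).symm }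

/-- The absolute Frobenius of a scheme of characteristic `p`: the identity on the
underlying space and the `p`-th power map on functions. -/
def absFrobenius (Y : Scheme.{u}) (h : ∀ U : Y.Opens, (p : Γ(Y, U)) = 0) : Y ⟶ Y :=
  Scheme.Hom.mk
    { toHom := absFrobeniusPre p Y h
      prop := by
        intro x
        constructor
        intro a ha
        obtain ⟨U, hxU, s, rfl⟩ := Y.presheaf.exists_germ_eq (x := x) a
        have h1 := congrArg (fun φ => φ.hom s)
          (PresheafedSpace.stalkMap_germ (absFrobeniusPre p Y h) U x hxU)
        have h2 : IsUnit ((Y.presheaf.germ U x hxU).hom (s ^ p)) :=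
          (show _ = (Y.presheaf.germ U x hxU).hom (s ^ p) from h1) ▸ ha
        rw [map_pow] at h2
        exact (isUnit_pow_iff hp.out.ne_zero).1 h2 }

lemma absFrobenius_comp {K : Type u} [Field K] [CharP K p] {Y : Scheme.{u}}
    (g : Y ⟶ Spec (.of K)) :
    absFrobenius p Y (cast_eq_zero p g) ≫ g =
      g ≫ Spec.map (CommRingCat.ofHom (frobenius K p)) := by
  apply ext_of_isAffine
  ext s
  obtain ⟨r, rfl⟩ : ∃ r, (Scheme.ΓSpecIso (.of K)).inv.hom r = s :=
    ⟨(Scheme.ΓSpecIso (.of K)).hom.hom s, by simp⟩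
  have h1 : (Spec.map (CommRingCat.ofHom (frobenius K p))).appTop.hom
      ((Scheme.ΓSpecIso (.of K)).inv.hom r) =
      (Scheme.ΓSpecIso (.of K)).inv.hom (r ^ p) := by
    have := congrArg (fun φ => φ.hom r)
      (Scheme.ΓSpecIso_inv_naturality (CommRingCat.ofHom (frobenius K p)))
    exact this.symm
  rw [Scheme.Hom.comp_appTop, Scheme.Hom.comp_appTop]
  change (g.appTop.hom ((Scheme.ΓSpecIso (.of K)).inv.hom r)) ^ p = g.appTop.hom
    ((Spec.map (CommRingCat.ofHom (frobenius K p))).appTop.hom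
      ((Scheme.ΓSpecIso (.of K)).inv.hom r))
  rw [h1, map_pow, map_pow]

variable {p}

/-- A descent of `X` along the Frobenius `F_K` of `K`: a scheme `Y` over `K` together with an
isomorphism of `X` with the Frobenius twist `Y^{(1)} = Y ×_{Spec K, F_K} Spec K`, given here as a
projection `X ⟶ Y` that makes `X` the fibre product. -/
structure FrobeniusDescent (p : ℕ) [Fact p.Prime] {K : Type u} [Field K] [CharP K p]
    {X : Scheme.{u}} (f : X ⟶ Spec (.of K)) where
  /-- the model -/
  Y : Scheme.{u}
  /-- its structure morphism -/
  g : Y ⟶ Spec (.of K)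
  /-- the projection from the twist to the model -/
  proj : X ⟶ Y
  isPullback : IsPullback proj f g (Spec.map (CommRingCat.ofHom (frobenius K p)))

variable {K : Type u} [Field K] [CharP K p] {X : Scheme.{u}} {f : X ⟶ Spec (.of K)}

/-- The relative Frobenius `F : Y ⟶ Y^{(1)} ≅ X`. -/
def FrobeniusDescent.relFrobenius (D : FrobeniusDescent p f) : D.Y ⟶ X :=
  D.isPullback.lift (absFrobenius p D.Y (cast_eq_zero p D.g)) D.g (absFrobenius_comp p D.g)

/-- A `K`-morphism `a : T ⟶ X` is a `p`-power point, `a ∈ X(T)^p = F(Y(T))`, if it factors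
through the relative Frobenius by a `K`-morphism `T ⟶ Y`. -/
def FrobeniusDescent.IsPthPower (D : FrobeniusDescent p f) {T : Scheme.{u}} (a : T ⟶ X) : Prop :=
  ∃ b : T ⟶ D.Y, b ≫ D.g = a ≫ f ∧ b ≫ D.relFrobenius = a

variable {L : Type u} [Field L] [Algebra K L]

/-- A point of `X(L)` is pure if it is weakly separable and not in `X(L)^p`. -/
def Points.IsPure (D : FrobeniusDescent p f) (a : Points f L) : Prop :=
  a.IsWeaklySeparable p ∧ ¬ D.IsPthPower a.1

variable (L) in
/-- `X⁰(L)`, the set of pure points. -/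
def purePoints (D : FrobeniusDescent p f) : Set (Points f L) := {a | a.IsPure D}

end Frobenius

/-! ### `p`-analytic functions and `p`-analytic subsets -/

section Analytic

variable (p : ℕ)

/-- The subfield `L^p` of `L`. -/
def pthPowers (L : Type u) [Field L] [ExpChar L p] : Subfield L := (frobenius L p).fieldRange

variable {L : Type u} [NontriviallyNormedField L] [ExpChar L p]

/-- `L^p` is a normed field for the restriction of the absolute value of `L`. -/
instance : NontriviallyNormedField (pthPowers p L) where
  __ := SubfieldClass.toNormedField (pthPowers p L)
  non_trivial := by
    obtain ⟨x, hx⟩ := NontriviallyNormedField.non_trivial (α := L)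
    refine ⟨⟨x ^ p, x, rfl⟩, ?_⟩
    change 1 < ‖x ^ p‖
    rw [norm_pow]
    exact one_lt_pow₀ hx (expChar_pos L p).ne'

/-- `L` as a normed algebra over `L^p`. -/
instance : NormedAlgebra (pthPowers p L) L where
  norm_smul_le a b := norm_mul_le (a : L) b

variable {K : Type u} [Field K] [Algebra K L] {X : Scheme.{u}} {f : X ⟶ Spec (.of K)}

/-- A function `h` on `X(L)` (or on a neighbourhood of `a`) is `p`-analytic at `a` if, close to
`a`, it is a function `G (s₁(b), …, s_N(b))`, where `s₁, …, s_N` are regular functions on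
an open `U ∋ a` of `X` and `G`, as a function on the `L^p`-vector space `L^N`, is given near
`(s₁(a), …, s_N(a))` by a convergent power series over `L^p`. (If `U` is affine and the `s_i`
generate its functions, then they embed the Weil restriction of `U` from `L` to `L^p` in that
of `𝔸^N`, whose set of `L^p`-points is `L^N`.) -/
def IsPAnalyticAt (h : Points f L → L) (a : Points f L) : Prop :=
  ∃ (U : X.Opens) (ha : a.image ∈ U) (N : ℕ) (s : Fin N → Γ(X, U)) (G : (Fin N → L) → L),
    AnalyticAt (pthPowers p L) G (fun i => a.eval ha (s i)) ∧
    ∀ᶠ b in 𝓝 a, ∃ hb : b.image ∈ U, h b = G (fun i => b.eval hb (s i))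

/-- A subset of `X(L)` is `p`-analytic if around every point of `X(L)` it is the set of common
zeros of finitely many `p`-analytic functions. -/
def IsPAnalyticSubset (W : Set (Points f L)) : Prop :=
  ∀ a : Points f L, ∃ (m : ℕ) (h : Fin m → Points f L → L),
    (∀ j, IsPAnalyticAt p (h j) a) ∧ ∀ᶠ b in 𝓝 a, (b ∈ W ↔ ∀ j, h j b = 0)

variable (f L) in
/-- `W` is a proper `p`-analytic subset of `Z(L)`, where `Z` is the closure of `x` in `X`:
it is `p`-analytic, lies in `Z(L)`, and contains no nonempty open subset of the analytic manifold
`Z^{sm}(L)`, where `Z^{sm}` is the smooth locus of `Z`. -/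
def IsProperPAnalyticSubset [LocallyOfFiniteType f] (x : X) (W : Set (Points f L)) : Prop :=
  IsPAnalyticSubset p W ∧ W ⊆ pointsIn f L (closure {x}) ∧
    ∀ O : Set (Points f L), IsOpen O → O ∩ pointsIn f L (smoothLocusClosure f x) ⊆ W →
      O ∩ pointsIn f L (smoothLocusClosure f x) = ∅

end Analytic

/-! ### Adelic points -/

section Adelic

variable {K : Type u} [Field K]

instance (p : ℕ) [CharP K p] (v : Place K) : CharP v.Completion p :=
  charP_of_injective_algebraMap (algebraMap K v.Completion).injective p

variable {X : Scheme.{u}} (f : X ⟶ Spec (.of K))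

/-- A finite affine atlas of `X`, with finitely many generators of each of its rings
of functions as a `K`-algebra. -/
structure Atlas where
  /-- the number of charts -/
  n : ℕ
  /-- the charts -/
  U : Fin n → X.Opens
  isAffineOpen : ∀ i, IsAffineOpen (U i)
  iSup_eq_top : ⨆ i, U i = ⊤
  /-- the coordinates of each chart -/
  coord : ∀ i, Finset Γ(X, U i)
  generates : ∀ i, Subring.closure (Set.range (scalar f (U i)) ∪ (coord i : Set Γ(X, U i))) = ⊤

variable {f}

/-- The integral points of `X(K_v)` for an atlas: those that have integral coordinates in one of
the charts. For all but finitely many `v` this is `𝒳(𝒪_v)`, where `𝒳` is the model of `X` over a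
ring of `S`-integers of `K` that is glued from the spectra of the algebras generated by the
coordinates. -/
def Atlas.integralPoints (A : Atlas f) (v : Place K) : Set (Points f v.Completion) :=
  {a | ∃ (i : Fin A.n) (ha : a.image ∈ A.U i), ∀ s ∈ A.coord i, ‖a.eval ha s‖ ≤ 1}

/-- The adelic points `X(𝐀_K)` with the adelic topology: the restricted product of the spaces
`X(K_v)` with respect to the sets of integral points. (It does not depend on the atlas.) -/
abbrev AdelicPoints (A : Atlas f) : Type u :=
  Πʳ v : Place K, [Points f v.Completion, A.integralPoints v]

/-- `X⁰(𝐀_K)`: the adelic points all of whose components are pure. -/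
def pureAdelicPoints {p : ℕ} [Fact p.Prime] [CharP K p] (D : FrobeniusDescent p f)
    (A : Atlas f) : Set (AdelicPoints A) :=
  {a | ∀ v, a v ∈ purePoints v.Completion D}

end Adelic

end PurePoints

end

noncomputable section

namespace PurePoints

/-! ### The canonical derivation of a complete field with one-element `p`-basis -/

section PBasis

variable (p : ℕ) [hp : Fact p.Prime]

/-! Everything rests on one derivation. Since `[K : K^p] = p`, any `t ∈ K` that stays a non-`p`-th
power in `L = K_v` is a one-element `p`-basis of `K` and, by density and completeness, of `L`. Such
a `t` exists (`Place.exists_isPBasis`): otherwise `L` would be perfect, although its value group is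
discrete. Hence `Ω_L` is the line spanned by `dt`, and there is a derivation `∂` of `L` with `∂t =
1`. It is `L^p`-linear on a finite-dimensional `L^p`-space, so continuous, and it is `p`-analytic
but not analytic over `L`.

A point `a ∈ X(L)` over `x` is weakly separable over `κ(x)` iff no nonzero form `∑ f dg` of `κ(x)`
satisfies `∑ f(a) ∂(g(a)) = 0`. As `K` is countable, these are countably many `p`-analytic
conditions; cut down to bounded subsets of affine opens, which are open and closed, they give the
`W_i`. Separability of `κ(x)/K` is automatic because `K` and `L` share a `p`-basis. The condition on
`p`-th powers descends along weakly separable extensions, since an element of a field with zero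
differential is a `p`-th power. A point of `Z` not lying over `x` is removed by a form `s dt`, with
`s` vanishing at that point but not at `x`.

The `W_i` are proper by `PthDerivation.eq_zero_of_sum_eq_zero`. In local coordinates `y` of a smooth
variety a form gives the function `F₀(y) + ∑ F_i(y) ∂y_i`. If it vanishes on an open set, then
differentiating it over `L^p` separates an `L`-linear part from the part involving `∂` and forces
`F_i = 0`, then `F₀ = 0`. Regular functions vanishing on an open set of points of a smooth integral
scheme are zero, so the form is zero.

For density, Baire's theorem gives, near any point, a point in general position, where no
differential relation with regular coefficients holds unless its coefficients vanish at the point.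
Such a point is weakly separable. It is not a `p`-th power: the coordinates of a `p`-power point
have derivatives in its residue field, and in positive dimension this is a forbidden relation. The
adelic statement follows componentwise, because the integral points form open sets. -/

instance (κ : Type u) [Field κ] [ExpChar κ p] : ExpChar (PthRootField p κ) p :=
  inferInstanceAs (ExpChar κ p)

/-- If `[κ : κ^p] ≤ p` and `t` is not a `p`-th power, then `κ = ⨁ κ^p t^i`. -/
lemma exists_eq_sum_pow_mul {κ : Type u} [Field κ] [CharP κ p]
    [FiniteDimensional κ (PthRootField p κ)]
    (hfin : Module.finrank κ (PthRootField p κ) ≤ p) {t : κ} (ht : t ∉ pthPowers p κ) (u : κ) :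
    ∃ c : Fin p → κ, u = ∑ i, c i ^ p * t ^ (i : ℕ) := by
  set t' : PthRootField p κ := t
  have hmap (c : κ) : algebraMap κ (PthRootField p κ) c = (c ^ p : κ) := rfl
  have hirr : Irreducible (Polynomial.X ^ p - Polynomial.C t : Polynomial κ) :=
    X_pow_sub_C_irreducible_of_prime hp.out fun b hb => ht ⟨b, hb⟩
  have hmin : minpoly κ t' = Polynomial.X ^ p - Polynomial.C t := by
    refine (minpoly.eq_of_irreducible_of_monic hirr ?_
      (Polynomial.monic_X_pow_sub_C _ hp.out.ne_zero)).symm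
    simp only [map_sub, map_pow, Polynomial.aeval_X, Polynomial.aeval_C, hmap]
    exact sub_self (t ^ p)
  have hint : IsIntegral κ t' := Algebra.IsIntegral.isIntegral t'
  have hdeg : (minpoly κ t').natDegree = p := by
    rw [hmin, Polynomial.natDegree_X_pow_sub_C]
  have hli : LinearIndependent κ fun i : Fin p => t' ^ (i : ℕ) := by
    have := linearIndependent_pow (K := κ) t'
    rwa [hdeg] at this
  have hspan : Submodule.span κ (Set.range fun i : Fin p => t' ^ (i : ℕ)) = ⊤ :=
    hli.span_eq_top_of_card_eq_finrank' (by
      refine le_antisymm ?_ (by simpa using hfin)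
      exact hli.fintype_card_le_finrank)
  obtain ⟨c, hc⟩ := (Submodule.mem_span_range_iff_exists_fun κ).1
    (hspan.symm ▸ Submodule.mem_top (x := (show PthRootField p κ from u)))
  refine ⟨c, hc.symm.trans (Finset.sum_congr rfl fun i _ => ?_)⟩
  rw [Algebra.smul_def, hmap]
  rfl

/-- A finite field is perfect, so the coefficients of a polynomial are already `p`-th powers, and
`F(T)^{1/p}` is generated over `F(T)` by `T^{1/p}` alone. -/
lemma finrank_pthRootField_ratFunc_le (F : Type*) [Field F] [Finite F] [CharP (RatFunc F) p] :
    FiniteDimensional (RatFunc F) (PthRootField p (RatFunc F)) ∧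
    Module.finrank (RatFunc F) (PthRootField p (RatFunc F)) ≤ p := by
  have hmap (c : RatFunc F) :
      algebraMap (RatFunc F) (PthRootField p (RatFunc F)) c = (c ^ p : RatFunc F) := rfl
  have hF : CharP F p :=
    ((algebraMap F (RatFunc F)).charP_iff (algebraMap F (RatFunc F)).injective p).2 inferInstance
  let T : PthRootField p (RatFunc F) := (RatFunc.X : RatFunc F)
  have hTp : T ^ p = algebraMap (RatFunc F) (PthRootField p (RatFunc F)) RatFunc.X :=
    (hmap _).symm
  have hint : _root_.IsIntegral (RatFunc F) T := by
    refine ⟨Polynomial.X ^ p - Polynomial.C RatFunc.X,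
      Polynomial.monic_X_pow_sub_C _ hp.out.ne_zero, ?_⟩
    simp [hTp]
  have hdeg : (minpoly (RatFunc F) T).natDegree ≤ p := by
    have := Polynomial.natDegree_le_of_dvd (minpoly.dvd (RatFunc F) T
      (p := Polynomial.X ^ p - Polynomial.C RatFunc.X) (by simp [hTp]))
      (Polynomial.monic_X_pow_sub_C _ hp.out.ne_zero).ne_zero
    rwa [Polynomial.natDegree_X_pow_sub_C] at this
  have htop : IntermediateField.adjoin (RatFunc F) {T} = ⊤ := by
    have hpoly (q : Polynomial F) : (show PthRootField p (RatFunc F) from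
        algebraMap (Polynomial F) (RatFunc F) q) ∈
        IntermediateField.adjoin (RatFunc F) {T} := by
      induction q using Polynomial.induction_on' with
      | add q r hq hr =>
        have : (show PthRootField p (RatFunc F) from algebraMap (Polynomial F) (RatFunc F) (q + r))
          = (show PthRootField p (RatFunc F) from algebraMap (Polynomial F) (RatFunc F) q) +
            (show PthRootField p (RatFunc F) from algebraMap (Polynomial F) (RatFunc F) r) :=
          map_add (algebraMap (Polynomial F) (RatFunc F)) q r
        rw [this]; exact add_mem hq hr
      | monomial n a =>
        obtain ⟨b, rfl⟩ : ∃ b, b ^ p = a := surjective_frobenius F p a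
        have h1 : algebraMap (Polynomial F) (RatFunc F) (Polynomial.monomial n (b ^ p)) =
            RatFunc.C b ^ p * RatFunc.X ^ n := by
          rw [← Polynomial.C_mul_X_pow_eq_monomial, map_mul, map_pow, map_pow, map_pow,
            RatFunc.algebraMap_X,
            RatFunc.algebraMap_C]
        have : (show PthRootField p (RatFunc F) from
            algebraMap (Polynomial F) (RatFunc F) (Polynomial.monomial n (b ^ p))) =
            algebraMap (RatFunc F) (PthRootField p (RatFunc F)) (RatFunc.C b) * T ^ n := h1
        rw [this]
        exact mul_mem (IntermediateField.algebraMap_mem _ _)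
          (pow_mem (IntermediateField.mem_adjoin_simple_self (RatFunc F) T) n)
    rw [eq_top_iff]
    rintro u -
    have h1 := (RatFunc.num_div_denom (show RatFunc F from u)).symm
    have : u = (show PthRootField p (RatFunc F) from
        algebraMap (Polynomial F) (RatFunc F) (RatFunc.num u)) /
          (show PthRootField p (RatFunc F) from
        algebraMap (Polynomial F) (RatFunc F) (RatFunc.denom u)) := h1
    rw [this]
    exact div_mem (hpoly _) (hpoly _)
  have hfd := IntermediateField.adjoin.finiteDimensional hint
  have hfr := IntermediateField.adjoin.finrank hint
  rw [htop] at hfd hfr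
  refine ⟨Module.Finite.equiv (IntermediateField.topEquiv (F := RatFunc F)
    (E := PthRootField p (RatFunc F))).toLinearEquiv, ?_⟩
  rw [← LinearEquiv.finrank_eq (IntermediateField.topEquiv (F := RatFunc F)
    (E := PthRootField p (RatFunc F))).toLinearEquiv, hfr]
  exact hdeg

/-- The degree `[K : K^p]` does not grow under finite extensions. -/
lemma finrank_pthRootField_le_of_finite (E : Type*) (K : Type u) [Field E] [Field K] [CharP E p]
    [CharP K p] [Algebra E K] [FiniteDimensional E K]
    (h1 : FiniteDimensional E (PthRootField p E)) :
    FiniteDimensional K (PthRootField p K) ∧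
      Module.finrank K (PthRootField p K) ≤ Module.finrank E (PthRootField p E) := by
  let : Algebra (PthRootField p E) (PthRootField p K) := inferInstanceAs (Algebra E K)
  let : Algebra E (PthRootField p K) :=
    ((algebraMap (PthRootField p E) (PthRootField p K)).comp
      (algebraMap E (PthRootField p E))).toAlgebra
  have : IsScalarTower E (PthRootField p E) (PthRootField p K) :=
    IsScalarTower.of_algebraMap_eq fun _ => rfl
  have : IsScalarTower E K (PthRootField p K) := IsScalarTower.of_algebraMap_eq fun x =>
    (map_pow (algebraMap E K) x p)
  have hfin : FiniteDimensional (PthRootField p E) (PthRootField p K) :=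
    inferInstanceAs (FiniteDimensional E K)
  have hfr : Module.finrank (PthRootField p E) (PthRootField p K) = Module.finrank E K := rfl
  have : FiniteDimensional E (PthRootField p K) := Module.Finite.trans (PthRootField p E) _
  refine ⟨.right E K _, ?_⟩
  -- `[K^{1/p} : E]` is computed through `K` and through `E^{1/p}`; since `[K^{1/p} : E^{1/p}] = [K
  -- : E]`, this common factor cancels.
  have e1 := Module.finrank_mul_finrank E K (PthRootField p K)
  have e2 := Module.finrank_mul_finrank E (PthRootField p E) (PthRootField p K)
  rw [← e2, hfr, mul_comm] at e1
  exact (Nat.eq_of_mul_eq_mul_right (Module.finrank_pos (R := E) (M := K)) e1).le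

end PBasis

/-! ### The derivation attached to a one-element `p`-basis -/

section Derivation

variable (p : ℕ) [hp : Fact p.Prime]

/-- Frobenius raises distances to the `p`-th power, so the `p`-th roots of a Cauchy sequence form a
Cauchy sequence. Completeness of `L^p` makes finite-dimensional `L^p`-subspaces closed and
`L^p`-linear maps on them continuous. -/
instance completeSpace_pthPowers (L : Type u) [NontriviallyNormedField L] [CompleteSpace L]
    [CharP L p] : CompleteSpace (pthPowers p L) := by
  refine Metric.complete_of_cauchySeq_tendsto fun u hu => ?_
  choose w hw using fun n => (u n).2
  have hdist (m n : ℕ) : dist (u m) (u n) = dist (w m) (w n) ^ p := by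
    rw [Subtype.dist_eq, ← hw, ← hw, dist_eq_norm, ← map_sub, frobenius_def, norm_pow,
      ← dist_eq_norm]
  have hc : CauchySeq w := by
    refine Metric.cauchySeq_iff'.2 fun ε hε => ?_
    obtain ⟨N, hN⟩ := Metric.cauchySeq_iff'.1 hu (ε ^ p) (by positivity)
    refine ⟨N, fun n hn => ?_⟩
    have := hN n hn
    rw [hdist] at this
    exact lt_of_pow_lt_pow_left₀ p hε.le this
  obtain ⟨a, ha⟩ := cauchySeq_tendsto_of_complete hc
  refine ⟨⟨frobenius L p a, a, rfl⟩, ?_⟩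
  rw [tendsto_subtype_rng]
  have : Tendsto (fun n => w n ^ p) atTop (𝓝 (a ^ p)) := ha.pow p
  refine this.congr fun n => ?_
  rw [← hw]; rfl

variable (K L : Type u) [Field K] [NontriviallyNormedField L] [CharP L p] [Algebra K L]

/-- The element `t` of `K` is a `p`-basis of both `K` and `L`: it is not a `p`-th power in `L`, its
powers span `K` over `K^p`, and they span `L` over `L^p`. -/
structure IsPBasis (t : K) : Prop where
  notMem : algebraMap K L t ∉ pthPowers p L
  exists_eq_sum : ∀ u : K, ∃ c : Fin p → K, u = ∑ i, c i ^ p * t ^ (i : ℕ)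
  exists_eq_sum' : ∀ u : L, ∃ c : Fin p → L, u = ∑ i, c i ^ p * algebraMap K L t ^ (i : ℕ)

variable {K L p}

lemma smul_pthPowers (c : pthPowers p L) (x : L) : c • x = (c : L) * x := rfl

/-- The `L^p`-span of the powers of `t` is finite-dimensional, hence closed, and it contains the
dense subfield `K`. -/
lemma IsPBasis.of_dense [CompleteSpace L] {t : K} (ht : algebraMap K L t ∉ pthPowers p L)
    (hK : ∀ u : K, ∃ c : Fin p → K, u = ∑ i, c i ^ p * t ^ (i : ℕ))
    (hd : DenseRange (algebraMap K L)) : IsPBasis p K L t := by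
  refine ⟨ht, hK, fun u => ?_⟩
  let S : Submodule (pthPowers p L) L :=
    Submodule.span (pthPowers p L) (Set.range fun i : Fin p => algebraMap K L t ^ (i : ℕ))
  have : FiniteDimensional (pthPowers p L) S := FiniteDimensional.span_of_finite _
    (Set.finite_range _)
  have hS : IsClosed (S : Set L) := S.closed_of_finiteDimensional
  have huS : u ∈ S := by
    refine hd.induction_on (p := fun u => u ∈ S) u hS fun v => ?_
    obtain ⟨c, hc⟩ := hK v
    rw [hc, map_sum]
    refine S.sum_mem fun i _ => ?_
    rw [map_mul, map_pow, map_pow]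
    exact S.smul_mem (⟨algebraMap K L (c i) ^ p, algebraMap K L (c i), rfl⟩ : pthPowers p L)
      (Submodule.subset_span ⟨i, rfl⟩)
  obtain ⟨c, hc⟩ := (Submodule.mem_span_range_iff_exists_fun _).1 huS
  choose w hw using fun i => (c i).2
  refine ⟨w, hc.symm.trans (Finset.sum_congr rfl fun i _ => ?_)⟩
  exact congrArg (· * _) (hw i).symm

/-- A continuous derivation of `L` with `D t = 1`, preserving `K`. -/
structure PthDerivation (p : ℕ) [Fact p.Prime] (K L : Type u) [Field K] [CharP K p]
    [NontriviallyNormedField L] [CharP L p] [Algebra K L] where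
  t : K
  isPBasis : IsPBasis p K L t
  toDer : Derivation ℤ L L
  toDer_t : toDer (algebraMap K L t) = 1

lemma derivation_pow_char {p : ℕ} {R M : Type*} [CommRing R] [CharP R p] [AddCommGroup M] [Module R M]
    (D : Derivation ℤ R M) (x : R) : D (x ^ p) = 0 := by
  rw [D.leibniz_pow, ← smul_assoc]
  simp

lemma derivation_sum {p : ℕ} {R M : Type*} [CommRing R] [CharP R p] [AddCommGroup M] [Module R M]
    (D : Derivation ℤ R M) (c : Fin p → R) (t : R) : D (∑ i, c i ^ p * t ^ (i : ℕ)) =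
      (∑ i, c i ^ p * ((i : ℕ) * t ^ ((i : ℕ) - 1))) • D t := by
  rw [map_sum, Finset.sum_smul]
  refine Finset.sum_congr rfl fun i _ => ?_
  rw [D.leibniz, derivation_pow_char (p := p), smul_zero, add_zero, D.leibniz_pow, mul_smul, mul_smul,
    Nat.cast_smul_eq_nsmul]

/-- For an inseparable extension `L/M` of exponent one generated by `t`, `dt ≠ 0` in
`Ω_{L/M}`. -/
lemma exists_derivation_of_notMem {M L : Type*} [Field M] [Field L] [CharP L p] [Algebra M L]
    (hpM : ∀ x : L, x ^ p ∈ (algebraMap M L).range) {t : L} (ht : t ∉ (algebraMap M L).range)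
    (hadj : Algebra.adjoin M {t} = ⊤) :
    ∃ D : Derivation M L L, D t = 1 := by
  have hft : Algebra.FiniteType M L := ⟨⟨{t}, by simpa using hadj⟩⟩
  have hspan : Submodule.span L {KaehlerDifferential.D M L t} = ⊤ := by
    rw [eq_top_iff, ← KaehlerDifferential.span_range_derivation, Submodule.span_le]
    rintro _ ⟨u, rfl⟩
    have hu : u ∈ Algebra.adjoin M {t} := hadj ▸ Algebra.mem_top
    induction hu using Algebra.adjoin_induction with
    | mem x hx => rw [Set.mem_singleton_iff.1 hx]; exact Submodule.mem_span_singleton_self _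
    | algebraMap r => rw [Derivation.map_algebraMap]; exact Submodule.zero_mem _
    | add x y _ _ hx hy => rw [map_add]; exact Submodule.add_mem _ hx hy
    | mul x y _ _ hx hy =>
      rw [Derivation.leibniz]
      exact Submodule.add_mem _ (Submodule.smul_mem _ _ hy) (Submodule.smul_mem _ _ hx)
  have hne : KaehlerDifferential.D M L t ≠ 0 := by
    -- If `dt = 0` then `Ω[L⁄M] = 0`, so `L/M` is separable as well as purely inseparable; then `L =
    -- M`, contrary to `t ∉ M`.
    intro h0
    rw [h0, Submodule.span_zero_singleton] at hspan
    have hsub : Subsingleton (Ω[L⁄M]) := by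
      refine ⟨fun a b => ?_⟩
      have ha : a ∈ (⊥ : Submodule L (Ω[L⁄M])) := hspan ▸ Submodule.mem_top
      have hb : b ∈ (⊥ : Submodule L (Ω[L⁄M])) := hspan ▸ Submodule.mem_top
      rw [(Submodule.mem_bot L).1 ha, (Submodule.mem_bot L).1 hb]
    have : Algebra.FormallyUnramified M L := ⟨hsub⟩
    have hsep := Algebra.FormallyUnramified.isSeparable M L
    have : CharP M p := ((algebraMap M L).charP_iff (algebraMap M L).injective p).2 inferInstance
    have hpi : IsPurelyInseparable M L :=
      (isPurelyInseparable_iff_pow_mem M p).2 fun x => ⟨1, by simpa using hpM x⟩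
    exact ht (IsPurelyInseparable.surjective_algebraMap_of_isSeparable M L t)
  obtain ⟨φ, hφ⟩ := Module.Projective.exists_dual_ne_zero L hne
  refine ⟨((φ (KaehlerDifferential.D M L t))⁻¹ • φ).compDer (KaehlerDifferential.D M L), ?_⟩
  simp [inv_mul_cancel₀ hφ]

variable [CharP K p]

lemma IsPBasis.exists_pthDerivation {t : K} (h : IsPBasis p K L t) :
    ∃ d : PthDerivation p K L, d.t = t := by
  obtain ⟨D, hD⟩ := exists_derivation_of_notMem (p := p) (M := pthPowers p L)
    (t := algebraMap K L t)
    (fun x => ⟨⟨x ^ p, x, rfl⟩, rfl⟩) (fun hy => by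
      obtain ⟨y, hy⟩ := hy
      exact h.notMem (by rw [← hy]; exact y.2)) (by
      refine eq_top_iff.2 fun u _ => ?_
      obtain ⟨c, rfl⟩ := h.exists_eq_sum' u
      exact sum_mem fun i _ => mul_mem
        ((Algebra.adjoin (pthPowers p L) _).algebraMap_mem ⟨c i ^ p, c i, rfl⟩)
        (pow_mem (Algebra.self_mem_adjoin_singleton _ _) _))
  exact ⟨⟨t, h, D.restrictScalars ℤ, hD⟩, rfl⟩

namespace PthDerivation

variable (d : PthDerivation p K L)

/-- The expansion of `u` in powers of `t` has coefficients in `K^p`, so one formal derivative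
computes both the derivation and `du`. In particular `Ω_K` is spanned by `dt`. -/
lemma map_algebraMap (u : K) : ∃ w : K, d.toDer (algebraMap K L u) = algebraMap K L w ∧
    KaehlerDifferential.D ℤ K u = w • KaehlerDifferential.D ℤ K d.t := by
  obtain ⟨c, rfl⟩ := d.isPBasis.exists_eq_sum u
  refine ⟨∑ i, c i ^ p * ((i : ℕ) * d.t ^ ((i : ℕ) - 1)), ?_, derivation_sum _ _ _⟩
  simp only [map_sum, map_mul, map_pow, map_natCast]
  have := derivation_sum d.toDer (fun i => algebraMap K L (c i)) (algebraMap K L d.t)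
  rw [map_sum] at this
  rw [this, d.toDer_t, smul_eq_mul, mul_one]

lemma D_eq (u : L) : KaehlerDifferential.D ℤ L u =
    d.toDer u • KaehlerDifferential.D ℤ L (algebraMap K L d.t) := by
  obtain ⟨c, rfl⟩ := d.isPBasis.exists_eq_sum' u
  rw [derivation_sum, derivation_sum, d.toDer_t, smul_eq_mul, mul_one]

/-- `Ω_L` is spanned by `dt`, whose value is `1`, so a form is its own value times `dt`. This turns
an equality of differentials into an equation in `L`. -/
lemma eq_zero_of_lift_eq_zero {ω : Ω[L⁄ℤ]} (hω : d.toDer.liftKaehlerDifferential ω = 0) :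
    ω = 0 := by
  have key (ω : Ω[L⁄ℤ]) : ω = d.toDer.liftKaehlerDifferential ω •
      KaehlerDifferential.D ℤ L (algebraMap K L d.t) := by
    have : ω ∈ Submodule.span L (Set.range (KaehlerDifferential.D ℤ L)) := by
      rw [KaehlerDifferential.span_range_derivation]; trivial
    induction this using Submodule.span_induction with
    | mem x hx =>
      obtain ⟨u, rfl⟩ := hx
      rw [Derivation.liftKaehlerDifferential_comp_D]
      exact d.D_eq u
    | zero => simp
    | add x y _ _ hx hy => rw [map_add, add_smul, ← hx, ← hy]
    | smul a x _ hx => rw [map_smul, smul_eq_mul, mul_smul, ← hx]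
  rw [key ω, hω, zero_smul]

/-- The derivation as a linear map over `L^p`. -/
def toLin : L →ₗ[pthPowers p L] L where
  toFun := d.toDer
  map_add' := map_add _
  map_smul' c x := by
    obtain ⟨w, hw⟩ := c.2
    rw [smul_pthPowers, Derivation.leibniz, ← hw, frobenius_def, derivation_pow_char (p := p), smul_zero,
      add_zero, RingHom.id_apply, smul_pthPowers, ← hw, frobenius_def, smul_eq_mul]

lemma finiteDimensional (d : PthDerivation p K L) : FiniteDimensional (pthPowers p L) L := by
  classical
  refine ⟨⟨(Finset.univ.image fun i : Fin p => algebraMap K L d.t ^ (i : ℕ)), ?_⟩⟩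
  rw [eq_top_iff]
  rintro u -
  obtain ⟨c, rfl⟩ := d.isPBasis.exists_eq_sum' u
  refine Submodule.sum_mem _ fun i _ => ?_
  exact Submodule.smul_mem _ (⟨c i ^ p, c i, rfl⟩ : pthPowers p L)
    (Submodule.subset_span (by simp))

variable [CompleteSpace L]

/-- The derivation as a continuous linear map over `L^p`. -/
def toCLM : L →L[pthPowers p L] L :=
  haveI := d.finiteDimensional
  LinearMap.toContinuousLinearMap d.toLin

lemma toCLM_apply (x : L) : d.toCLM x = d.toDer x := rfl

end PthDerivation

/-- Every subfield of `L` that contains `K` is separable over `K`. -/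
lemma IsPBasis.isSeparableExt {t : K} (h : IsPBasis p K L t) {κ : Type u} [Field κ]
    (ι : K →+* κ) (ρ : κ →+* L) (hρ : ρ.comp ι = algebraMap K L) : IsSeparableExt p ι := by
  let : Algebra K κ := ι.toAlgebra
  have hι (c : K) : algebraMap K κ c = ι c := rfl
  have hρι (c : K) : ρ (ι c) = algebraMap K L c := RingHom.congr_fun hρ c
  have : CharP κ p := charP_of_injective_algebraMap ι.injective p
  let : Algebra K (PthRootField p L) :=
    ((algebraMap L (PthRootField p L)).comp (algebraMap K L)).toAlgebra
  let f₁ : κ →ₐ[K] PthRootField p L :=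
    { ((algebraMap L (PthRootField p L)).comp ρ) with
      commutes' := fun c => congrArg (algebraMap L (PthRootField p L)) (hρι c) }
  let f₂ : PthRootField p K →ₐ[K] PthRootField p L :=
    { (algebraMap K L : K →+* L) with
      commutes' := fun c => map_pow (algebraMap K L) c p }
  -- The tensor product is reduced because it embeds in the field `L^{1/p}`: the powers of `t^{1/p}`
  -- generate it over `κ`, and they stay linearly independent over `L`.
  let Φ : κ ⊗[K] PthRootField p K →ₐ[K] PthRootField p L :=
    Algebra.TensorProduct.lift f₁ f₂ fun _ _ => Commute.all _ _
  have hΦ (a : κ) (b : PthRootField p K) :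
      Φ (a ⊗ₜ b) = ((ρ a) ^ p * algebraMap K L (show K from b) : L) :=
    Algebra.TensorProduct.lift_tmul _ _ _ _ _
  let t' : PthRootField p K := t
  have hrep (z : κ ⊗[K] PthRootField p K) : ∃ a : Fin p → κ, z = ∑ i, a i ⊗ₜ (t' ^ (i : ℕ)) := by
    induction z with
    | zero => exact ⟨0, by simp⟩
    | add x y hx hy =>
      obtain ⟨a, rfl⟩ := hx
      obtain ⟨b, rfl⟩ := hy
      exact ⟨a + b, by simp [TensorProduct.add_tmul, Finset.sum_add_distrib]⟩
    | tmul a b =>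
      obtain ⟨c, hc⟩ := h.exists_eq_sum (show K from b)
      refine ⟨fun i => c i • a, ?_⟩
      have : b = ∑ i, c i • t' ^ (i : ℕ) := by
        refine hc.trans (Finset.sum_congr rfl fun i _ => ?_)
        rw [Algebra.smul_def]; rfl
      rw [this, TensorProduct.tmul_sum]
      exact Finset.sum_congr rfl fun i _ => (TensorProduct.smul_tmul _ _ _).symm
  have hli : LinearIndependent (pthPowers p L) fun i : Fin p => algebraMap K L t ^ (i : ℕ) := by
    have hirr : Irreducible (Polynomial.X ^ p - Polynomial.C ⟨algebraMap K L t ^ p, _, rfl⟩ :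
        Polynomial (pthPowers p L)) :=
      X_pow_sub_C_irreducible_of_prime hp.out fun b hb => h.notMem (by
        have h2 : (b : L) ^ p = algebraMap K L t ^ p := congrArg Subtype.val hb
        rw [← frobenius_inj L p h2]
        exact b.2)
    have hmin : minpoly (pthPowers p L) (algebraMap K L t) = _ :=
      (minpoly.eq_of_irreducible_of_monic hirr (by
        simp only [map_sub, map_pow, Polynomial.aeval_X, Polynomial.aeval_C]
        exact sub_self _) (Polynomial.monic_X_pow_sub_C _ hp.out.ne_zero)).symm
    have := linearIndependent_pow (K := pthPowers p L) (algebraMap K L t)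
    rwa [hmin, Polynomial.natDegree_X_pow_sub_C] at this
  have hinj : Function.Injective Φ := by
    refine (injective_iff_map_eq_zero Φ).2 fun z hz => ?_
    obtain ⟨a, rfl⟩ := hrep z
    rw [map_sum] at hz
    have hz' : ∑ i, (⟨ρ (a i) ^ p, ρ (a i), rfl⟩ : pthPowers p L) •
        algebraMap K L t ^ (i : ℕ) = 0 := by
      refine Eq.trans (Finset.sum_congr rfl fun i _ => ?_) hz
      refine Eq.trans ?_ (hΦ _ _).symm
      exact congrArg (ρ (a i) ^ p * ·) (map_pow (algebraMap K L) t _).symm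
    have h0 := Fintype.linearIndependent_iff.1 hli _ hz'
    refine Finset.sum_eq_zero fun i _ => ?_
    have h1 : ρ (a i) ^ p = 0 := congrArg Subtype.val (h0 i)
    have h2 : a i = 0 := by
      simpa using pow_eq_zero_iff hp.out.ne_zero |>.1 h1
    rw [h2, TensorProduct.zero_tmul]
  change IsReduced (κ ⊗[K] PthRootField p K)
  exact isReduced_of_injective Φ hinj

end Derivation

/-! ### Discrete value groups and the `p`-basis of a completion -/

section Discrete

/-- Images of natural numbers are fixed by Frobenius, so their norms satisfy `r ^ p = r` and are at
most `1`. -/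
lemma isUltrametricDist_of_charP (p : ℕ) [hp : Fact p.Prime] (L : Type*) [NormedField L]
    [CharP L p] : IsUltrametricDist L := by
  refine IsUltrametricDist.isUltrametricDist_of_forall_norm_natCast_le_one fun n => ?_
  have h1 : ((n : L)) ^ p = n := by
    have := map_natCast (frobenius L p) n
    rwa [frobenius_def] at this
  by_contra! h
  have h2 : ‖(n : L)‖ ^ p = ‖(n : L)‖ := by rw [← norm_pow, h1]
  have h3 : ‖(n : L)‖ ^ 1 < ‖(n : L)‖ ^ p := pow_lt_pow_right₀ h hp.out.one_lt
  rw [h2, pow_one] at h3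
  exact lt_irrefl _ h3

/-- In an ultrametric group the term of largest norm dominates when all the norms are distinct. -/
lemma exists_norm_sum_eq {ι M : Type*} [SeminormedAddCommGroup M] [IsUltrametricDist M]
    {s : Finset ι} (hs : s.Nonempty) (a : ι → M) (h : Set.InjOn (fun i => ‖a i‖) s) :
    ∃ i ∈ s, ‖∑ j ∈ s, a j‖ = ‖a i‖ := by
  induction hs using Finset.Nonempty.cons_induction with
  | singleton i => exact ⟨i, by simp⟩
  | cons i s hi hs ih =>
    obtain ⟨j, hj, hj'⟩ := ih (h.mono fun x hx => Finset.mem_cons_of_mem hx)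
    have hne : ‖a i‖ ≠ ‖∑ k ∈ s, a k‖ := by
      rw [hj']
      intro he
      have := h (Finset.mem_cons_self i s) (Finset.mem_cons_of_mem hj) he
      exact hi (this ▸ hj)
    rw [Finset.sum_cons, IsUltrametricDist.norm_add_eq_max_of_norm_ne_norm hne]
    rcases max_choice ‖a i‖ ‖∑ k ∈ s, a k‖ with h' | h'
    · exact ⟨i, Finset.mem_cons_self i s, h'⟩
    · exact ⟨j, Finset.mem_cons_of_mem hj, h'.trans hj'⟩

variable (F : Type*) [Field F] [Finite F] {L : Type*} [NormedField L]

variable {F} in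
lemma norm_eq_one_of_finite (φ : F →+* L) {a : F} (ha : a ≠ 0) : ‖φ a‖ = 1 := by
  have h1 : a ^ (Nat.card F - 1) = 1 := by
    have := Fintype.ofFinite F
    rw [Nat.card_eq_fintype_card]
    exact FiniteField.pow_card_sub_one_eq_one a ha
  have h2 : ‖φ a‖ ^ (Nat.card F - 1) = 1 := by
    rw [← norm_pow, ← map_pow, h1, map_one, norm_one]
  exact (pow_eq_one_iff_of_nonneg (norm_nonneg _)
    (Nat.sub_pos_of_lt Finite.one_lt_card).ne').1 h2

variable [IsUltrametricDist L]

/-- Ultrametric absolute values of `F[T]`, `F` finite, have cyclic value groups. -/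
lemma exists_norm_polynomial_eq_zpow (φ : Polynomial F →+* L) (hφ : Function.Injective φ) :
    ∃ c : ℝ, 0 < c ∧ ∀ P : Polynomial F, P ≠ 0 → ∃ k : ℤ, ‖φ P‖ = c ^ k := by
  have hcoef (a : F) (ha : a ≠ 0) : ‖φ (Polynomial.C a)‖ = 1 :=
    norm_eq_one_of_finite (φ.comp Polynomial.C) ha
  have hsum (P : Polynomial F) : φ P = ∑ i ∈ P.support, φ (Polynomial.C (P.coeff i)) *
      φ Polynomial.X ^ i := by
    conv_lhs => rw [P.as_sum_support_C_mul_X_pow, map_sum]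
    simp
  -- The place at infinity: the monomials of a polynomial have distinct norms, so the leading one
  -- wins and `‖T‖` generates the values.
  by_cases hT : 1 < ‖φ Polynomial.X‖
  · refine ⟨‖φ Polynomial.X‖, one_pos.trans hT, fun P hP => ?_⟩
    have hn (i) (hi : i ∈ P.support) :
        ‖φ (Polynomial.C (P.coeff i)) * φ Polynomial.X ^ i‖ = ‖φ Polynomial.X‖ ^ i := by
      rw [norm_mul, hcoef _ (Polynomial.mem_support_iff.1 hi), one_mul, norm_pow]
    obtain ⟨i, hi, h⟩ := exists_norm_sum_eq (Polynomial.support_nonempty.2 hP)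
      (fun i => φ (Polynomial.C (P.coeff i)) * φ Polynomial.X ^ i) (by
        intro i hi j hj hij
        simp only [hn i hi, hn j hj] at hij
        exact pow_right_injective₀ (one_pos.trans hT) hT.ne' hij)
    rw [hn i hi] at h
    exact ⟨i, by rw [hsum, h, zpow_natCast]⟩
  · push Not at hT
    have hle (P : Polynomial F) : ‖φ P‖ ≤ 1 := by
      rcases eq_or_ne P 0 with rfl | hP
      · simp
      obtain ⟨i, hi, h⟩ := IsUltrametricDist.exists_norm_finsetSum_le_of_nonempty
        (Polynomial.support_nonempty.2 hP)
        (fun i => φ (Polynomial.C (P.coeff i)) * φ Polynomial.X ^ i)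
      rw [hsum]
      refine h.trans ?_
      rw [norm_mul, hcoef _ (Polynomial.mem_support_iff.1 hi), one_mul, norm_pow]
      exact pow_le_one₀ (norm_nonneg _) hT
    -- A finite place: `π` is chosen of least degree among polynomials of norm less than `1`. A
    -- polynomial prime to `π` differs by a small multiple of `π` from a remainder of norm `1`, so
    -- only the power of `π` matters. If there is no such `π`, all values are `1`.
    by_cases hex : ∃ π : Polynomial F, π ≠ 0 ∧ ‖φ π‖ < 1
    · have hn : ∃ n, ∃ π : Polynomial F, π.natDegree = n ∧ π ≠ 0 ∧ ‖φ π‖ < 1 := by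
        obtain ⟨π, h⟩ := hex
        exact ⟨_, π, rfl, h⟩
      classical
      obtain ⟨π, hdeg, hπ0, hπ⟩ := Nat.find_spec hn
      have hmin (Q : Polynomial F) (hQ : Q ≠ 0) (hd : Q.natDegree < π.natDegree) :
          ‖φ Q‖ = 1 := by
        rw [hdeg] at hd
        have := Nat.find_min hn hd
        push Not at this
        exact le_antisymm (hle Q) (this Q rfl hQ)
      have hd0 : π.natDegree ≠ 0 := by
        intro h0
        rw [Polynomial.natDegree_eq_zero] at h0
        obtain ⟨a, rfl⟩ := h0
        rw [hcoef a (by simpa using hπ0)] at hπ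
        exact lt_irrefl _ hπ
      have hunit : ¬ IsUnit π := fun h => hd0 (Polynomial.natDegree_eq_zero_of_isUnit h)
      refine ⟨‖φ π‖, norm_pos_iff.2 (by simpa using hφ.ne hπ0), fun P hP => ?_⟩
      obtain ⟨k, Q, hQ, rfl⟩ := WfDvdMonoid.max_power_factor' hP hunit
      refine ⟨k, ?_⟩
      have hr : Q % π ≠ 0 := fun h => hQ ((EuclideanDomain.mod_eq_zero).1 h)
      have hQ1 : ‖φ Q‖ = 1 := by
        rw [← EuclideanDomain.div_add_mod Q π, map_add, map_mul]
        have h1 : ‖φ (Q % π)‖ = 1 := hmin _ hr (Polynomial.natDegree_mod_lt Q hd0)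
        have h2 : ‖φ π * φ (Q / π)‖ < 1 := by
          rw [norm_mul]
          exact mul_lt_one_of_nonneg_of_lt_one_left (norm_nonneg _) hπ (hle _)
        rw [IsUltrametricDist.norm_add_eq_max_of_norm_ne_norm (by rw [h1]; exact h2.ne), h1]
        exact max_eq_right h2.le
      rw [map_mul, map_pow, norm_mul, norm_pow, hQ1, mul_one, zpow_natCast]
    · push Not at hex
      exact ⟨1, one_pos, fun P hP => ⟨0, by simpa using le_antisymm (hle P) (hex P hP)⟩⟩

/-- Ultrametric absolute values of global function fields have discrete value groups. -/
lemma exists_pow_norm_eq_zpow (K : Type*) [Field K] [Algebra (RatFunc F) K] [FunctionField F K]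
    (φ : K →+* L) : ∃ (c : ℝ) (N : ℕ), 0 < c ∧ 0 < N ∧
      ∀ y : K, y ≠ 0 → ∃ k : ℤ, ‖φ y‖ ^ N = c ^ k := by
  let ψ : RatFunc F →+* L := φ.comp (algebraMap (RatFunc F) K)
  obtain ⟨c, hc, h⟩ := exists_norm_polynomial_eq_zpow F
    (ψ.comp (algebraMap (Polynomial F) (RatFunc F)))
    (ψ.injective.comp (RatFunc.algebraMap_injective F))
  have hE (a : RatFunc F) (ha : a ≠ 0) : ∃ k : ℤ, ‖ψ a‖ = c ^ k := by
    obtain ⟨k, hk⟩ := h a.num (RatFunc.num_ne_zero ha)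
    obtain ⟨l, hl⟩ := h a.denom (RatFunc.denom_ne_zero a)
    refine ⟨k - l, ?_⟩
    rw [← RatFunc.num_div_denom a, map_div₀, norm_div, zpow_sub₀ hc.ne', ← hk, ← hl]
    rfl
  set n := Module.finrank (RatFunc F) K
  -- The exponent found for `y` is a difference of two degrees in its minimal polynomial, at most
  -- `n`; the factorial is a common multiple of all of them.
  refine ⟨c, n.factorial, hc, n.factorial_pos, fun y hy => ?_⟩
  have hint : _root_.IsIntegral (RatFunc F) y := Algebra.IsIntegral.isIntegral y
  set m := minpoly (RatFunc F) y
  -- The terms of the minimal equation of `y` sum to zero, so two of them have the same norm.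
  -- Comparing these puts a power of `‖y‖` in the value group of `F(T)`.
  have hterm : ¬ Set.InjOn (fun i => ‖ψ (m.coeff i) * φ y ^ i‖) m.support := by
    intro hinj
    obtain ⟨i, hi, h'⟩ := exists_norm_sum_eq
      (Polynomial.support_nonempty.2 (minpoly.ne_zero hint)) _ hinj
    have h0 : ∑ i ∈ m.support, ψ (m.coeff i) * φ y ^ i = 0 := by
      have := congrArg φ (minpoly.aeval (RatFunc F) y)
      rw [Polynomial.aeval_eq_sum_range, map_sum, map_zero] at this
      rw [← this, Finset.sum_subset (s₁ := m.support) (s₂ := Finset.range (m.natDegree + 1))]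
      · exact Finset.sum_congr rfl fun i _ => by rw [Algebra.smul_def, map_mul, map_pow]; rfl
      · exact Polynomial.supp_subset_range_natDegree_succ
      · intro i _ hi
        rw [Polynomial.notMem_support_iff.1 hi, map_zero, zero_mul]
    rw [h0, norm_zero, eq_comm, norm_eq_zero, mul_eq_zero] at h'
    rcases h' with h' | h'
    · exact Polynomial.mem_support_iff.1 hi (by simpa using h')
    · exact hy ((map_eq_zero φ).1 (by
        by_contra h0; exact pow_ne_zero i h0 h'))
  simp only [Set.InjOn, not_forall] at hterm
  obtain ⟨i, hi, j, hj, hij, hne⟩ := hterm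
  wlog hlt : i < j generalizing i j
  · exact this j hj i hi hij.symm (Ne.symm hne) (lt_of_le_of_ne (not_lt.1 hlt) (Ne.symm hne))
  obtain ⟨k, hk⟩ := hE _ (Polynomial.mem_support_iff.1 hi)
  obtain ⟨l, hl⟩ := hE _ (Polynomial.mem_support_iff.1 hj)
  have hy0 : ‖φ y‖ ≠ 0 := by simpa using hy
  have hpow : ‖φ y‖ ^ (j - i) = c ^ (k - l) := by
    rw [norm_mul, norm_mul, hk, hl, norm_pow, norm_pow, ← Nat.sub_add_cancel hlt.le, pow_add,
      ← mul_assoc] at hij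
    rw [zpow_sub₀ hc.ne', eq_div_iff (zpow_ne_zero _ hc.ne'), mul_comm]
    exact (mul_right_cancel₀ (pow_ne_zero _ hy0) hij).symm
  have hjn : j ≤ n := (Polynomial.le_natDegree_of_mem_supp j hj).trans (minpoly.natDegree_le y)
  obtain ⟨e, he⟩ := Nat.dvd_factorial (Nat.sub_pos_of_lt hlt) ((Nat.sub_le j i).trans hjn)
  exact ⟨(k - l) * e, by rw [he, pow_mul, hpow, zpow_mul, zpow_natCast]⟩

end Discrete

/-- Completions of global function fields have a canonical `p`-basis. -/
lemma Place.exists_isPBasis (p : ℕ) [hp : Fact p.Prime] (F : Type*) [Field F] [Finite F]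
    (K : Type u) [Field K] [CharP K p] [Algebra (RatFunc F) K] [FunctionField F K]
    (v : Place K) : DenseRange (algebraMap K v.Completion) ∧
      ∃ t : K, IsPBasis p K v.Completion t := by
  have : IsUltrametricDist v.Completion := isUltrametricDist_of_charP p _
  have hd : DenseRange (algebraMap K v.Completion) :=
    (UniformSpace.Completion.denseRange_coe (α := WithAbs v.absVal)).comp
      (WithAbs.equiv v.absVal).symm.surjective.denseRange
      (UniformSpace.Completion.continuous_coe _)
  refine ⟨hd, ?_⟩
  have hE : CharP (RatFunc F) p :=
    ((algebraMap (RatFunc F) K).charP_iff (algebraMap (RatFunc F) K).injective p).2 inferInstance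
  obtain ⟨e1, e2⟩ := finrank_pthRootField_ratFunc_le p F
  obtain ⟨e3, e4⟩ := finrank_pthRootField_le_of_finite p (RatFunc F) K e1
  suffices h : ∃ t : K, algebraMap K v.Completion t ∉ pthPowers p v.Completion by
    obtain ⟨t, ht⟩ := h
    exact ⟨t, IsPBasis.of_dense ht (exists_eq_sum_pow_mul p (e4.trans e2)
      fun ⟨s, hs⟩ => ht ⟨algebraMap K v.Completion s, by rw [← hs, RingHom.map_frobenius]⟩) hd⟩
  -- If `K ⊆ L^p`, then `L = L^p` because `L^p` is closed, and every element has `p^m`-th roots for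
  -- all `m`.
  by_contra! hall
  have hclosed : IsClosed (pthPowers p v.Completion : Set v.Completion) :=
    (completeSpace_coe_iff_isComplete.1 (completeSpace_pthPowers p v.Completion)).isClosed
  have hperf (y : v.Completion) : y ∈ pthPowers p v.Completion :=
    hd.induction_on (p := fun y => y ∈ pthPowers p v.Completion) y hclosed hall
  have hiter (m : ℕ) (y : v.Completion) : ∃ z, z ^ p ^ m = y := by
    induction m generalizing y with
    | zero => exact ⟨y, by simp⟩
    | succ m ih =>
      obtain ⟨w, hw⟩ := hperf y
      obtain ⟨z, hz⟩ := ih w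
      exact ⟨z, by rw [pow_succ, pow_mul, hz, ← hw, frobenius_def]⟩
  obtain ⟨c, N, hc, hN, hval⟩ := exists_pow_norm_eq_zpow F K (algebraMap K v.Completion)
  -- By the ultrametric inequality, `y` has the same norm as any element of `K` close enough to it.
  have hval' (y : v.Completion) (hy : y ≠ 0) : ∃ k : ℤ, ‖y‖ ^ N = c ^ k := by
    obtain ⟨x, hx⟩ := hd.exists_dist_lt y (norm_pos_iff.2 hy)
    have h1 : ‖algebraMap K v.Completion x‖ = ‖y‖ := by
      rw [dist_eq_norm] at hx
      have h2 := IsUltrametricDist.norm_eq_of_add_norm_lt_max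
        (x := y) (y := -algebraMap K v.Completion x)
        (by rw [← sub_eq_add_neg]; exact hx.trans_le (le_max_left _ _))
      rw [h2, norm_neg]
    obtain ⟨k, hk⟩ := hval x (by rintro rfl; rw [map_zero, norm_zero] at h1; exact hy (by simpa using h1.symm))
    exact ⟨k, by rw [← h1, hk]⟩
  obtain ⟨x, hx⟩ := v.absVal_isNontrivial.exists_abv_gt_one
  rw [← v.norm_toCompletion] at hx
  have hx0 : v.toCompletion x ≠ 0 := by
    rintro h; rw [h, norm_zero] at hx; linarith
  obtain ⟨k, hk⟩ := hval' _ hx0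
  have hk1 : 1 < c ^ k := hk ▸ one_lt_pow₀ hx hN.ne'
  have hk0 : k ≠ 0 := by rintro rfl; simp at hk1
  have hc1 : c ≠ 1 := by rintro rfl; simp at hk1
  -- With a root of order `p^|k|`, discreteness makes `p^|k|` divide `k ≠ 0`, impossible since `|k|
  -- < p^|k|`.
  obtain ⟨z, hz⟩ := hiter k.natAbs (v.toCompletion x)
  obtain ⟨l, hl⟩ := hval' z (by rintro rfl; rw [zero_pow (pow_pos hp.out.pos _).ne'] at hz; exact hx0 hz.symm)
  have hkl : c ^ k = c ^ (l * (p ^ k.natAbs : ℕ)) := by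
    rw [zpow_mul, ← hl, zpow_natCast, ← pow_mul, mul_comm, pow_mul, ← norm_pow, hz, hk]
  have := zpow_right_injective₀ hc hc1 hkl
  have h1 : k.natAbs < p ^ k.natAbs := Nat.lt_pow_self hp.out.one_lt
  have h2 : p ^ k.natAbs ∣ k.natAbs := by
    rw [← Int.natCast_dvd]
    exact ⟨l, by rw [mul_comm]; exact this⟩
  exact absurd (Nat.le_of_dvd (Int.natAbs_pos.2 hk0) h2) (not_le.2 h1)

/-! ### Absolute differentials and their values at points -/

section Kaehler

lemma kaehler_induction {R A : Type*} [CommRing R] [CommRing A] [Algebra R A]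
    {P : Ω[A⁄R] → Prop} (h0 : P 0)
    (hadd : ∀ x y, P x → P y → P (x + y)) (hD : ∀ a b : A, P (a • KaehlerDifferential.D R A b))
    (ω : Ω[A⁄R]) : P ω := by
  have : ω ∈ Submodule.span A (Set.range (KaehlerDifferential.D R A)) := by
    rw [KaehlerDifferential.span_range_derivation]; trivial
  induction this using Submodule.closure_induction with
  | zero => exact h0
  | add x y _ _ hx hy => exact hadd x y hx hy
  | smul_mem a x hx => obtain ⟨b, rfl⟩ := hx; exact hD a b

variable {A B C : Type*} [CommRing A] [CommRing B] [CommRing C]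

/-- The map on absolute differentials induced by a ring homomorphism. -/
def kaehlerMap (φ : A →+* B) : Ω[A⁄ℤ] →+ Ω[B⁄ℤ] :=
  letI := φ.toAlgebra
  (KaehlerDifferential.map ℤ ℤ A B).toAddMonoidHom

lemma kaehlerMap_smul (φ : A →+* B) (a : A) (ω : Ω[A⁄ℤ]) :
    kaehlerMap φ (a • ω) = φ a • kaehlerMap φ ω := by
  let := φ.toAlgebra
  exact (KaehlerDifferential.map ℤ ℤ A B).map_smul a ω

lemma kaehlerMap_D (φ : A →+* B) (a : A) :
    kaehlerMap φ (KaehlerDifferential.D ℤ A a) = KaehlerDifferential.D ℤ B (φ a) := by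
  let := φ.toAlgebra
  exact KaehlerDifferential.map_D ℤ ℤ A B a

lemma kaehlerMap_comp (φ : A →+* B) (ψ : B →+* C) (ω : Ω[A⁄ℤ]) :
    kaehlerMap (ψ.comp φ) ω = kaehlerMap ψ (kaehlerMap φ ω) := by
  induction ω using kaehler_induction with
  | h0 => simp
  | hadd x y hx hy => simp [hx, hy]
  | hD a b => simp [kaehlerMap_smul, kaehlerMap_D]

lemma kaehlerMap_injective_of_bijective {φ : A →+* B} (h : Function.Bijective φ) :
    Function.Injective (kaehlerMap φ) := by
  let e := RingEquiv.ofBijective φ h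
  have key (ω : Ω[A⁄ℤ]) : kaehlerMap (e.symm : B →+* A) (kaehlerMap φ ω) = ω := by
    induction ω using kaehler_induction with
    | h0 => simp
    | hadd x y hx hy => simp [hx, hy]
    | hD a b =>
      rw [kaehlerMap_smul, kaehlerMap_smul, kaehlerMap_D, kaehlerMap_D]
      have (a : A) : (e.symm : B →+* A) (φ a) = a := e.symm_apply_apply a
      rw [this, this]
  exact Function.LeftInverse.injective key

variable {L : Type*} [Field L] (D : Derivation ℤ L L)

/-- The evaluation of a differential form at a point, with respect to a derivation:
`∑ f dg ↦ ∑ φ(f) D(φ(g))`. -/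
def diffEval (φ : A →+* L) : Ω[A⁄ℤ] →+ L :=
  D.liftKaehlerDifferential.toAddMonoidHom.comp (kaehlerMap φ)

lemma diffEval_apply (φ : A →+* L) (ω : Ω[A⁄ℤ]) :
    diffEval D φ ω = D.liftKaehlerDifferential (kaehlerMap φ ω) := rfl

lemma diffEval_smul (φ : A →+* L) (a : A) (ω : Ω[A⁄ℤ]) :
    diffEval D φ (a • ω) = φ a * diffEval D φ ω := by
  rw [diffEval_apply, kaehlerMap_smul, map_smul]; rfl

lemma diffEval_D (φ : A →+* L) (a : A) :
    diffEval D φ (KaehlerDifferential.D ℤ A a) = D (φ a) := by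
  rw [diffEval_apply, kaehlerMap_D, Derivation.liftKaehlerDifferential_comp_D]

lemma diffEval_kaehlerMap (φ : A →+* B) (ψ : B →+* L) (ω : Ω[A⁄ℤ]) :
    diffEval D ψ (kaehlerMap φ ω) = diffEval D (ψ.comp φ) ω := by
  rw [diffEval_apply, diffEval_apply, kaehlerMap_comp]

/-- Clearing denominators in differential forms of a field. -/
lemma exists_smul_eq_kaehlerMap {κ : Type*} [Field κ] (β : A →+* κ)
    (hβ : ∀ u : κ, ∃ a b : A, β b ≠ 0 ∧ u * β b = β a) (ω : Ω[κ⁄ℤ]) :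
    ∃ (b : A) (ω' : Ω[A⁄ℤ]), β b ≠ 0 ∧ β b • ω = kaehlerMap β ω' := by
  induction ω using kaehler_induction with
  | h0 => exact ⟨1, 0, by simp, by simp⟩
  | hadd x y hx hy =>
    obtain ⟨b, ω, hb, h⟩ := hx
    obtain ⟨b', ω', hb', h'⟩ := hy
    refine ⟨b * b', b' • ω + b • ω', by simp [hb, hb'], ?_⟩
    rw [map_add, kaehlerMap_smul, kaehlerMap_smul, ← h, ← h', smul_add, smul_smul, smul_smul,
      ← map_mul, mul_comm b' b, ← map_mul]
  | hD u w =>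
    obtain ⟨a, b, hb, hw⟩ := hβ w
    obtain ⟨a', b', hb', hu⟩ := hβ u
    -- The quotient rule: for `w = a / b` one has `b² dw = b da - a db`.
    refine ⟨b' * b ^ 2, a' • (b • KaehlerDifferential.D ℤ A a - a • KaehlerDifferential.D ℤ A b),
      by simp [hb, hb'], ?_⟩
    have h1 : KaehlerDifferential.D ℤ κ (β a) =
        w • KaehlerDifferential.D ℤ κ (β b) + β b • KaehlerDifferential.D ℤ κ w := by
      rw [← hw, Derivation.leibniz]
    rw [kaehlerMap_smul, map_sub, kaehlerMap_smul, kaehlerMap_smul, kaehlerMap_D, kaehlerMap_D,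
      h1, ← hu, ← hw, smul_add, smul_smul, smul_smul, mul_comm (β b) w, add_sub_cancel_left,
      smul_smul, smul_smul, map_mul, map_pow]
    congr 1
    ring

lemma kaehler_countable [Countable A] : Countable (Ω[A⁄ℤ]) := by
  have h : Function.Surjective fun l : List (A × A) =>
      (l.map fun x => x.1 • KaehlerDifferential.D ℤ A x.2).sum := by
    intro ω
    induction ω using kaehler_induction with
    | h0 => exact ⟨[], rfl⟩
    | hadd x y hx hy =>
      obtain ⟨l, rfl⟩ := hx
      obtain ⟨m, rfl⟩ := hy
      exact ⟨l ++ m, by simp⟩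
    | hD a b => exact ⟨[(a, b)], by simp⟩
  exact h.countable

/-- Every form is a finite sum `∑ f dg`. -/
lemma exists_eq_sum_smul_D (ω : Ω[A⁄ℤ]) : ∃ (n : ℕ) (a b : Fin n → A),
    ω = ∑ i, a i • KaehlerDifferential.D ℤ A (b i) := by
  induction ω using kaehler_induction with
  | h0 => exact ⟨0, 0, 0, by simp⟩
  | hadd x y hx hy =>
    obtain ⟨n, a, b, rfl⟩ := hx
    obtain ⟨m, a', b', rfl⟩ := hy
    exact ⟨n + m, Fin.append a a', Fin.append b b', by simp [Fin.sum_univ_add]⟩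
  | hD a b => exact ⟨1, fun _ => a, fun _ => b, by simp⟩

/-- If `Ω_K` is generated by `dt` and `Ω_{B/K}` by the `dg_i`, then `Ω_B` is generated by `dt` and
the `dg_i`. -/
lemma exists_eq_smul_add_sum {K : Type*} [Field K] [Algebra K B] {t : K}
    (ht : ∀ u : K, ∃ w : K, KaehlerDifferential.D ℤ K u = w • KaehlerDifferential.D ℤ K t)
    {ι : Type*} [Fintype ι] {g : ι → B}
    (hg : Submodule.span B (Set.range fun i => KaehlerDifferential.D K B (g i)) = ⊤)
    (ω : Ω[B⁄ℤ]) : ∃ (a : B) (b : ι → B),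
      ω = a • KaehlerDifferential.D ℤ B (algebraMap K B t) +
        ∑ i, b i • KaehlerDifferential.D ℤ B (g i) := by
  obtain ⟨b, hb⟩ := (Submodule.mem_span_range_iff_exists_fun B).1
    (hg.symm ▸ Submodule.mem_top (x := KaehlerDifferential.map ℤ K B B ω))
  -- After subtracting the `dg_i` part the form dies in `Ω_{B/K}`, so by exactness it comes from `B
  -- ⊗ Ω_K`, which is generated by `dt`.
  have hker : KaehlerDifferential.map ℤ K B B
      (ω - ∑ i, b i • KaehlerDifferential.D ℤ B (g i)) = 0 := by
    rw [map_sub, map_sum, ← hb, sub_eq_zero]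
    refine Finset.sum_congr rfl fun i _ => ?_
    rw [map_smul, KaehlerDifferential.map_D]
    rfl
  obtain ⟨z, hz⟩ := (KaehlerDifferential.exact_mapBaseChange_map ℤ K B _).1 hker
  have hz' : ∃ a : B, KaehlerDifferential.mapBaseChange ℤ K B z =
      a • KaehlerDifferential.D ℤ B (algebraMap K B t) := by
    clear hz
    induction z with
    | zero => exact ⟨0, by simp⟩
    | add x y hx hy =>
      obtain ⟨a, ha⟩ := hx
      obtain ⟨a', ha'⟩ := hy
      exact ⟨a + a', by rw [map_add, ha, ha', add_smul]⟩
    | tmul x y =>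
      have : ∃ w : K, y = w • KaehlerDifferential.D ℤ K t := by
        induction y using kaehler_induction with
        | h0 => exact ⟨0, by simp⟩
        | hadd x y hx hy =>
          obtain ⟨a, rfl⟩ := hx
          obtain ⟨b, rfl⟩ := hy
          exact ⟨a + b, by rw [add_smul]⟩
        | hD a b =>
          obtain ⟨w, hw⟩ := ht b
          exact ⟨a * w, by rw [hw, smul_smul]⟩
      obtain ⟨w, rfl⟩ := this
      refine ⟨x * algebraMap K B w, ?_⟩
      rw [KaehlerDifferential.mapBaseChange_tmul, map_smul, KaehlerDifferential.map_D, mul_smul,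
        algebraMap_smul]
  obtain ⟨a, ha⟩ := hz'
  exact ⟨a, b, by rw [← ha, hz, sub_add_cancel]⟩

end Kaehler

/-! ### Weak separability and `p`-th roots -/

section WeaklySeparable

variable {p : ℕ} [hp : Fact p.Prime]

lemma IsWeaklySeparableExt.eq_zero {κ L : Type u} [Field κ] [Field L] {ρ : κ →+* L}
    (h : IsWeaklySeparableExt ρ) {ω : Ω[κ⁄ℤ]} (hω : kaehlerMap ρ ω = 0) : ω = 0 :=
  (injective_iff_map_eq_zero (kaehlerMap ρ)).1 h ω hω

/-- The derivation detects nonzero elements of `Ω_L`, so weak separability becomes one inequation in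
`L` for each nonzero form of `κ`. -/
lemma PthDerivation.isWeaklySeparableExt_iff {K L : Type u} [Field K] [CharP K p]
    [NontriviallyNormedField L] [CharP L p] [Algebra K L] (d : PthDerivation p K L)
    {κ : Type u} [Field κ] (ρ : κ →+* L) :
    IsWeaklySeparableExt ρ ↔ ∀ ω : Ω[κ⁄ℤ], diffEval d.toDer ρ ω = 0 → ω = 0 := by
  refine ⟨fun h ω hω => h.eq_zero (d.eq_zero_of_lift_eq_zero hω), fun h => ?_⟩
  refine (injective_iff_map_eq_zero (kaehlerMap ρ)).2 fun ω hω => h ω ?_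
  rw [diffEval_apply, hω, map_zero]

/-- An element of a field of characteristic `p` with zero differential is a `p`-th power. -/
lemma mem_frobenius_range_of_D_eq_zero {κ : Type*} [Field κ] [CharP κ p] {u : κ}
    (hu : KaehlerDifferential.D ℤ κ u = 0) : ∃ w, w ^ p = u := by
  by_contra hne
  -- Let `M` be maximal among the subfields containing `κ^p` but not `u`. Then `κ = M(u)`, so a
  -- derivation over `M` with `Du = 1` exists and `du ≠ 0`.
  let S : Set (Subfield κ) := {M | (∀ x : κ, x ^ p ∈ M) ∧ u ∉ M}
  have h0 : (frobenius κ p).fieldRange ∈ S := ⟨fun x => ⟨x, rfl⟩, fun ⟨w, hw⟩ => hne ⟨w, hw⟩⟩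
  obtain ⟨M, -, hM⟩ := zorn_le_nonempty₀ S (fun c hc hchain M hMc => by
    have hdir : DirectedOn (· ≤ ·) c := hchain.directedOn
    refine ⟨sSup c, ⟨fun x => (le_sSup hMc : M ≤ _) ((hc hMc).1 x), fun hmem => ?_⟩,
      fun N hN => le_sSup hN⟩
    obtain ⟨N, hN, huN⟩ := (Subfield.mem_sSup_of_directedOn ⟨M, hMc⟩ hdir).1 hmem
    exact (hc hN).2 huN) _ h0
  have hMS : M ∈ S := hM.1
  have hpow (x : κ) : x ^ p ∈ (algebraMap M κ).range := ⟨⟨x ^ p, hMS.1 x⟩, rfl⟩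
  have hdeg (x : κ) (hx : x ∉ M) : _root_.IsIntegral M x ∧ (minpoly M x).natDegree = p := by
    have hmonic := Polynomial.monic_X_pow_sub_C (⟨x ^ p, hMS.1 x⟩ : M) hp.out.ne_zero
    have haev : Polynomial.aeval x
        (Polynomial.X ^ p - Polynomial.C (⟨x ^ p, hMS.1 x⟩ : M)) = 0 := by
      simp only [map_sub, map_pow, Polynomial.aeval_X, Polynomial.aeval_C]
      exact sub_self _
    have hirr : Irreducible (Polynomial.X ^ p - Polynomial.C (⟨x ^ p, hMS.1 x⟩ : M)) :=
      X_pow_sub_C_irreducible_of_prime hp.out fun b hb => hx (by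
        have h2 : (b : κ) ^ p = x ^ p := congrArg Subtype.val hb
        rw [← frobenius_inj κ p h2]
        exact b.2)
    refine ⟨⟨_, hmonic, haev⟩, ?_⟩
    rw [← minpoly.eq_of_irreducible_of_monic hirr haev hmonic, Polynomial.natDegree_X_pow_sub_C]
  have hint (x : κ) : _root_.IsIntegral M x := by
    by_cases hx : x ∈ M
    · exact isIntegral_algebraMap (x := (⟨x, hx⟩ : M))
    · exact (hdeg x hx).1
  have hle (x : κ) : x ∈ IntermediateField.adjoin M {u} := by
    by_cases hx : x ∈ M
    · exact IntermediateField.algebraMap_mem _ (⟨x, hx⟩ : M)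
    have hlt : M < (IntermediateField.adjoin M {x}).toSubfield := by
      refine lt_of_le_not_ge (fun y hy => IntermediateField.algebraMap_mem _ (⟨y, hy⟩ : M)) ?_
      exact fun h => hx (h (IntermediateField.mem_adjoin_simple_self M x))
    -- By maximality `M(x)` contains `u`; both `M(u)` and `M(x)` have degree `p` over `M`, so they
    -- coincide.
    have hux : u ∈ IntermediateField.adjoin M {x} := by
      by_contra hux
      exact hlt.not_ge (hM.2 ⟨fun y => hlt.le (hMS.1 y), hux⟩ hlt.le)
    have : FiniteDimensional M (IntermediateField.adjoin M {x}) :=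
      IntermediateField.adjoin.finiteDimensional (hint x)
    have heq : IntermediateField.adjoin M {u} = IntermediateField.adjoin M {x} := by
      refine IntermediateField.eq_of_le_of_finrank_eq
        (IntermediateField.adjoin_simple_le_iff.2 hux) ?_
      rw [IntermediateField.adjoin.finrank (hint u), IntermediateField.adjoin.finrank (hint x),
        (hdeg u hMS.2).2, (hdeg x hx).2]
    rw [heq]
    exact IntermediateField.mem_adjoin_simple_self M x
  have hadj : Algebra.adjoin M {u} = ⊤ := by
    rw [← IntermediateField.adjoin_simple_toSubalgebra_of_isAlgebraic (hint u).isAlgebraic]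
    exact eq_top_iff.2 fun x _ => hle x
  obtain ⟨D, hD⟩ := exists_derivation_of_notMem (p := p) hpow
    (fun ⟨y, hy⟩ => hMS.2 (by rw [← hy]; exact y.2)) hadj
  have h1 := (D.restrictScalars ℤ).liftKaehlerDifferential_comp_D u
  rw [hu, map_zero] at h1
  exact one_ne_zero (hD.symm.trans h1.symm)

/-- The form `du` maps to `d(w^p) = 0`, so it is zero already in `Ω_κ`, and `u` is a `p`-th power in
`κ`. -/
lemma IsWeaklySeparableExt.exists_pow_eq {κ L : Type u} [Field κ] [Field L] [CharP κ p]
    [CharP L p] {ρ : κ →+* L} (h : IsWeaklySeparableExt ρ) {u : κ} {w : L} (hw : w ^ p = ρ u) :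
    ∃ z : κ, ρ z = w := by
  obtain ⟨z, rfl⟩ := mem_frobenius_range_of_D_eq_zero (p := p) (u := u) (h.eq_zero (by
    rw [kaehlerMap_D, ← hw, derivation_pow_char (p := p)]))
  refine ⟨z, frobenius_inj L p ?_⟩
  rw [frobenius_def, frobenius_def, hw, map_pow]

end WeaklySeparable

/-! ### Local parametrizations of smooth varieties by open sets of affine space -/

section LocalChart

lemma hasStrictFDerivAt_aeval {K L ι : Type*} [Field K] [NontriviallyNormedField L] [Algebra K L]
    [Fintype ι] (r : MvPolynomial ι K) (x : ι → L) :
    HasStrictFDerivAt (fun x : ι → L => MvPolynomial.aeval x r)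
      (∑ k, MvPolynomial.aeval x (MvPolynomial.pderiv k r) •
        (ContinuousLinearMap.proj k : (ι → L) →L[L] L)) x := by
  classical
  induction r using MvPolynomial.induction_on with
  | C a =>
    refine ((hasStrictFDerivAt_const (𝕜 := L) (algebraMap K L a) x).congr_fderiv ?_).congr_of_eventuallyEq
      (Filter.Eventually.of_forall fun y => (MvPolynomial.aeval_C y a).symm)
    ext v
    simp
  | add q r hq hr =>
    refine ((hq.add hr).congr_fderiv ?_).congr_of_eventuallyEq
      (Filter.Eventually.of_forall fun y => (map_add (MvPolynomial.aeval y) q r).symm)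
    ext v
    simp [add_mul, Finset.sum_add_distrib]
  | mul_X q i hq =>
    refine ((hq.mul (ContinuousLinearMap.proj i : (ι → L) →L[L] L).hasStrictFDerivAt).congr_fderiv
      ?_).congr_of_eventuallyEq (Filter.Eventually.of_forall fun y => by simp)
    ext v
    simp [MvPolynomial.pderiv_X, Pi.single_apply, add_mul, Finset.sum_add_distrib,
      Finset.mul_sum, apply_ite]
    ring_nf

/-- An analytic parametrization, by an open set of affine space, of the `L`-points of an algebra
`B` near a given one. -/
structure LocalChart {K L B : Type*} [Field K] [NontriviallyNormedField L] [Algebra K L]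
    [CommRing B] [Algebra K B] (φ₀ : B →ₐ[K] L) where
  ι : Type
  [fintype : Fintype ι]
  g : ι → B
  span_D : Submodule.span B (Set.range fun i => KaehlerDifferential.D K B (g i)) = ⊤
  U : Set (ι → L)
  isOpen_U : IsOpen U
  mem_U : (fun i => φ₀ (g i)) ∈ U
  ψ : (ι → L) → B →ₐ[K] L
  ψ_base : ψ (fun i => φ₀ (g i)) = φ₀
  ψ_g : ∀ y ∈ U, ∀ i, ψ y (g i) = y i
  differentiableAt : ∀ s, ∀ y ∈ U, DifferentiableAt L (fun y => ψ y s) y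

attribute [instance] LocalChart.fintype

-- This is the implicit function theorem for a standard smooth presentation: the coordinates outside
-- the invertible Jacobian minor are free, and the relations determine the others.
open Algebra in
lemma exists_localChart {K L B : Type*} [Field K] [NontriviallyNormedField L] [CompleteSpace L]
    [Algebra K L] [CommRing B] [Algebra K B] [Algebra.IsStandardSmooth K B] (φ₀ : B →ₐ[K] L) :
    Nonempty (LocalChart φ₀) := by
  classical
  obtain ⟨ι, σ, _, _, ⟨P⟩⟩ := Algebra.IsStandardSmooth.out (R := K) (S := B)
  have := Fintype.ofFinite ι
  have := Fintype.ofFinite σ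
  let κ : Type := ((Set.range P.map)ᶜ : Set ι)
  have : Fintype κ := Fintype.ofFinite κ
  let pr (x : ι → L) : κ → L := fun k => x k
  let J (x : ι → L) : L := MvPolynomial.aeval x P.jacobiMatrix.det
  -- The free coordinates together with the values of the relations: a local homeomorphism wherever
  -- the Jacobian is nonzero. The points of `B` form its fibre over zero in the second factor.
  let Φ (x : ι → L) : (κ → L) × (σ → L) := (fun k => x k, fun j => MvPolynomial.aeval x (P.relation j))
  let Φ' (x : ι → L) : (ι → L) →L[L] (κ → L) × (σ → L) :=
    (ContinuousLinearMap.pi fun k : κ => ContinuousLinearMap.proj (k : ι)).prod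
      (ContinuousLinearMap.pi fun j => ∑ k, MvPolynomial.aeval x
        (MvPolynomial.pderiv k (P.relation j)) • ContinuousLinearMap.proj k)
  have hΦ (x : ι → L) : HasStrictFDerivAt Φ (Φ' x) x :=
    HasStrictFDerivAt.prodMk
      (hasStrictFDerivAt_pi.2 fun k =>
        (ContinuousLinearMap.proj (k : ι) : (ι → L) →L[L] L).hasStrictFDerivAt)
      (hasStrictFDerivAt_pi.2 fun j => hasStrictFDerivAt_aeval _ x)
  have hinv (x : ι → L) (hx : J x ≠ 0) :
      ∃ e : (ι → L) ≃L[L] (κ → L) × (σ → L), (e : (ι → L) →L[L] _) = Φ' x := by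
    have hinj : Function.Injective (Φ' x : (ι → L) →ₗ[L] (κ → L) × (σ → L)) := by
      refine (injective_iff_map_eq_zero _).2 fun v hv => ?_
      have h1 (k : κ) : v k = 0 := congrFun (congrArg Prod.fst hv) k
      have h2 (j : σ) : ∑ k, MvPolynomial.aeval x (MvPolynomial.pderiv k (P.relation j)) * v k = 0 := by
        have := congrFun (congrArg Prod.snd hv) j
        simpa [Φ'] using this
      have h3 : Matrix.vecMul (fun i => v (P.map i))
          (P.jacobiMatrix.map (MvPolynomial.aeval x)) = 0 := by
        ext j
        rw [Pi.zero_apply, ← h2 j, Matrix.vecMul, dotProduct]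
        refine Fintype.sum_of_injective P.map P.map_inj _ _ (fun k hk => ?_) fun i => ?_
        · rw [h1 ⟨k, hk⟩, mul_zero]
        · rw [Matrix.map_apply, P.jacobiMatrix_apply, mul_comm]
      have h4 : (P.jacobiMatrix.map (MvPolynomial.aeval x)).det ≠ 0 := by
        have : (P.jacobiMatrix.map (MvPolynomial.aeval x)).det = J x :=
          (AlgHom.map_det (MvPolynomial.aeval x) P.jacobiMatrix).symm
        rwa [this]
      have h5 := Matrix.eq_zero_of_vecMul_eq_zero h4 h3
      ext k
      by_cases hk : k ∈ Set.range P.map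
      · obtain ⟨i, rfl⟩ := hk
        exact congrFun h5 i
      · exact h1 ⟨k, hk⟩
    have hcard : Fintype.card ι = Fintype.card κ + Fintype.card σ := by
      rw [← Fintype.card_sum]
      refine Fintype.card_congr ?_
      exact ((Equiv.sumComm _ _).trans ((Equiv.sumCongr (Equiv.ofInjective _ P.map_inj)
        (Equiv.refl _)).trans (Equiv.Set.sumCompl (Set.range P.map)))).symm
    have hfin : Module.finrank L (ι → L) = Module.finrank L ((κ → L) × (σ → L)) := by
      rw [Module.finrank_prod, Module.finrank_fintype_fun_eq_card,
        Module.finrank_fintype_fun_eq_card, Module.finrank_fintype_fun_eq_card, hcard]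
    exact ⟨(LinearEquiv.ofInjectiveOfFinrankEq (Φ' x : (ι → L) →ₗ[L] (κ → L) × (σ → L)) hinj
      hfin).toContinuousLinearEquiv, by ext v : 1; rfl⟩
  let x₀ : ι → L := fun k => φ₀ (P.val k)
  have haev (r : MvPolynomial ι K) : MvPolynomial.aeval x₀ r = φ₀ (MvPolynomial.aeval P.val r) := by
    rw [← AlgHom.comp_apply, MvPolynomial.comp_aeval]
  have hJ : J x₀ ≠ 0 := by
    have h1 : J x₀ = φ₀ P.jacobian := by
      rw [P.jacobian_eq_jacobiMatrix_det, P.algebraMap_apply, ← haev]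
    rw [h1]
    exact (P.jacobian_isUnit.map φ₀).ne_zero
  obtain ⟨e₀, he₀⟩ := hinv x₀ hJ
  have hstrict : HasStrictFDerivAt Φ (e₀ : (ι → L) →L[L] _) x₀ := he₀ ▸ hΦ x₀
  let e := hstrict.toOpenPartialHomeomorph Φ
  have hecoe : (e : (ι → L) → (κ → L) × (σ → L)) = Φ := rfl
  have hJc : Continuous J := continuous_iff_continuousAt.2 fun x =>
    (hasStrictFDerivAt_aeval P.jacobiMatrix.det x).continuousAt
  -- Keeping the Jacobian nonzero makes the inverse differentiable at every point of the chart, not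
  -- only at the centre.
  let V : Set ((κ → L) × (σ → L)) := e.target ∩ e.symm ⁻¹' {x | J x ≠ 0}
  have hV : IsOpen V := e.isOpen_inter_preimage_symm (isOpen_ne_fun hJc continuous_const)
  have hsymm {y : (κ → L) × (σ → L)} (hy : y ∈ e.target) : Φ (e.symm y) = y := e.right_inv hy
  have hsurj : Function.Surjective (MvPolynomial.aeval (R := K) P.val) := fun s =>
    ⟨P.σ s, P.aeval_val_σ s⟩
  have hlift (y : κ → L) (hy : (y, (0 : σ → L)) ∈ V) :
      ∃ φ : B →ₐ[K] L, ∀ k, φ (P.val k) = e.symm (y, 0) k := by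
    let f := MvPolynomial.aeval (R := K) P.val
    have hk (a : MvPolynomial ι K) (ha : a ∈ RingHom.ker f) :
        MvPolynomial.aeval (e.symm (y, (0 : σ → L))) a = 0 := by
      rw [← P.ker_eq_ker_aeval_val, ← P.span_range_relation_eq_ker] at ha
      refine (Ideal.span_le (I := RingHom.ker (MvPolynomial.aeval (R := K)
        (e.symm (y, (0 : σ → L)))))).2 ?_ ha
      rintro _ ⟨j, rfl⟩
      exact congrFun (congrArg Prod.snd (hsymm hy.1)) j
    refine ⟨(Ideal.Quotient.liftₐ (RingHom.ker f) _ hk).comp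
      (Ideal.quotientKerAlgEquivOfSurjective hsurj).symm.toAlgHom, fun k => ?_⟩
    have : (Ideal.quotientKerAlgEquivOfSurjective hsurj).symm (P.val k) =
        Ideal.Quotient.mk (RingHom.ker f) (MvPolynomial.X k) := by
      rw [AlgEquiv.symm_apply_eq]
      exact (MvPolynomial.aeval_X (R := K) P.val k).symm
    change Ideal.Quotient.liftₐ (RingHom.ker f) _ hk
      ((Ideal.quotientKerAlgEquivOfSurjective hsurj).symm (P.val k)) = _
    rw [this]
    exact MvPolynomial.aeval_X _ k
  let U : Set (κ → L) := {y | (y, (0 : σ → L)) ∈ V}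
  have hU : IsOpen U := hV.preimage (by fun_prop)
  let ψ (y : κ → L) : B →ₐ[K] L := if hy : y ∈ U then (hlift y hy).choose else φ₀
  have hψ (y : κ → L) (hy : y ∈ U) (s : B) :
      ψ y s = MvPolynomial.aeval (e.symm (y, (0 : σ → L))) (P.σ s) := by
    have h1 : ψ y = (hlift y hy).choose := dif_pos hy
    have h2 := (hlift y hy).choose_spec
    conv_lhs => rw [← P.aeval_val_σ s]
    rw [← AlgHom.comp_apply, MvPolynomial.comp_aeval, h1]
    congr 2
    exact funext h2
  have hψval (y : κ → L) (hy : y ∈ U) (k : ι) : ψ y (P.val k) = e.symm (y, (0 : σ → L)) k := by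
    have h1 : ψ y = (hlift y hy).choose := dif_pos hy
    rw [h1]
    exact (hlift y hy).choose_spec k
  have hΦ₀ : Φ x₀ = (fun k : κ => φ₀ (P.val k), 0) := by
    refine Prod.ext rfl (funext fun j => ?_)
    change MvPolynomial.aeval x₀ (P.relation j) = 0
    rw [haev, P.aeval_val_relation, map_zero]
  have hx₀ : e.symm (fun k : κ => φ₀ (P.val k), 0) = x₀ := by
    rw [← hΦ₀]
    exact e.left_inv hstrict.mem_toOpenPartialHomeomorph_source
  have hmem : (fun k : κ => φ₀ (P.val k)) ∈ U := by
    refine ⟨?_, ?_⟩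
    · rw [← hΦ₀]
      exact hstrict.image_mem_toOpenPartialHomeomorph_target
    · change J _ ≠ 0
      rwa [hx₀]
  refine ⟨{
    ι := κ
    g := fun k => P.val k
    span_D := ?_
    U := U
    isOpen_U := hU
    mem_U := hmem
    ψ := ψ
    ψ_base := ?_
    ψ_g := ?_
    differentiableAt := ?_ }⟩
  · convert P.basisKaehler.span_eq using 3
    ext k
    exact (P.basisKaehler_apply k).symm
  · ext s
    rw [hψ _ hmem, hx₀, haev, P.aeval_val_σ]
  · intro y hy k
    rw [hψval y hy]
    exact congrFun (congrArg Prod.fst (hsymm hy.1)) k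
  · intro s y hy
    obtain ⟨e₁, he₁⟩ := hinv _ hy.2
    have h1 : HasFDerivAt e.symm (e₁.symm : (κ → L) × (σ → L) →L[L] (ι → L)) (y, 0) :=
      e.hasFDerivAt_symm hy.1 (he₁ ▸ (hΦ _).hasFDerivAt)
    have h2 : DifferentiableAt L (fun y : κ → L => e.symm (y, (0 : σ → L))) y :=
      h1.differentiableAt.comp y (by fun_prop)
    have h3 := DifferentiableAt.comp (g := fun x : ι → L => MvPolynomial.aeval x (P.σ s)) y
      (hasStrictFDerivAt_aeval (P.σ s) _).hasFDerivAt.differentiableAt h2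
    exact h3.congr_of_eventuallyEq (by
      filter_upwards [hU.mem_nhds hy] with z hz using hψ z hz s)

end LocalChart

/-! ### Differential relations on open sets -/

section KeyLemma

variable {p : ℕ} [hp : Fact p.Prime] {K L : Type u} [Field K] [CharP K p]
  [NontriviallyNormedField L] [CompleteSpace L] [CharP L p] [Algebra K L]

/-- A differential relation `F₀(y) + ∑ Fᵢ(y) dyᵢ = 0` on an open set has zero coefficients. -/
lemma PthDerivation.eq_zero_of_sum_eq_zero (d : PthDerivation p K L) {ι : Type*} [Fintype ι]
    {O : Set (ι → L)} (hO : IsOpen O) {F₀ : (ι → L) → L} {F : ι → (ι → L) → L}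
    (hF₀ : ∀ y ∈ O, DifferentiableAt L F₀ y) (hF : ∀ i, ∀ y ∈ O, DifferentiableAt L (F i) y)
    (h : ∀ y ∈ O, F₀ y + ∑ i, F i y * d.toDer (y i) = 0) (y : ι → L) (hy : y ∈ O) :
    F₀ y = 0 ∧ ∀ i, F i y = 0 := by
  classical
  suffices hi : ∀ i, F i y = 0 by
    refine ⟨?_, hi⟩
    have := h y hy
    simpa [hi] using this
  -- The derivation is linear only over `L^p`, so the relation is differentiated over `L^p`.
  have h0 := (hF₀ y hy).hasFDerivAt.restrictScalars (pthPowers p L)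
  have h1 (i : ι) := (hF i y hy).hasFDerivAt.restrictScalars (pthPowers p L)
  have h2 (i : ι) : HasFDerivAt (fun z : ι → L => d.toCLM (z i))
      (d.toCLM.comp (ContinuousLinearMap.proj i : (ι → L) →L[pthPowers p L] L)) y :=
    (d.toCLM.comp (ContinuousLinearMap.proj i : (ι → L) →L[pthPowers p L] L)).hasFDerivAt
  have h3 := h0.add (HasFDerivAt.fun_sum (u := Finset.univ) fun i _ => (h1 i).mul (h2 i))
  have h4 := h3.unique ((hasFDerivAt_const (0 : L) y).congr_of_eventuallyEq (by
    filter_upwards [hO.mem_nhds hy] with z hz using h z hz))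
  let A : (ι → L) →L[L] L := fderiv L F₀ y + ∑ i, d.toDer (y i) • fderiv L (F i) y
  have h5 (v : ι → L) : A v + ∑ i, F i y * d.toDer (v i) = 0 := by
    have := DFunLike.congr_fun h4 v
    simp [Finset.sum_add_distrib, PthDerivation.toCLM_apply] at this
    simp only [A, add_apply, sum_apply,
      smul_apply, smul_eq_mul]
    linear_combination this
  intro i
  -- In the direction `c e_i` one term is `L`-linear in `c` and the other is `F_i(y)` times the
  -- derivation of `c`. The choice `c = 1` kills the first term, and `c = t` then gives `F_i(y) =
  -- 0`.
  have h6 (c : L) : c * A (Pi.single i 1) + F i y * d.toDer c = 0 := by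
    have := h5 (c • Pi.single i 1)
    rw [map_smul, smul_eq_mul, Finset.sum_eq_single i] at this
    · simpa using this
    · intro j _ hj
      simp [hj]
    · simp
  have h7 := h6 1
  rw [Derivation.map_one_eq_zero, mul_zero, add_zero, one_mul] at h7
  have h8 := h6 (algebraMap K L d.t)
  rwa [h7, mul_zero, zero_add, d.toDer_t, mul_one] at h8

end KeyLemma

/-! ### Regular functions vanishing on open sets of points -/

section Density

/-- On a smooth domain, functions vanishing on a nonempty open set of `L`-points vanish. -/
lemma LocalChart.eq_zero_of_forall_eq_zero {K L B : Type*} [Field K] [NontriviallyNormedField L]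
    [Algebra K L] [CommRing B] [IsDomain B] [Algebra K B] [Algebra.FiniteType K B]
    {φ₀ : B →ₐ[K] L} (c : LocalChart φ₀) {O : Set (c.ι → L)} (hO : IsOpen O) (hne : O.Nonempty)
    (hOU : O ⊆ c.U) {s : B} (hs : ∀ y ∈ O, c.ψ y s = 0) : s = 0 := by
  by_contra hs0
  let E := FractionRing B
  -- The `dg_i` generate the differentials, so `Frac B` is unramified, hence algebraic, over
  -- `K(g_i)`. A nonzero `s` therefore divides a nonzero polynomial in the `g_i`.
  let k := IntermediateField.adjoin K (Set.range fun i => algebraMap B E (c.g i))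
  have hD0 (x : B) : KaehlerDifferential.D k E (algebraMap B E x) = 0 := by
    have h1 : KaehlerDifferential.map K k B E (KaehlerDifferential.D K B x) = 0 := by
      have : KaehlerDifferential.D K B x ∈
          Submodule.span B (Set.range fun i => KaehlerDifferential.D K B (c.g i)) := by
        rw [c.span_D]; trivial
      generalize KaehlerDifferential.D K B x = ω at this ⊢
      induction this using Submodule.span_induction with
      | mem x hx =>
        obtain ⟨i, rfl⟩ := hx
        rw [KaehlerDifferential.map_D]
        exact (KaehlerDifferential.D k E).map_algebraMap
          (⟨algebraMap B E (c.g i), IntermediateField.subset_adjoin _ _ ⟨i, rfl⟩⟩ : k)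
      | zero => simp
      | add x y _ _ hx hy => rw [map_add, hx, hy, add_zero]
      | smul a x _ hx => rw [map_smul, hx, smul_zero]
    rwa [KaehlerDifferential.map_D] at h1
  have hD (x : E) : KaehlerDifferential.D k E x = 0 := by
    obtain ⟨a, b, hb, rfl⟩ := IsFractionRing.div_surjective (A := B) x
    rw [Derivation.leibniz_div, hD0, hD0]
    simp
  have hsub : Subsingleton (Ω[E⁄k]) := by
    refine subsingleton_of_forall_eq 0 fun ω => ?_
    induction ω using kaehler_induction with
    | h0 => rfl
    | hadd x y hx hy => rw [hx, hy, add_zero]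
    | hD a b => rw [hD, smul_zero]
  have : Algebra.FormallyUnramified k E := ⟨hsub⟩
  have : Algebra.EssFiniteType K E := Algebra.EssFiniteType.comp K B E
  have : Algebra.EssFiniteType k E := Algebra.EssFiniteType.of_comp K k E
  have hsep := Algebra.FormallyUnramified.isSeparable k E
  let : Algebra (MvPolynomial c.ι K) B := (MvPolynomial.aeval c.g).toAlgebra
  have halgE : IsAlgebraic (Algebra.adjoin K (Set.range fun i => algebraMap B E (c.g i)))
      (algebraMap B E s) := by
    have h1 : IsAlgebraic k (algebraMap B E s) := Algebra.IsAlgebraic.isAlgebraic _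
    exact IntermediateField.isAlgebraic_adjoin_iff.1 h1
  have halg : IsAlgebraic (MvPolynomial c.ι K) s := by
    let f : MvPolynomial c.ι K →ₐ[K] Algebra.adjoin K (Set.range fun i => algebraMap B E (c.g i)) :=
      MvPolynomial.aeval fun i => ⟨algebraMap B E (c.g i), Algebra.subset_adjoin ⟨i, rfl⟩⟩
    have hf (P : MvPolynomial c.ι K) :
        (f P : E) = MvPolynomial.aeval (fun i => algebraMap B E (c.g i)) P := by
      have : (Algebra.adjoin K (Set.range fun i => algebraMap B E (c.g i))).val.comp f =
          MvPolynomial.aeval (fun i => algebraMap B E (c.g i)) := by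
        ext i; simp [f]
      exact DFunLike.congr_fun this P
    refine halgE.of_ringHom_of_comp_eq f (algebraMap B E) ?_ (IsFractionRing.injective B E) ?_
    · rintro ⟨x, hx⟩
      obtain ⟨P, rfl⟩ : x ∈ (MvPolynomial.aeval (R := K)
          (fun i => algebraMap B E (c.g i))).range := by
        rwa [← Algebra.adjoin_range_eq_range_aeval]
      exact ⟨P, Subtype.ext (hf P)⟩
    · ext P
      · simp [RingHom.algebraMap_toAlgebra, f, IsScalarTower.algebraMap_apply K B E]
      · simp [RingHom.algebraMap_toAlgebra, f]
  obtain ⟨P, hP, hP0⟩ := (Submodule.ne_bot_iff _).1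
    (Ideal.comap_ne_bot_of_algebraic_mem (R := MvPolynomial c.ι K) hs0
      (Ideal.mem_span_singleton_self s) halg)
  obtain ⟨q, hq⟩ := Ideal.mem_span_singleton'.1 (Ideal.mem_comap.1 hP)
  have hq' : q * s = MvPolynomial.aeval c.g P := hq
  -- In the chart the `g_i` are the coordinate functions, so `P` itself vanishes on an open box; its
  -- sides are infinite, hence `P = 0`.
  have hev (y) (hy : y ∈ O) : MvPolynomial.eval y (MvPolynomial.map (algebraMap K L) P) = 0 := by
    rw [MvPolynomial.eval_map, ← MvPolynomial.aeval_def]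
    have h1 : MvPolynomial.aeval (fun i => c.ψ y (c.g i)) P = c.ψ y (q * s) := by
      rw [hq', ← AlgHom.comp_apply, MvPolynomial.comp_aeval]
    rw [map_mul, hs y hy, mul_zero] at h1
    rw [← h1]
    congr 2
    ext i
    rw [c.ψ_g y (hOU hy)]
  obtain ⟨y, hy⟩ := hne
  obtain ⟨ε, hε, hball⟩ := Metric.isOpen_iff.1 hO y hy
  have hinf (i : c.ι) : (Metric.ball (y i) ε).Infinite := infinite_of_mem_nhds (y i) (Metric.ball_mem_nhds _ hε)
  have h0 : MvPolynomial.map (algebraMap K L) P = 0 := by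
    refine MvPolynomial.funext_set (fun i => Metric.ball (y i) ε) hinf fun z hz => ?_
    rw [map_zero]
    refine hev z (hball ?_)
    rw [ball_pi _ hε]
    exact hz
  exact hP0 (MvPolynomial.map_injective _ (algebraMap K L).injective (by rw [h0, map_zero]))

end Density

/-! ### Values of functions at points with values in a field -/

section FieldPoint

variable {X Y : Scheme.{u}} {L : Type u} [Field L]

/-- The value at a field-valued point of the functions on an open neighbourhood. -/
def valHom (b : Spec (.of L) ⟶ X) {U : X.Opens} (hU : b (IsLocalRing.closedPoint L) ∈ U) :
    Γ(X, U) →+* L :=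
  (X.presheaf.germ U _ hU ≫ Scheme.stalkClosedPointTo b).hom

lemma valHom_res (b : Spec (.of L) ⟶ X) {U V : X.Opens} (h : V ≤ U)
    (hV : b (IsLocalRing.closedPoint L) ∈ V) (s : Γ(X, U)) :
    valHom b hV (X.presheaf.map (homOfLE h).op s) = valHom b (h hV) s := by
  have := TopCat.Presheaf.germ_res_apply X.presheaf (homOfLE h) _ hV s
  change (Scheme.stalkClosedPointTo b).hom _ = (Scheme.stalkClosedPointTo b).hom _
  exact congrArg _ this

lemma valHom_comp (b : Spec (.of L) ⟶ X) (i : X ⟶ Y) {U : Y.Opens}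
    (hU : i (b (IsLocalRing.closedPoint L)) ∈ U) (s : Γ(Y, U)) :
    valHom (b ≫ i) (U := U) hU s = valHom (U := i ⁻¹ᵁ U) b hU (i.app U s) := by
  have h1 : Y.presheaf.germ U _ hU ≫ i.stalkMap _ ≫ Scheme.stalkClosedPointTo b =
      i.app U ≫ X.presheaf.germ (i ⁻¹ᵁ U) _ hU ≫ Scheme.stalkClosedPointTo b := by
    rw [Scheme.Hom.germ_stalkMap_assoc]
  have h2 := Scheme.stalkClosedPointTo_comp b i
  change (Y.presheaf.germ U _ hU ≫ Scheme.stalkClosedPointTo (b ≫ i)).hom s = _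
  rw [h2]
  exact congrArg (fun φ => φ.hom s) h1

lemma specMap_valHom (b : Spec (.of L) ⟶ X) {U : X.Opens} (hU : IsAffineOpen U)
    (hb : b (IsLocalRing.closedPoint L) ∈ U) :
    Spec.map (CommRingCat.ofHom (valHom b hb)) ≫ hU.fromSpec = b := by
  have h := Scheme.Spec_stalkClosedPointTo_fromSpecStalk b
  rw [← hU.fromSpecStalk_eq_fromSpecStalk hb, IsAffineOpen.fromSpecStalk,
    ← Spec.map_comp_assoc] at h
  exact h

lemma specMap_fromSpec_mem {U : X.Opens} (hU : IsAffineOpen U) (φ : Γ(X, U) →+* L) :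
    (Spec.map (CommRingCat.ofHom φ) ≫ hU.fromSpec) (IsLocalRing.closedPoint L) ∈ U := by
  exact hU.range_fromSpec.le (Set.mem_range_self (f := hU.fromSpec)
    (Spec.map (CommRingCat.ofHom φ) (IsLocalRing.closedPoint L)))

lemma valHom_specMap {U : X.Opens} (hU : IsAffineOpen U) (φ : Γ(X, U) →+* L) :
    valHom (Spec.map (CommRingCat.ofHom φ) ≫ hU.fromSpec) (specMap_fromSpec_mem hU φ) = φ := by
  have h := specMap_valHom _ hU (specMap_fromSpec_mem hU φ)
  rw [cancel_mono] at h
  exact congrArg CommRingCat.Hom.hom (Spec.map_injective h)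

lemma valHom_eq_zero_iff (b : Spec (.of L) ⟶ X) {U : X.Opens}
    (hU : b (IsLocalRing.closedPoint L) ∈ U) (s : Γ(X, U)) :
    valHom b hU s = 0 ↔ b (IsLocalRing.closedPoint L) ∉ X.basicOpen s := by
  rw [Scheme.mem_basicOpen _ _ _ hU, ← isUnit_map_iff (Scheme.stalkClosedPointTo b).hom,
    isUnit_iff_ne_zero, not_not]
  rfl

lemma fromSpec_comp_structure {K : Type u} [Field K] (f : X ⟶ Spec (.of K)) {U : X.Opens}
    (hU : IsAffineOpen U) :
    hU.fromSpec ≫ f = Spec.map (CommRingCat.ofHom (scalar f U)) := by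
  have h := IsAffineOpen.SpecMap_appLE_fromSpec f (isAffineOpen_top (Spec (.of K))) hU
    (i := le_top)
  rw [IsAffineOpen.fromSpec_top, Scheme.isoSpec_Spec_inv, ← Spec.map_comp] at h
  rw [← h]
  congr 1

lemma valHom_scalar {K : Type u} [Field K] (f : X ⟶ Spec (.of K)) (φ : K →+* L)
    (b : Spec (.of L) ⟶ X) (hb : b ≫ f = Spec.map (CommRingCat.ofHom φ)) {U : X.Opens}
    (hU : b (IsLocalRing.closedPoint L) ∈ U) (c : K) : valHom b hU (scalar f U c) = φ c := by
  obtain ⟨_, ⟨V, hV, rfl⟩, hbV, hVU⟩ := X.isBasis_affineOpens.exists_subset_of_mem_open hU U.isOpen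
  have h1 : valHom b hbV (scalar f V c) = valHom b hU (scalar f U c) := by
    rw [← valHom_res b (SetLike.coe_subset_coe.1 hVU) hbV]
    congr 1
    change _ = (X.presheaf.map _ ≫ X.presheaf.map _) _
    rw [← Functor.map_comp]
    rfl
  rw [← h1]
  have h2 := fromSpec_comp_structure f hV
  rw [← specMap_valHom b hV hbV, Category.assoc, h2, ← Spec.map_comp] at hb
  exact congrArg (fun g => g.hom c) (Spec.map_injective hb)

end FieldPoint

/-! ### The topology on points -/

section PointsTopology

variable {K : Type u} [Field K] {X Z : Scheme.{u}} {f : X ⟶ Spec (.of K)} {g : Z ⟶ Spec (.of K)}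
  {L : Type u} [Field L] [Algebra K L]

namespace Points

lemma eval_eq_valHom (a : Points f L) {U : X.Opens} (ha : a.image ∈ U) (s : Γ(X, U)) :
    a.eval ha s = valHom a.1 ha s := rfl

lemma eval_scalar (a : Points f L) {U : X.Opens} (ha : a.image ∈ U) (c : K) :
    a.eval ha (scalar f U c) = algebraMap K L c :=
  valHom_scalar f _ a.1 a.2 ha c

lemma eval_res (a : Points f L) {U V : X.Opens} (h : V ≤ U) (ha : a.image ∈ V) (s : Γ(X, U)) :
    a.eval ha (X.presheaf.map (homOfLE h).op s) = a.eval (h ha) s :=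
  valHom_res a.1 h ha s

lemma eval_eq_zero_iff (a : Points f L) {U : X.Opens} (ha : a.image ∈ U) (s : Γ(X, U)) :
    a.eval ha s = 0 ↔ a.image ∉ X.basicOpen s :=
  valHom_eq_zero_iff a.1 ha s

/-- The point given by the values of the functions on an affine open. -/
def ofAffine {V : X.Opens} (hV : IsAffineOpen V) (φ : Γ(X, V) →+* L)
    (hφ : φ.comp (scalar f V) = algebraMap K L) : Points f L :=
  ⟨Spec.map (CommRingCat.ofHom φ) ≫ hV.fromSpec, by
    rw [Category.assoc, fromSpec_comp_structure, ← Spec.map_comp, ← hφ]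
    rfl⟩

lemma image_ofAffine_mem {V : X.Opens} (hV : IsAffineOpen V) (φ : Γ(X, V) →+* L)
    (hφ : φ.comp (scalar f V) = algebraMap K L) : (ofAffine hV φ hφ).image ∈ V :=
  specMap_fromSpec_mem hV φ

lemma eval_ofAffine {V : X.Opens} (hV : IsAffineOpen V) (φ : Γ(X, V) →+* L)
    (hφ : φ.comp (scalar f V) = algebraMap K L) (s : Γ(X, V)) :
    (ofAffine hV φ hφ).eval (image_ofAffine_mem hV φ hφ) s = φ s :=
  congrArg (fun g : Γ(X, V) →+* L => g s) (valHom_specMap hV φ)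

lemma ext_of_eval {V : X.Opens} (hV : IsAffineOpen V) {a b : Points f L} (ha : a.image ∈ V)
    (hb : b.image ∈ V) (h : ∀ s, a.eval ha s = b.eval hb s) : a = b := by
  apply Subtype.ext
  rw [← specMap_valHom a.1 hV ha, ← specMap_valHom b.1 hV hb]
  congr 3
  ext s
  exact h s

/-- The map on points induced by a morphism. -/
def map (i : Z ⟶ X) (hi : i ≫ f = g) (b : Points g L) : Points f L :=
  ⟨b.1 ≫ i, by rw [Category.assoc, hi, b.2]⟩

lemma eval_map (i : Z ⟶ X) (hi : i ≫ f = g) (b : Points g L) {U : X.Opens}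
    (hb : i b.image ∈ U) (s : Γ(X, U)) :
    (b.map i hi).eval (U := U) hb s = b.eval (U := i ⁻¹ᵁ U) hb (i.app U s) :=
  valHom_comp b.1 i hb s

open Classical in
/-- The value at a point of a function on an open, extended by `0`. -/
def value {U : X.Opens} (s : Γ(X, U)) (a : Points f L) : L :=
  if ha : a.image ∈ U then a.eval ha s else 0

lemma value_eq {U : X.Opens} (s : Γ(X, U)) (a : Points f L) (ha : a.image ∈ U) :
    value s a = a.eval ha s := dif_pos ha

variable [TopologicalSpace L]

lemma isOpen_setOf_eval_mem {U : X.Opens} (s : Γ(X, U)) {O : Set L} (hO : IsOpen O) :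
    IsOpen {a : Points f L | ∃ ha : a.image ∈ U, a.eval ha s ∈ O} :=
  TopologicalSpace.isOpen_generateFrom_of_mem ⟨U, s, O, hO, rfl⟩

variable (f L) in
lemma isOpen_setOf_image_mem (U : X.Opens) : IsOpen {a : Points f L | a.image ∈ U} := by
  convert isOpen_setOf_eval_mem (f := f) (U := U) 0 (isOpen_univ (X := L)) using 3
  simp

lemma continuous_map (i : Z ⟶ X) (hi : i ≫ f = g) :
    Continuous (map i hi : Points g L → Points f L) := by
  refine continuous_generateFrom_iff.2 ?_
  rintro _ ⟨U, s, O, hO, rfl⟩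
  convert isOpen_setOf_eval_mem (f := g) (i.app U s) hO using 1
  ext b
  constructor
  · rintro ⟨h, hb⟩
    exact ⟨h, eval_map i hi b h s ▸ hb⟩
  · rintro ⟨h, hb⟩
    exact ⟨h, (eval_map i hi b h s).symm ▸ hb⟩

end Points

end PointsTopology

lemma exists_res_mul_pow_eq {X : Scheme.{u}} {V : X.Opens} (hV : IsAffineOpen V) {h : Γ(X, V)}
    {U : X.Opens} (hU : X.basicOpen h ≤ U) (s : Γ(X, U)) :
    ∃ (n : ℕ) (r : Γ(X, V)), X.presheaf.map (homOfLE hU).op s *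
      X.presheaf.map (homOfLE (X.basicOpen_le h)).op h ^ n =
      X.presheaf.map (homOfLE (X.basicOpen_le h)).op r := by
  have := hV.isLocalization_basicOpen h
  obtain ⟨n, r, hr⟩ := IsLocalization.Away.surj h (X.presheaf.map (homOfLE hU).op s)
  exact ⟨n, r, hr⟩

section PointsTopology

variable {K : Type u} [Field K] {X : Scheme.{u}} {f : X ⟶ Spec (.of K)}
  {L : Type u} [NormedField L] [Algebra K L]

namespace Points

lemma eval_eq_div {V U : X.Opens} {h : Γ(X, V)} (hU : X.basicOpen h ≤ U) {s : Γ(X, U)} {n : ℕ}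
    {r : Γ(X, V)} (hr : X.presheaf.map (homOfLE hU).op s *
      X.presheaf.map (homOfLE (X.basicOpen_le h)).op h ^ n =
      X.presheaf.map (homOfLE (X.basicOpen_le h)).op r) (a : Points f L)
    (ha : a.image ∈ X.basicOpen h) :
    a.eval (hU ha) s =
      a.eval (X.basicOpen_le h ha) r / a.eval (X.basicOpen_le h ha) h ^ n := by
  have h0 : a.eval (X.basicOpen_le h ha) h ≠ 0 := fun h1 => (a.eval_eq_zero_iff _ h).1 h1 ha
  rw [eq_div_iff (pow_ne_zero _ h0)]
  rw [← eval_res a hU ha, ← eval_res a (X.basicOpen_le h) ha, ← eval_res a (X.basicOpen_le h) ha,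
    ← hr]
  exact ((map_mul (valHom a.1 ha) _ _).trans
    (congrArg _ (map_pow (valHom a.1 ha) _ _))).symm

/-- The topology involves functions on all opens; near a given point each of them is a quotient `r /
h ^ n` of functions on the affine open `V`. -/
lemma continuousAt_of_eval {T : Type*} [TopologicalSpace T] {τ : T → Points f L} {t₀ : T}
    {V : X.Opens} (hV : IsAffineOpen V) (hτ : ∀ᶠ t in 𝓝 t₀, (τ t).image ∈ V)
    (hc : ∀ s : Γ(X, V), ContinuousAt (fun t => value s (τ t)) t₀) : ContinuousAt τ t₀ := by
  have hτ₀ := hτ.self_of_nhds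
  refine TopologicalSpace.tendsto_nhds_generateFrom_iff.2 ?_
  rintro _ ⟨U, s, O, hO, rfl⟩ ⟨h₀, hO₀⟩
  obtain ⟨h, hhU, hh⟩ := hV.exists_basicOpen_le ⟨(τ t₀).image, h₀⟩ hτ₀
  obtain ⟨n, r, hr⟩ := exists_res_mul_pow_eq hV hhU s
  have hne : value h (τ t₀) ≠ 0 := by
    rw [value_eq h _ hτ₀]
    exact fun h1 => (eval_eq_zero_iff _ _ h).1 h1 hh
  have hq : ContinuousAt (fun t => value r (τ t) / value h (τ t) ^ n) t₀ :=
    (hc r).div ((hc h).pow n) (pow_ne_zero _ hne)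
  have hO₁ : value r (τ t₀) / value h (τ t₀) ^ n ∈ O := by
    rw [value_eq r _ hτ₀, value_eq h _ hτ₀, ← eval_eq_div hhU hr _ hh]
    exact hO₀
  filter_upwards [hτ, (hc h).eventually_ne hne, hq (hO.mem_nhds hO₁)] with t ht h1 h2
  rw [value_eq h _ ht, Ne, eval_eq_zero_iff, not_not] at h1
  refine ⟨hhU h1, ?_⟩
  rw [eval_eq_div hhU hr _ h1]
  rw [Set.mem_preimage, value_eq r _ ht, value_eq h _ ht] at h2
  exact h2

end Points

end PointsTopology

/-! ### Rings of functions on affine opens -/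

section Affine

variable {K : Type u} [Field K] {X : Scheme.{u}} {f : X ⟶ Spec (.of K)}

lemma finiteType_scalar [LocallyOfFiniteType f] {U : X.Opens} (hU : IsAffineOpen U) :
    (scalar f U).FiniteType := by
  have h := f.finiteType_appLE (isAffineOpen_top (Spec (.of K))) hU le_top
  exact h.comp (RingHom.FiniteType.of_surjective _
    (Scheme.ΓSpecIso (.of K)).symm.commRingCatIsoToRingEquiv.surjective)

lemma exists_generators [LocallyOfFiniteType f] {U : X.Opens} (hU : IsAffineOpen U) :
    ∃ S : Finset Γ(X, U),
      Subring.closure (Set.range (scalar f U) ∪ (S : Set Γ(X, U))) = ⊤ := by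
  let := (scalar f U).toAlgebra
  obtain ⟨S, hS⟩ := (finiteType_scalar (f := f) hU).out
  refine ⟨S, ?_⟩
  have := congrArg Subalgebra.toSubring hS
  rw [Algebra.adjoin_eq_ring_closure] at this
  exact this

lemma isNoetherianRing_of_isAffineOpen [LocallyOfFiniteType f] {U : X.Opens}
    (hU : IsAffineOpen U) : IsNoetherianRing Γ(X, U) := by
  let := (scalar f U).toAlgebra
  have : Algebra.FiniteType K Γ(X, U) := finiteType_scalar (f := f) hU
  exact Algebra.FiniteType.isNoetherianRing K _

lemma countable_of_finiteType {A B : Type*} [CommRing A] [CommRing B] [Countable A] (φ : A →+* B)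
    (h : φ.FiniteType) : Countable B := by
  let := φ.toAlgebra
  have : Algebra.FiniteType A B := h
  obtain ⟨n, g, hg⟩ := Algebra.FiniteType.iff_quotient_mvPolynomial''.1 this
  have : Countable (MvPolynomial (Fin n) A) := by
    rw [← Cardinal.mk_le_aleph0_iff]
    refine MvPolynomial.cardinalMk_le_max_lift.trans ?_
    simp
  exact hg.countable

lemma exists_evaluation_mul_eq {U : X.Opens} (hU : IsAffineOpen U) {x : X} (hx : x ∈ U)
    (w : X.residueField x) : ∃ a b : Γ(X, U), X.evaluation U x hx b ≠ 0 ∧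
      w * X.evaluation U x hx b = X.evaluation U x hx a := by
  have := hU.isLocalization_stalk ⟨x, hx⟩
  obtain ⟨w, rfl⟩ := X.residue_surjective x w
  let : Algebra Γ(X, U) (X.presheaf.stalk x) := (X.presheaf.germ U x hx).hom.toAlgebra
  obtain ⟨⟨a, b⟩, h⟩ := IsLocalization.surj (hU.primeIdealOf ⟨x, hx⟩).asIdeal.primeCompl w
  refine ⟨a, b, ?_, ?_⟩
  · have hb : IsUnit (X.presheaf.germ U x hx b) :=
      IsLocalization.map_units (M := (hU.primeIdealOf ⟨x, hx⟩).asIdeal.primeCompl)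
        (X.presheaf.stalk x) b
    exact (hb.map (X.residue x).hom).ne_zero
  · exact (map_mul (X.residue x).hom _ _).symm.trans (congrArg (X.residue x).hom h)

open Limits in
/-- In a separated scheme the intersection of two affine opens is affine, and its functions are
generated by those on the two opens. -/
lemma exists_isPullback_fromSpec [IsSeparated f] {U V : X.Opens} (hU : IsAffineOpen U)
    (hV : IsAffineOpen V) :
    ∃ (R : CommRingCat.{u}) (i : Γ(X, U) ⟶ R) (j : Γ(X, V) ⟶ R),
      IsPullback (Spec.map i) (Spec.map j) hU.fromSpec hV.fromSpec ∧
      Subring.closure (Set.range i.hom ∪ Set.range j.hom) = ⊤ := by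
  let := (scalar f U).toAlgebra
  let := (scalar f V).toAlgebra
  have h1 : hU.fromSpec ≫ f = Spec.map (CommRingCat.ofHom (algebraMap K Γ(X, U))) :=
    fromSpec_comp_structure f hU
  have h2 : hV.fromSpec ≫ f = Spec.map (CommRingCat.ofHom (algebraMap K Γ(X, V))) :=
    fromSpec_comp_structure f hV
  let W := pullback hU.fromSpec hV.fromSpec
  let c : W ⟶ Spec (.of (Γ(X, U) ⊗[K] Γ(X, V))) :=
    pullback.mapDesc hU.fromSpec hV.fromSpec f ≫ (pullback.congrHom h1 h2).hom ≫
      (pullbackSpecIso K Γ(X, U) Γ(X, V)).hom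
  -- The map `U ∩ V → U ×_K V` is a base change of the diagonal of the separated morphism `f`.
  have hc : IsClosedImmersion c := inferInstance
  obtain ⟨hW, hs⟩ := IsClosedImmersion.isAffine_surjective_of_isAffine c
  have hc1 : c ≫ Spec.map (CommRingCat.ofHom Algebra.TensorProduct.includeLeftRingHom) =
      pullback.fst hU.fromSpec hV.fromSpec := by
    simp only [c, pullback.mapDesc, pullback.congrHom_hom, Category.assoc,
      pullbackSpecIso_hom_fst, pullback.map, Category.comp_id]
    erw [pullback.lift_fst, pullback.lift_fst]
  have hc2 : c ≫ Spec.map (CommRingCat.ofHom (RingHomClass.toRingHom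
      (Algebra.TensorProduct.includeRight : Γ(X, V) →ₐ[K] Γ(X, U) ⊗[K] Γ(X, V)))) =
      pullback.snd hU.fromSpec hV.fromSpec := by
    simp only [c, pullback.mapDesc, pullback.congrHom_hom, Category.assoc,
      pullbackSpecIso_hom_snd, pullback.map, Category.comp_id]
    erw [pullback.lift_snd, pullback.lift_snd]
  let γ : CommRingCat.of (Γ(X, U) ⊗[K] Γ(X, V)) ⟶ Γ(W, ⊤) :=
    (Scheme.ΓSpecIso _).inv ≫ c.appTop
  have hγ : W.isoSpec.inv ≫ c = Spec.map γ := by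
    rw [Spec.map_comp, ← Scheme.isoSpec_inv_naturality, Scheme.isoSpec_Spec_inv]
  have hγs : Function.Surjective γ.hom := hs.comp
    (Scheme.ΓSpecIso _).symm.commRingCatIsoToRingEquiv.surjective
  refine ⟨Γ(W, ⊤), CommRingCat.ofHom Algebra.TensorProduct.includeLeftRingHom ≫ γ,
    CommRingCat.ofHom (RingHomClass.toRingHom
      (Algebra.TensorProduct.includeRight : Γ(X, V) →ₐ[K] Γ(X, U) ⊗[K] Γ(X, V))) ≫ γ, ?_, ?_⟩
  · refine (IsPullback.of_hasPullback hU.fromSpec hV.fromSpec).of_iso W.isoSpec (Iso.refl _)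
      (Iso.refl _) (Iso.refl _) ?_ ?_ (by simp) (by simp)
    · rw [Spec.map_comp, ← hγ, Category.assoc, hc1]
      simp [W]
    · rw [Spec.map_comp, ← hγ, Category.assoc, hc2]
      simp [W]
  · refine eq_top_iff.2 fun r _ => ?_
    obtain ⟨r, rfl⟩ := hγs r
    induction r using TensorProduct.induction_on with
    | zero => rw [map_zero]; exact zero_mem _
    | add r s hr hs =>
      rw [map_add]
      exact add_mem (hr trivial) (hs trivial)
    | tmul a b =>
      have : a ⊗ₜ[K] b = (a ⊗ₜ[K] (1 : Γ(X, V))) * ((1 : Γ(X, U)) ⊗ₜ[K] b) := by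
        rw [Algebra.TensorProduct.tmul_mul_tmul, one_mul, mul_one]
      rw [this, map_mul]
      exact mul_mem (Subring.subset_closure (Or.inl ⟨a, rfl⟩))
        (Subring.subset_closure (Or.inr ⟨b, rfl⟩))

/-- A maximal ideal containing the extended ideal would give a point of `U` to which `y`
specializes, and `U` is stable under generization. -/
lemma map_eq_top_of_isPullback {U V : X.Opens} (hU : IsAffineOpen U) (hV : IsAffineOpen V)
    {R : CommRingCat.{u}} {i : Γ(X, U) ⟶ R} {j : Γ(X, V) ⟶ R}
    (h : Spec.map i ≫ hU.fromSpec = Spec.map j ≫ hV.fromSpec) (y : PrimeSpectrum Γ(X, V))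
    (hy : hV.fromSpec y ∉ U) : y.asIdeal.map j.hom = ⊤ := by
  by_contra hne
  obtain ⟨m, hm, hle⟩ := Ideal.exists_le_maximal _ hne
  let z : PrimeSpectrum R := ⟨m, hm.isPrime⟩
  have h1 : y ⤳ PrimeSpectrum.comap j.hom z :=
    (PrimeSpectrum.le_iff_specializes _ _).1 (Ideal.map_le_iff_le_comap.1 hle)
  have h2 : hV.fromSpec y ⤳ hV.fromSpec (PrimeSpectrum.comap j.hom z) :=
    h1.map hV.fromSpec.continuous
  refine hy (h2.mem_open U.isOpen ?_)
  have h3 : hU.fromSpec (Spec.map i z) = hV.fromSpec (Spec.map j z) :=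
    congrArg (fun g : Spec R ⟶ X => g z) h
  exact h3 ▸ hU.range_fromSpec.le (Set.mem_range_self (f := hU.fromSpec) _)

end Affine

/-! ### Bounded sets of points of an affine open are closed -/

section Bounded

variable {K : Type u} [Field K] {X : Scheme.{u}} {f : X ⟶ Spec (.of K)}
  {L : Type u} [NormedField L] [Algebra K L]

namespace Points

variable (f L) in
/-- The points of an open at which given functions are bounded by a given number. -/
def boundedSet {U : X.Opens} (S : Finset Γ(X, U)) (r : ℝ) : Set (Points f L) :=
  {a | ∃ ha : a.image ∈ U, ∀ s ∈ S, ‖a.eval ha s‖ ≤ r}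

lemma exists_bound_on_boundedSet {U : X.Opens} {S : Finset Γ(X, U)}
    (hS : Subring.closure (Set.range (scalar f U) ∪ (S : Set Γ(X, U))) = ⊤) (r : ℝ)
    (s : Γ(X, U)) : ∃ M : ℝ, ∀ (a : Points f L) (ha : a.image ∈ U),
      a ∈ boundedSet f L S r → ‖a.eval ha s‖ ≤ M := by
  have hs : s ∈ Subring.closure (Set.range (scalar f U) ∪ (S : Set Γ(X, U))) := hS ▸ trivial
  induction hs using Subring.closure_induction with
  | mem s hs =>
    rcases hs with ⟨c, rfl⟩ | hs
    · exact ⟨‖algebraMap K L c‖, fun a ha _ => by rw [eval_scalar]⟩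
    · exact ⟨r, fun a _ ⟨_, h⟩ => h s hs⟩
  | zero => exact ⟨0, fun a ha _ => by rw [eval_eq_valHom, map_zero, norm_zero]⟩
  | one => exact ⟨1, fun a ha _ => by rw [eval_eq_valHom, map_one, norm_one]⟩
  | add s t _ _ hs ht =>
    obtain ⟨M, hM⟩ := hs
    obtain ⟨N, hN⟩ := ht
    exact ⟨M + N, fun a ha h => by
      rw [eval_eq_valHom, map_add]
      exact norm_add_le_of_le (hM a ha h) (hN a ha h)⟩
  | neg s _ hs =>
    obtain ⟨M, hM⟩ := hs
    exact ⟨M, fun a ha h => by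
      rw [eval_eq_valHom, map_neg, norm_neg]
      exact hM a ha h⟩
  | mul s t _ _ hs ht =>
    obtain ⟨M, hM⟩ := hs
    obtain ⟨N, hN⟩ := ht
    exact ⟨M * N, fun a ha h => by
      rw [eval_eq_valHom, map_mul]
      exact norm_mul_le_of_le (hM a ha h) (hN a ha h)⟩

/-- Let `b ∈ V` be outside `U`. The ideal of `b` becomes the unit ideal on `U ∩ V`, so `1 = ∑ q_k
s_k` with `s_k(b) = 0`. Near `b` the `s_k` are small. On bounded points near `b` the `q_k` are
bounded, being polynomials in functions on `U` and on `V`. So bounded points close to `b` would give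
`1 < 1`. -/
theorem isClosed_boundedSet [IsSeparated f] {U : X.Opens} (hU : IsAffineOpen U)
    {S : Finset Γ(X, U)}
    (hS : Subring.closure (Set.range (scalar f U) ∪ (S : Set Γ(X, U))) = ⊤) (r : ℝ) :
    IsClosed (boundedSet f L S r) := by
  refine ⟨isOpen_iff_mem_nhds.2 fun b hb => ?_⟩
  by_cases hbU : b.image ∈ U
  · obtain ⟨s, hs, hrs⟩ : ∃ s ∈ S, r < ‖b.eval hbU s‖ := by
      by_contra! h
      exact hb ⟨hbU, h⟩
    filter_upwards [(isOpen_setOf_eval_mem (f := f) s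
      (isOpen_lt continuous_const continuous_norm)).mem_nhds ⟨hbU, hrs⟩]
    rintro c ⟨hc, hcs⟩ ⟨_, h⟩
    exact (h s hs).not_gt hcs
  obtain ⟨_, ⟨V, hV, rfl⟩, hbV, -⟩ := X.isBasis_affineOpens.exists_subset_of_mem_open
    (Set.mem_univ b.image) isOpen_univ
  obtain ⟨R, i, j, hp, hgen⟩ := exists_isPullback_fromSpec (f := f) hU hV
  -- `ε` is evaluation at `c` of the functions on `U ∩ V`.
  let Good (c : Points f L) (ε : R →+* L) : Prop := c ∈ boundedSet f L S r ∧
    ∃ (hcU : c.image ∈ U) (hcV : c.image ∈ V), (∀ s, ε (i.hom s) = c.eval hcU s) ∧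
      ∀ s, ε (j.hom s) = c.eval hcV s
  have hlift (c : Points f L) (hc : c ∈ boundedSet f L S r) (hcV : c.image ∈ V) :
      ∃ ε, Good c ε := by
    obtain ⟨hcU, -⟩ := id hc
    let e := hp.lift (Spec.map (CommRingCat.ofHom (valHom c.1 hcU)))
      (Spec.map (CommRingCat.ofHom (valHom c.1 hcV)))
      ((specMap_valHom c.1 hU hcU).trans (specMap_valHom c.1 hV hcV).symm)
    refine ⟨(Spec.preimage e).hom, hc, hcU, hcV, fun s => ?_, fun s => ?_⟩
    · have : i ≫ Spec.preimage e = CommRingCat.ofHom (valHom c.1 hcU) := by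
        apply Spec.map_injective
        rw [Spec.map_comp, Spec.map_preimage]
        exact hp.lift_fst _ _ _
      exact congrArg (fun g => g.hom s) this
    · have : j ≫ Spec.preimage e = CommRingCat.ofHom (valHom c.1 hcV) := by
        apply Spec.map_injective
        rw [Spec.map_comp, Spec.map_preimage]
        exact hp.lift_snd _ _ _
      exact congrArg (fun g => g.hom s) this
  have hval (s : Γ(X, V)) {O : Set L} (hO : IsOpen O) (hs : b.eval hbV s ∈ O) :
      ∀ᶠ c in 𝓝 b, ∀ ε, Good c ε → ε (j.hom s) ∈ O := by
    filter_upwards [(isOpen_setOf_eval_mem (f := f) s hO).mem_nhds ⟨hbV, hs⟩]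
    rintro c ⟨hc, hcs⟩ ε ⟨-, -, hcV, -, h⟩
    rw [h]
    exact hcs
  have hbdd (q : R) : ∃ M : ℝ, ∀ᶠ c in 𝓝 b, ∀ ε, Good c ε → ‖ε q‖ ≤ M := by
    have hq : q ∈ Subring.closure (Set.range i.hom ∪ Set.range j.hom) := hgen ▸ trivial
    induction hq using Subring.closure_induction with
    | mem q hq =>
      rcases hq with ⟨s, rfl⟩ | ⟨s, rfl⟩
      · obtain ⟨M, hM⟩ := exists_bound_on_boundedSet (L := L) hS r s
        refine ⟨M, Eventually.of_forall ?_⟩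
        rintro c ε ⟨hc, hcU, -, h, -⟩
        rw [h]
        exact hM c hcU hc
      · refine ⟨‖b.eval hbV s‖ + 1, (hval s (isOpen_lt continuous_norm
          (continuous_const (y := ‖b.eval hbV s‖ + 1)))
          (lt_add_one ‖b.eval hbV s‖)).mono ?_⟩
        exact fun c h ε hε => (h ε hε).le
    | zero => exact ⟨0, Eventually.of_forall fun c ε _ => by rw [map_zero, norm_zero]⟩
    | one => exact ⟨1, Eventually.of_forall fun c ε _ => by rw [map_one, norm_one]⟩
    | add s t _ _ hs ht =>
      obtain ⟨M, hM⟩ := hs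
      obtain ⟨N, hN⟩ := ht
      exact ⟨M + N, (hM.and hN).mono fun c h ε hε => by
        rw [map_add]
        exact norm_add_le_of_le (h.1 ε hε) (h.2 ε hε)⟩
    | neg s _ hs =>
      obtain ⟨M, hM⟩ := hs
      exact ⟨M, hM.mono fun c h ε hε => by
        rw [map_neg, norm_neg]
        exact h ε hε⟩
    | mul s t _ _ hs ht =>
      obtain ⟨M, hM⟩ := hs
      obtain ⟨N, hN⟩ := ht
      exact ⟨M * N, (hM.and hN).mono fun c h ε hε => by
        rw [map_mul]
        exact norm_mul_le_of_le (h.1 ε hε) (h.2 ε hε)⟩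
  let y : PrimeSpectrum Γ(X, V) := Spec.map (CommRingCat.ofHom (valHom b.1 hbV))
    (IsLocalRing.closedPoint L)
  have hyb : hV.fromSpec y = b.image :=
    congrArg (fun g : Spec (.of L) ⟶ X => g (IsLocalRing.closedPoint L)) (specMap_valHom b.1 hV hbV)
  have htop := map_eq_top_of_isPullback hU hV hp.w y (hyb ▸ hbU)
  have hsmall (q : R) (hq : q ∈ y.asIdeal.map j.hom) :
      ∀ δ : ℝ, 0 < δ → ∀ᶠ c in 𝓝 b, ∀ ε, Good c ε → ‖ε q‖ < δ := by
    induction hq using Submodule.span_induction with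
    | mem q hq =>
      obtain ⟨s, hs, rfl⟩ := hq
      have hs0 : b.eval hbV s = 0 := by
        have : valHom b.1 hbV s ∈ IsLocalRing.maximalIdeal L := hs
        rwa [IsLocalRing.maximalIdeal_eq_bot, Ideal.mem_bot] at this
      intro δ hδ
      exact hval s (isOpen_lt continuous_norm (continuous_const (y := δ)))
        (by simpa [hs0] using hδ)
    | zero => exact fun δ hδ => Eventually.of_forall fun c ε _ => by rwa [map_zero, norm_zero]
    | add s t _ _ hs ht =>
      intro δ hδ
      filter_upwards [hs _ (half_pos hδ), ht _ (half_pos hδ)] with c h1 h2 ε hε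
      rw [map_add]
      exact (norm_add_le _ _).trans_lt ((add_lt_add (h1 ε hε) (h2 ε hε)).trans_eq (add_halves δ))
    | smul q s _ hs =>
      intro δ hδ
      obtain ⟨M, hM⟩ := hbdd q
      have hM0 : 0 < |M| + 1 := by positivity
      filter_upwards [hM, hs _ (div_pos hδ hM0)] with c h1 h2 ε hε
      rw [smul_eq_mul, map_mul, norm_mul]
      calc ‖ε q‖ * ‖ε s‖ ≤ (|M| + 1) * ‖ε s‖ := by
            gcongr
            exact (h1 ε hε).trans ((le_abs_self M).trans (le_add_of_nonneg_right zero_le_one))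
        _ < (|M| + 1) * (δ / (|M| + 1)) := by gcongr; exact h2 ε hε
        _ = δ := mul_div_cancel₀ _ hM0.ne'
  filter_upwards [hsmall 1 (htop ▸ trivial) 1 one_pos,
    (isOpen_setOf_image_mem f L V).mem_nhds hbV] with c h1 h2 hc
  obtain ⟨ε, hε⟩ := hlift c hc h2
  have := h1 ε hε
  rw [map_one, norm_one] at this
  exact this.false

end Points

end Bounded

/-! ### Points of smooth schemes in local charts -/

section Lift

variable {K : Type u} [Field K] {X T : Scheme.{u}} {f : X ⟶ Spec (.of K)}
  {L : Type u} [Field L] [Algebra K L]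

lemma surjective_residueFieldMap (i : T ⟶ X) [SurjectiveOnStalks i] (t : T) :
    Function.Surjective (i.residueFieldMap t).hom := by
  intro w
  obtain ⟨w, rfl⟩ := T.residue_surjective t w
  obtain ⟨v, rfl⟩ := i.stalkMap_surjective t w
  refine ⟨X.residue _ v, ?_⟩
  exact congrArg (fun g => g.hom v) (Scheme.residue_residueFieldMap i t)

lemma bijective_residueFieldMap (i : T ⟶ X) [SurjectiveOnStalks i] (t : T) :
    Function.Bijective (i.residueFieldMap t).hom :=
  ⟨(i.residueFieldMap t).hom.injective, surjective_residueFieldMap i t⟩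

namespace Points

lemma specMap_residueMap (a : Points f L) :
    Spec.map (CommRingCat.ofHom a.residueMap) ≫ X.fromSpecResidueField a.image = a.1 :=
  Scheme.descResidueField_stalkClosedPointTo_fromSpecResidueField L X a.1

/-- A field-valued point is a point of the scheme with an embedding of its residue field, and
surjectivity on stalks makes the two residue fields agree. -/
lemma exists_lift (i : T ⟶ X) [SurjectiveOnStalks i] (a : Points f L) (t : T)
    (ht : i t = a.image) : ∃ b : Points (i ≫ f) L, b.map i rfl = a ∧ b.image = t := by
  obtain ⟨ρ, hρ⟩ : ∃ ρ : X.residueField (i t) →+* L,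
      Spec.map (CommRingCat.ofHom ρ) ≫ X.fromSpecResidueField (i t) = a.1 := by
    have key (y : X) (hy : y = a.image) : ∃ ρ : X.residueField y →+* L,
        Spec.map (CommRingCat.ofHom ρ) ≫ X.fromSpecResidueField y = a.1 := by
      subst hy
      exact ⟨_, a.specMap_residueMap⟩
    exact key _ ht
  let e := RingEquiv.ofBijective _ (bijective_residueFieldMap i t)
  let b : Spec (.of L) ⟶ T :=
    Spec.map (CommRingCat.ofHom (ρ.comp e.symm.toRingHom)) ≫ T.fromSpecResidueField t
  have hb : b ≫ i = a.1 := by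
    rw [Category.assoc, ← Scheme.Hom.SpecMap_residueFieldMap_fromSpecResidueField,
      ← Spec.map_comp_assoc, ← hρ]
    congr 2
    ext w
    exact congrArg ρ (e.symm_apply_apply w)
  exact ⟨⟨b, by rw [← Category.assoc, hb, a.2]⟩, Subtype.ext hb,
    Scheme.fromSpecResidueField_apply t _⟩

end Points

end Lift

lemma isReduced_subscheme_vanishingIdeal {X : Scheme.{u}} (Z : TopologicalSpace.Closeds X) :
    IsReduced (Scheme.IdealSheafData.vanishingIdeal Z).subscheme := by
  have h (U : X.affineOpens) :
      IsReduced (Spec (.of (Γ(X, U.1) ⧸ (Scheme.IdealSheafData.vanishingIdeal Z).ideal U))) := by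
    have : _root_.IsReduced (Γ(X, U.1) ⧸ (Scheme.IdealSheafData.vanishingIdeal Z).ideal U) := by
      rw [← Ideal.isRadical_iff_quotient_reduced, Scheme.IdealSheafData.vanishingIdeal_ideal]
      exact PrimeSpectrum.isRadical_vanishingIdeal _
    infer_instance
  have (U : (Scheme.IdealSheafData.vanishingIdeal Z).subschemeCover.openCover.I₀) : IsReduced
      ((Scheme.IdealSheafData.vanishingIdeal Z).subschemeCover.openCover.X U) := h U
  exact IsReduced.of_openCover _ (Scheme.IdealSheafData.subschemeCover _).openCover

lemma exists_isStandardSmooth_scalar {K : Type u} [Field K] {T : Scheme.{u}}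
    (h : T ⟶ Spec (.of K)) [Smooth h] (t : T) :
    ∃ V : T.Opens, IsAffineOpen V ∧ t ∈ V ∧ (scalar h V).IsStandardSmooth := by
  obtain ⟨U, hU, V, hV, ht, e, H⟩ := Smooth.exists_isStandardSmooth h t
  obtain rfl : U = ⊤ := by
    refine eq_top_iff.2 fun s _ => ?_
    rw [Subsingleton.elim s (h t)]
    exact e ht
  exact ⟨V, hV, ht, H.comp (RingHom.IsStandardSmoothOfRelativeDimension.equiv
    (Scheme.ΓSpecIso (.of K)).symm.commRingCatIsoToRingEquiv).isStandardSmooth⟩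

/-- A function vanishing at a generic point has empty nonvanishing locus, so it is zero on a reduced
scheme. -/
lemma injective_evaluation {T : Scheme.{u}} [IsReduced T] {t : T} (ht : ∀ z : T, t ⤳ z)
    {V : T.Opens} (htV : t ∈ V) : Function.Injective (T.evaluation V t htV).hom := by
  refine (injective_iff_map_eq_zero _).2 fun s hs => ?_
  refine (basicOpen_eq_bot_iff s).1 (eq_bot_iff.2 fun z hz => ?_)
  exact ((T.evaluation_eq_zero_iff_notMem_basicOpen t htV s).1 hs
    ((ht z).mem_open (T.basicOpen s).isOpen hz)).elim

/-! ### Differential forms vanishing on open sets of points -/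

section Chart

variable {p : ℕ} [hp : Fact p.Prime] {K L : Type u} [Field K] [CharP K p]
  [NontriviallyNormedField L] [CompleteSpace L] [CharP L p] [Algebra K L]

/-- A differential form on a smooth domain that vanishes, with respect to the derivation, on a
nonempty open set of points, is zero. -/
lemma PthDerivation.eq_zero_of_forall_diffEval_eq_zero (d : PthDerivation p K L) {B : Type u}
    [CommRing B] [IsDomain B] [Algebra K B] [Algebra.FiniteType K B] {φ₀ : B →ₐ[K] L}
    (c : LocalChart φ₀) {O : Set (c.ι → L)} (hO : IsOpen O) (hne : O.Nonempty) (hOU : O ⊆ c.U)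
    {ω : Ω[B⁄ℤ]} (hω : ∀ y ∈ O, diffEval d.toDer (c.ψ y : B →+* L) ω = 0) : ω = 0 := by
  have hK (u : K) : ∃ w : K, KaehlerDifferential.D ℤ K u = w • KaehlerDifferential.D ℤ K d.t := by
    obtain ⟨w, -, hw⟩ := d.map_algebraMap u
    exact ⟨w, hw⟩
  obtain ⟨a, b, rfl⟩ := exists_eq_smul_add_sum hK c.span_D ω
  have key := d.eq_zero_of_sum_eq_zero hO (F₀ := fun y => c.ψ y a) (F := fun i y => c.ψ y (b i))
    (fun y hy => c.differentiableAt a y (hOU hy))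
    (fun i y hy => c.differentiableAt (b i) y (hOU hy)) fun y hy => by
      have := hω y hy
      rw [map_add, map_sum, diffEval_smul, diffEval_D] at this
      simp only [diffEval_smul, diffEval_D, RingHom.coe_coe, AlgHom.commutes, d.toDer_t, mul_one,
        c.ψ_g y (hOU hy)] at this
      exact this
  rw [c.eq_zero_of_forall_eq_zero hO hne hOU fun y hy => (key y hy).1, zero_smul, zero_add]
  refine Finset.sum_eq_zero fun i _ => ?_
  rw [c.eq_zero_of_forall_eq_zero hO hne hOU fun y hy => (key y hy).2 i, zero_smul]

variable {T : Scheme.{u}} {h : T ⟶ Spec (.of K)}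

/-- Near a point of a smooth scheme there are points with prescribed local coordinates. -/
lemma Points.exists_localChart {V : T.Opens} (hV : IsAffineOpen V)
    (hs : (scalar h V).IsStandardSmooth) (b : Points h L) (hb : b.image ∈ V) :
    letI := (scalar h V).toAlgebra
    ∃ (φ₀ : Γ(T, V) →ₐ[K] L) (c : LocalChart φ₀) (τ : (c.ι → L) → Points h L)
      (hτ : ∀ y, (τ y).image ∈ V), (∀ y s, (τ y).eval (hτ y) s = c.ψ y s) ∧
      (τ fun i => φ₀ (c.g i)) = b ∧ ∀ y ∈ c.U, ContinuousAt τ y := by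
  let := (scalar h V).toAlgebra
  have : Algebra.IsStandardSmooth K Γ(T, V) := hs
  let φ₀ : Γ(T, V) →ₐ[K] L := { valHom b.1 hb with commutes' := b.eval_scalar hb }
  obtain ⟨c⟩ := PurePoints.exists_localChart φ₀
  let τ (y : c.ι → L) : Points h L :=
    ofAffine hV (c.ψ y : Γ(T, V) →+* L) (by ext u; exact (c.ψ y).commutes u)
  have hτ (y) : (τ y).image ∈ V := image_ofAffine_mem hV _ _
  have hτs (y s) : (τ y).eval (hτ y) s = c.ψ y s := eval_ofAffine hV _ _ s
  refine ⟨φ₀, c, τ, hτ, hτs, ?_, fun y hy => ?_⟩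
  · refine ext_of_eval hV (hτ _) hb fun s => ?_
    rw [hτs, c.ψ_base]
    rfl
  · refine continuousAt_of_eval hV (Eventually.of_forall hτ) fun s => ?_
    have : (fun y => value s (τ y)) = fun y => c.ψ y s := by
      ext y
      rw [value_eq _ _ (hτ y), hτs]
    rw [this]
    exact (c.differentiableAt s y hy).continuousAt

/-- A differential form on an integral smooth affine scheme that vanishes, with respect to the
derivation, near some point, is zero. -/
lemma PthDerivation.eq_zero_of_forall_points (d : PthDerivation p K L) {V : T.Opens}
    (hV : IsAffineOpen V) (hs : (scalar h V).IsStandardSmooth) [IsDomain Γ(T, V)]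
    {O : Set (Points h L)} (hO : IsOpen O) {b : Points h L} (hbO : b ∈ O) (hb : b.image ∈ V)
    {ω : Ω[Γ(T, V)⁄ℤ]}
    (hω : ∀ b' ∈ O, ∀ hb' : b'.image ∈ V, diffEval d.toDer (valHom b'.1 hb') ω = 0) : ω = 0 := by
  let := (scalar h V).toAlgebra
  obtain ⟨φ₀, c, τ, hτ, hτs, hτb, hτc⟩ := Points.exists_localChart hV hs b hb
  have : Algebra.IsStandardSmooth K Γ(T, V) := hs
  have : Algebra.FiniteType K Γ(T, V) := inferInstance
  have hev : ∀ᶠ y in 𝓝 (fun i => φ₀ (c.g i)), y ∈ c.U ∧ τ y ∈ O :=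
    (c.isOpen_U.eventually_mem c.mem_U).and
      ((hτc _ c.mem_U).eventually_mem (hO.mem_nhds (hτb ▸ hbO)))
  obtain ⟨O', hO', hO'o, hmem⟩ := eventually_nhds_iff.1 hev
  refine d.eq_zero_of_forall_diffEval_eq_zero c hO'o ⟨_, hmem⟩ (fun y hy => (hO' y hy).1)
    fun y hy => ?_
  rw [← hω (τ y) (hO' y hy).2 (hτ y)]
  have : (c.ψ y : Γ(T, V) →+* L) = valHom (τ y).1 (hτ y) := by
    ext s
    exact (hτs y s).symm
  rw [this]

end Chart

/-! ### The sets where a differential form vanishes -/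

lemma evaluation_res {X : Scheme.{u}} {U V : X.Opens} (h : V ≤ U) {x : X} (hx : x ∈ V)
    (s : Γ(X, U)) :
    X.evaluation V x hx (X.presheaf.map (homOfLE h).op s) = X.evaluation U x (h hx) s :=
  congrArg (X.residue x).hom (TopCat.Presheaf.germ_res_apply X.presheaf (homOfLE h) x hx s)

lemma mem_closure_iff_evaluation {X : Scheme.{u}} {U : X.Opens} (hU : IsAffineOpen U) {x z : X}
    (hx : x ∈ U) (hz : z ∈ U) : z ∈ closure {x} ↔
      ∀ s : Γ(X, U), X.evaluation U x hx s = 0 → X.evaluation U z hz s = 0 := by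
  rw [← specializes_iff_mem_closure]
  simp only [Scheme.evaluation_eq_zero_iff_notMem_basicOpen]
  refine ⟨fun h s hs hzs => hs (h.mem_open (X.basicOpen s).isOpen hzs), fun h => ?_⟩
  refine specializes_iff_forall_open.2 fun O hO hzO => ?_
  obtain ⟨s, hs, hzs⟩ := hU.exists_basicOpen_le (V := ⟨O, hO⟩) ⟨z, hzO⟩ hz
  exact hs (not_not.1 fun h' => h s h' hzs)

lemma valHom_comp_appLE {X T : Scheme.{u}} {L : Type u} [Field L] (b : Spec (.of L) ⟶ T)
    (j : T ⟶ X) {U : X.Opens} {V : T.Opens} (hVU : V ≤ j ⁻¹ᵁ U)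
    (hb : b (IsLocalRing.closedPoint L) ∈ V) :
    (valHom b hb).comp (j.appLE U V hVU).hom = valHom (b ≫ j) (U := U) (hVU hb) := by
  ext s
  exact (valHom_res b hVU hb (j.app U s)).trans (valHom_comp b j (U := U) (hVU hb) s).symm

lemma evaluation_comp_appLE {X T : Scheme.{u}} (j : T ⟶ X) {U : X.Opens} {V : T.Opens}
    (hVU : V ≤ j ⁻¹ᵁ U) {t : T} (ht : t ∈ V) :
    (j.residueFieldMap t).hom.comp (X.evaluation U (j t) (hVU ht)).hom =
      (T.evaluation V t ht).hom.comp (j.appLE U V hVU).hom := by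
  ext s
  exact (Scheme.evaluation_naturality_apply j t (hVU ht) s).trans
    (evaluation_res hVU ht (j.app U s)).symm

section PAnalytic

variable (p : ℕ) [hp : Fact p.Prime] {K L : Type u} [Field K] [NontriviallyNormedField L]
  [CharP L p] [Algebra K L] {X : Scheme.{u}} {f : X ⟶ Spec (.of K)}

lemma isPAnalyticAt_value {U : X.Opens} (s : Γ(X, U)) (a : Points f L) (ha : a.image ∈ U) :
    IsPAnalyticAt p (Points.value s) a := by
  refine ⟨U, ha, 1, fun _ => s, fun y => y 0, ?_, ?_⟩
  · exact (ContinuousLinearMap.proj (R := pthPowers p L) (φ := fun _ : Fin 1 => L) 0).analyticAt _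
  · filter_upwards [(Points.isOpen_setOf_image_mem f L U).mem_nhds ha] with b hb
    exact ⟨hb, Points.value_eq s b hb⟩

lemma isPAnalyticAt_one (a : Points f L) : IsPAnalyticAt p (fun _ => (1 : L)) a :=
  ⟨⊤, trivial, 0, Fin.elim0, fun _ => 1, analyticAt_const, Eventually.of_forall fun _ =>
    ⟨trivial, rfl⟩⟩

lemma isPAnalyticSubset_of_fintype {W : Set (Points f L)}
    (h : ∀ a : Points f L, ∃ (ι : Type) (_ : Finite ι) (h : ι → Points f L → L),
      (∀ j, IsPAnalyticAt p (h j) a) ∧ ∀ᶠ b in 𝓝 a, (b ∈ W ↔ ∀ j, h j b = 0)) :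
    IsPAnalyticSubset p W := by
  intro a
  obtain ⟨ι, _, h, h1, h2⟩ := h a
  obtain ⟨n, ⟨e⟩⟩ := Finite.exists_equiv_fin ι
  exact ⟨n, fun j => h (e.symm j), fun j => h1 _, h2.mono fun b hb =>
    hb.trans ⟨fun H j => H _, fun H j => by simpa using H (e j)⟩⟩

lemma isPAnalyticSubset_empty : IsPAnalyticSubset p (∅ : Set (Points f L)) :=
  isPAnalyticSubset_of_fintype p fun a => ⟨Unit, inferInstance, fun _ _ => 1,
    fun _ => isPAnalyticAt_one p a, Eventually.of_forall fun _ =>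
      ⟨fun h => h.elim, fun h => (one_ne_zero (h ())).elim⟩⟩

variable {p}

open Classical in
/-- The value of a differential form at a point, extended by `0`. -/
def diffValue (D : Derivation ℤ L L) {U : X.Opens} (ω : Ω[Γ(X, U)⁄ℤ]) (a : Points f L) : L :=
  if ha : a.image ∈ U then diffEval D (valHom a.1 ha) ω else 0

lemma diffValue_eq (D : Derivation ℤ L L) {U : X.Opens} (ω : Ω[Γ(X, U)⁄ℤ]) (a : Points f L)
    (ha : a.image ∈ U) : diffValue D ω a = diffEval D (valHom a.1 ha) ω := dif_pos ha

variable [CharP K p] [CompleteSpace L]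

/-- In the coordinates of `L^{2n}` the value is `∑ y_i ∂(z_i)`, polynomial over `L^p` up to the
continuous `L^p`-linear map `∂`. -/
lemma PthDerivation.isPAnalyticAt_diffValue (d : PthDerivation p K L) {U : X.Opens}
    (ω : Ω[Γ(X, U)⁄ℤ]) (a : Points f L) (ha : a.image ∈ U) :
    IsPAnalyticAt p (diffValue d.toDer ω) a := by
  obtain ⟨n, s, t, rfl⟩ := exists_eq_sum_smul_D ω
  refine ⟨U, ha, n + n, Fin.append s t, fun y =>
    ∑ i, y (Fin.castAdd n i) * d.toCLM (y (Fin.natAdd n i)), ?_, ?_⟩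
  · refine Finset.analyticAt_fun_sum _ fun i _ => AnalyticAt.mul ?_ ?_
    · exact (ContinuousLinearMap.proj (R := pthPowers p L) (φ := fun _ : Fin (n + n) => L)
        (Fin.castAdd n i)).analyticAt _
    · exact (d.toCLM.comp (ContinuousLinearMap.proj (R := pthPowers p L)
        (φ := fun _ : Fin (n + n) => L) (Fin.natAdd n i))).analyticAt _
  · filter_upwards [(Points.isOpen_setOf_image_mem f L U).mem_nhds ha] with b hb
    refine ⟨hb, ?_⟩
    rw [diffValue_eq _ _ b hb, map_sum]
    refine Finset.sum_congr rfl fun i _ => ?_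
    rw [diffEval_smul, diffEval_D, Fin.append_left, Fin.append_right, d.toCLM_apply]
    rfl

/-- The bounded points of an affine open that lie in the closure of `x` and at which a differential
form vanishes. -/
def vanishingSet (D : Derivation ℤ L L) (f : X ⟶ Spec (.of K)) (x : X) {U : X.Opens}
    (S : Finset Γ(X, U)) (r : ℝ) (ω : Ω[Γ(X, U)⁄ℤ]) : Set (Points f L) :=
  {a | a ∈ Points.boundedSet f L S r ∧ a.image ∈ closure {x} ∧ diffValue D ω a = 0}

/-- The bounded set is open, because closed balls of nonzero radius are open, and closed by
separatedness. Near its points the equations are generators of the ideal of `x` together with the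
form; elsewhere the equation `1 = 0` works. -/
theorem PthDerivation.isPAnalyticSubset_vanishingSet [IsSeparated f] [LocallyOfFiniteType f]
    (d : PthDerivation p K L) {U : X.Opens} (hU : IsAffineOpen U) {x : X} (hx : x ∈ U)
    {S : Finset Γ(X, U)}
    (hS : Subring.closure (Set.range (scalar f U) ∪ (S : Set Γ(X, U))) = ⊤) {r : ℝ} (hr : r ≠ 0)
    (ω : Ω[Γ(X, U)⁄ℤ]) : IsPAnalyticSubset p (vanishingSet d.toDer f x S r ω) := by
  have := isUltrametricDist_of_charP p L
  refine isPAnalyticSubset_of_fintype p fun a => ?_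
  by_cases ha : a ∈ Points.boundedSet f L S r
  · obtain ⟨haU, haS⟩ := id ha
    have := isNoetherianRing_of_isAffineOpen (f := f) hU
    obtain ⟨G, hG⟩ := (isNoetherianRing_iff_ideal_fg _).1 this
      (RingHom.ker (X.evaluation U x hx).hom)
    refine ⟨Option (Fin G.card), inferInstance, fun o => o.elim (diffValue d.toDer ω)
      fun i => Points.value (G.equivFin.symm i).1, ?_, ?_⟩
    · rintro (_ | i)
      · exact d.isPAnalyticAt_diffValue ω a haU
      · exact isPAnalyticAt_value p _ a haU
    · have hbdd : ∀ᶠ b in 𝓝 a, b ∈ Points.boundedSet f L S r := by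
        have h1 : ∀ᶠ b : Points f L in 𝓝 a, ∀ s ∈ S, ∃ hb : b.image ∈ U,
            b.eval hb s ∈ Metric.closedBall 0 r :=
          (Filter.eventually_all_finset S).2 fun s hs =>
            (Points.isOpen_setOf_eval_mem s (IsUltrametricDist.isOpen_closedBall 0 hr)).mem_nhds
              ⟨haU, mem_closedBall_zero_iff.2 (haS s hs)⟩
        filter_upwards [h1, (Points.isOpen_setOf_image_mem f L U).mem_nhds haU] with b h1 hb
        exact ⟨hb, fun s hs => mem_closedBall_zero_iff.1 (h1 s hs).2⟩
      filter_upwards [hbdd] with b hb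
      obtain ⟨hbU, -⟩ := id hb
      have h1 : b.image ∈ closure {x} ↔ ∀ i, Points.value (G.equivFin.symm i).1 b = 0 := by
        rw [mem_closure_iff_evaluation hU hx hbU]
        have h2 : (∀ s : Γ(X, U), X.evaluation U x hx s = 0 → X.evaluation U b.image hbU s = 0) ↔
            RingHom.ker (X.evaluation U x hx).hom ≤ RingHom.ker (valHom b.1 hbU) := by
          refine forall_congr' fun s => imp_congr Iff.rfl ?_
          exact (map_eq_zero_iff b.residueMap b.residueMap.injective).symm
        rw [h2, ← hG, Ideal.span_le]
        refine ⟨fun h i => ?_, fun h s hs => ?_⟩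
        · rw [Points.value_eq _ _ hbU]
          exact h (G.equivFin.symm i).2
        · have := h (G.equivFin ⟨s, hs⟩)
          rw [Equiv.symm_apply_apply, Points.value_eq _ _ hbU] at this
          exact this
      refine ⟨fun h => ?_, fun h => ⟨hb, h1.2 fun i => h (some i), h none⟩⟩
      rintro (_ | i)
      · exact h.2.2
      · exact h1.1 h.2.1 i
  · refine ⟨Unit, inferInstance, fun _ _ => 1, fun _ => isPAnalyticAt_one p a, ?_⟩
    filter_upwards [(Points.isClosed_boundedSet (L := L) hU hS r).isOpen_compl.mem_nhds ha] with b hb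
    exact ⟨fun h => (hb h.1).elim, fun h => (one_ne_zero (h ())).elim⟩

/-- Suppose the form vanishes on a nonempty open set of smooth points of `Z`. Then its pullback to
an integral smooth affine open of `Z` is zero. That open contains the generic point, so the image of
the form in the differentials of `κ(x)` is zero. -/
theorem PthDerivation.inter_smoothLocusClosure_eq_empty [LocallyOfFiniteType f]
    (d : PthDerivation p K L) {U : X.Opens} {x : X} (hx : x ∈ U)
    {S : Finset Γ(X, U)} {r : ℝ} {ω : Ω[Γ(X, U)⁄ℤ]}
    (hω : kaehlerMap (X.evaluation U x hx).hom ω ≠ 0) {O : Set (Points f L)} (hO : IsOpen O)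
    (hOW : O ∩ pointsIn f L (smoothLocusClosure f x) ⊆ vanishingSet d.toDer f x S r ω) :
    O ∩ pointsIn f L (smoothLocusClosure f x) = ∅ := by
  by_contra hne
  obtain ⟨a, haO, ha⟩ := Set.nonempty_iff_ne_empty.2 hne
  obtain ⟨⟨haU, -⟩, -⟩ := hOW ⟨haO, ha⟩
  let I := Scheme.IdealSheafData.vanishingIdeal
    (⟨closure {x}, isClosed_closure⟩ : TopologicalSpace.Closeds X)
  let i := I.subschemeι
  have hfp : LocallyOfFinitePresentation (i ≫ f) :=
    LocallyOfFinitePresentation.iff_locallyOfFiniteType.2 inferInstance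
  obtain ⟨z, hz, hza⟩ : ∃ z ∈ (i ≫ f).smoothLocus, i z = a.image := ha
  have hi (z) : i z ∈ closure {x} := I.range_subschemeι.le (Set.mem_range_self z)
  obtain ⟨w, hw⟩ : ∃ w, i w = x := I.range_subschemeι.ge (subset_closure (Set.mem_singleton x))
  have hwz (z) : w ⤳ z := by
    rw [← i.isEmbedding.isInducing.specializes_iff, hw, specializes_iff_mem_closure]
    exact hi z
  have : IsReduced I.subscheme := isReduced_subscheme_vanishingIdeal _
  -- The part of the smooth locus of `Z` over `U`; being open and nonempty, it contains the generic
  -- point `w`.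
  let M : I.subscheme.Opens := (i ≫ f).smoothLocus ⊓ i ⁻¹ᵁ U
  have hzM : z ∈ M := ⟨hz, show i z ∈ U from hza.symm ▸ haU⟩
  have hwM : w ∈ M := (hwz z).mem_open M.isOpen hzM
  let j : M.toScheme ⟶ X := M.ι ≫ i
  have hsm : Smooth (j ≫ f) := by
    rw [Category.assoc, ← Scheme.Hom.smoothLocus_eq_top_iff, ← Scheme.Hom.preimage_smoothLocus_eq]
    exact eq_top_iff.2 fun t _ => t.2.1
  let tw : M.toScheme := ⟨w, hwM⟩
  have htw (t : M.toScheme) : tw ⤳ t := by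
    rw [← M.ι.isEmbedding.isInducing.specializes_iff]
    exact hwz _
  obtain ⟨b, hba, hbz⟩ := Points.exists_lift j a ⟨z, hzM⟩ hza
  obtain ⟨V, hV, hzV, hs⟩ := exists_isStandardSmooth_scalar (j ≫ f) (⟨z, hzM⟩ : M.toScheme)
  have htwV : tw ∈ V := (htw _).mem_open V.isOpen hzV
  have hdom : IsDomain Γ(M.toScheme, V) :=
    (injective_evaluation htw htwV).isDomain (M.toScheme.evaluation V tw htwV).hom
  have hVU : V ≤ j ⁻¹ᵁ U := fun t _ => t.2.2
  have hzero := d.eq_zero_of_forall_points hV hs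
    (hO.preimage (Points.continuous_map (f := f) (L := L) j rfl)) (b := b)
    (by rw [Set.mem_preimage, hba]; exact haO) (by rw [hbz]; exact hzV)
    (ω := kaehlerMap (j.appLE U V hVU).hom ω) fun b' hb'O hb'V => by
      obtain ⟨-, -, h1⟩ := hOW ⟨hb'O, ⟨M.ι b'.image, b'.image.2.1, rfl⟩⟩
      rw [diffValue_eq _ _ (b'.map j rfl) (hVU hb'V)] at h1
      rw [diffEval_kaehlerMap]
      exact (congrArg (fun φ => diffEval d.toDer φ ω) (valHom_comp_appLE b'.1 j hVU hb'V)).trans h1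
  have hω' (y : X) (hy : y = x) : ∃ hyU : y ∈ U, kaehlerMap (X.evaluation U y hyU).hom ω ≠ 0 := by
    subst hy
    exact ⟨hx, hω⟩
  obtain ⟨hyU, hy⟩ := hω' (j tw) hw
  -- The residue field of the generic point of `M` is `κ(x)`, so the vanishing can be tested there.
  refine hy (kaehlerMap_injective_of_bijective (bijective_residueFieldMap j tw) ?_)
  rw [map_zero, ← kaehlerMap_comp, evaluation_comp_appLE j hVU htwV, kaehlerMap_comp, hzero,
    map_zero]

end PAnalytic

/-! ### Descent of `p`-th powers and the pure points over a point of the scheme -/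

section Descent

/-- Field extensions are faithfully flat. This lets identities between points be checked after
extending the field. -/
lemma epi_specMap_of_field {κ L : Type u} [Field κ] [Field L] (ρ : κ →+* L) :
    Epi (Spec.map (CommRingCat.ofHom ρ)) := by
  let := ρ.toAlgebra
  have hflat : Flat (Spec.map (CommRingCat.ofHom ρ)) := by
    rw [HasRingHomProperty.Spec_iff (P := @Flat)]
    exact (inferInstance : Module.Flat κ L)
  have hsurj : Surjective (Spec.map (CommRingCat.ofHom ρ)) :=
    ⟨fun y => ⟨IsLocalRing.closedPoint L, Subsingleton.elim (α := PrimeSpectrum κ) _ _⟩⟩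
  exact Flat.epi_of_flat_of_surjective _

lemma valHom_specMap_comp {Y : Scheme.{u}} {κ L : Type u} [Field κ] [Field L] (ρ : κ →+* L)
    (c : Spec (.of κ) ⟶ Y) {U : Y.Opens}
    (hU : (Spec.map (CommRingCat.ofHom ρ) ≫ c) (IsLocalRing.closedPoint L) ∈ U)
    (hU' : c (IsLocalRing.closedPoint κ) ∈ U) (s : Γ(Y, U)) :
    valHom (Spec.map (CommRingCat.ofHom ρ) ≫ c) hU s = ρ (valHom c hU' s) := by
  obtain ⟨_, ⟨V, hV, rfl⟩, hcV, hVU⟩ :=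
    Y.isBasis_affineOpens.exists_subset_of_mem_open hU' U.isOpen
  replace hV : IsAffineOpen V := hV
  have hpt : Spec.map (CommRingCat.ofHom ρ) (IsLocalRing.closedPoint L) =
      IsLocalRing.closedPoint κ := Subsingleton.elim (α := PrimeSpectrum κ) _ _
  have hbV : (Spec.map (CommRingCat.ofHom ρ) ≫ c) (IsLocalRing.closedPoint L) ∈ V := by
    change c (Spec.map (CommRingCat.ofHom ρ) (IsLocalRing.closedPoint L)) ∈ V
    rw [hpt]
    exact hcV
  rw [← valHom_res _ (SetLike.coe_subset_coe.1 hVU) hbV,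
    ← valHom_res c (SetLike.coe_subset_coe.1 hVU) hcV]
  have h := specMap_valHom (Spec.map (CommRingCat.ofHom ρ) ≫ c) hV hbV
  nth_rw 2 [← specMap_valHom c hV hcV] at h
  rw [← Category.assoc, ← Spec.map_comp, cancel_mono] at h
  have h2 := congrArg CommRingCat.Hom.hom (Spec.map_injective h)
  exact RingHom.congr_fun h2 _

variable {p : ℕ} [hp : Fact p.Prime] {K : Type u} [Field K] [CharP K p] {X : Scheme.{u}}
  {f : X ⟶ Spec (.of K)} (D : FrobeniusDescent p f) {L : Type u} [Field L]

lemma FrobeniusDescent.relFrobenius_proj :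
    D.relFrobenius ≫ D.proj = absFrobenius p D.Y (cast_eq_zero p D.g) :=
  D.isPullback.lift_fst _ _ _

/-- The coordinates of a point of the model are `p`-th roots of those of its image. -/
lemma FrobeniusDescent.valHom_proj (b : Spec (.of L) ⟶ D.Y) {V : D.Y.Opens}
    (hb : b (IsLocalRing.closedPoint L) ∈ V) (s : Γ(D.Y, V)) :
    ∃ h : ((b ≫ D.relFrobenius) ≫ D.proj) (IsLocalRing.closedPoint L) ∈ V,
      valHom ((b ≫ D.relFrobenius) ≫ D.proj) h s = valHom b hb s ^ p := by
  rw [Category.assoc, D.relFrobenius_proj]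
  exact ⟨hb, (valHom_comp b (absFrobenius p D.Y (cast_eq_zero p D.g)) (U := V) hb s).trans
    (map_pow (valHom b hb) s p)⟩

/-- If a point is a `p`-power and its field of values is weakly separable over a field over which
the point is defined, then it is a `p`-power over the latter field. -/
lemma FrobeniusDescent.IsPthPower.descend {κ : Type u} [Field κ] [CharP κ p] [CharP L p]
    {ρ : κ →+* L}
    (hρ : IsWeaklySeparableExt ρ) {x : Spec (.of κ) ⟶ X}
    (h : D.IsPthPower (Spec.map (CommRingCat.ofHom ρ) ≫ x)) : D.IsPthPower x := by
  obtain ⟨b, hb1, hb2⟩ := h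
  have hepi := epi_specMap_of_field ρ
  obtain ⟨_, ⟨V, hV, rfl⟩, hbV, -⟩ := D.Y.isBasis_affineOpens.exists_subset_of_mem_open
    (Set.mem_univ (b (IsLocalRing.closedPoint L))) isOpen_univ
  replace hV : IsAffineOpen V := hV
  -- The coordinates of the model point are `p`-th roots in `L` of elements of `κ`, and weak
  -- separability places them in `κ`.
  have hrange (s : Γ(D.Y, V)) : valHom b hbV s ∈ ρ.range := by
    obtain ⟨h1, h2⟩ := D.valHom_proj b hbV s
    simp only [hb2, Category.assoc] at h1 h2
    have h3 : (x ≫ D.proj) (IsLocalRing.closedPoint κ) ∈ V := by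
      rwa [← Subsingleton.elim (α := PrimeSpectrum κ) (Spec.map (CommRingCat.ofHom ρ)
        (IsLocalRing.closedPoint L)) (IsLocalRing.closedPoint κ)]
    rw [valHom_specMap_comp ρ _ h1 h3] at h2
    exact hρ.exists_pow_eq h2.symm
  let e := RingEquiv.ofBijective ρ.rangeRestrict
    ⟨fun x y h => ρ.injective (congrArg Subtype.val h), ρ.rangeRestrict_surjective⟩
  let β : Γ(D.Y, V) →+* κ := e.symm.toRingHom.comp ((valHom b hbV).codRestrict ρ.range hrange)
  have hβ : ρ.comp β = valHom b hbV := by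
    ext s
    exact congrArg Subtype.val (e.apply_symm_apply ⟨valHom b hbV s, hrange s⟩)
  have hc : Spec.map (CommRingCat.ofHom ρ) ≫ Spec.map (CommRingCat.ofHom β) ≫ hV.fromSpec = b := by
    rw [← Spec.map_comp_assoc, ← CommRingCat.ofHom_comp, hβ, specMap_valHom]
  refine ⟨Spec.map (CommRingCat.ofHom β) ≫ hV.fromSpec, ?_, ?_⟩
  · rw [← cancel_epi (Spec.map (CommRingCat.ofHom ρ)), ← Category.assoc, hc, hb1, Category.assoc]
  · rw [← cancel_epi (Spec.map (CommRingCat.ofHom ρ)), ← Category.assoc, hc, hb2]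

end Descent

section PureOver

variable {p : ℕ} {K L : Type u} [Field K] {X : Scheme.{u}} {f : X ⟶ Spec (.of K)}

section Field

variable [Field L] [Algebra K L]

lemma Points.residueMap_residueStructure (a : Points f L) :
    a.residueMap.comp (residueStructure f a.image) = algebraMap K L := by
  have h : Spec.map (CommRingCat.ofHom (residueStructure f a.image)) =
      X.fromSpecResidueField a.image ≫ f := Spec.map_preimage _
  have h2 : Spec.map (CommRingCat.ofHom a.residueMap) ≫
      Spec.map (CommRingCat.ofHom (residueStructure f a.image)) =
      Spec.map (CommRingCat.ofHom (algebraMap K L)) := by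
    rw [h]
    exact (Category.assoc _ _ _).symm.trans
      ((congrArg (· ≫ f) a.specMap_residueMap).trans a.2)
  rw [← Spec.map_comp] at h2
  exact congrArg CommRingCat.Hom.hom (Spec.map_injective h2)

lemma charP_residueField [CharP K p] (a : Points f L) : CharP (X.residueField a.image) p :=
  charP_of_injective_ringHom (residueStructure f a.image).injective p

lemma Points.not_isPthPower [Fact p.Prime] [CharP K p] [CharP L p] (D : FrobeniusDescent p f) (a : Points f L)
    (ha : IsWeaklySeparableExt a.residueMap)
    (h : ¬ D.IsPthPower (X.fromSpecResidueField a.image)) : ¬ D.IsPthPower a.1 := by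
  have := charP_residueField (p := p) a
  refine fun h' => h (FrobeniusDescent.IsPthPower.descend D ha ?_)
  rw [a.specMap_residueMap]
  exact h'

lemma exists_finset_affine [QuasiCompact f] : ∃ T : Finset X.affineOpens,
    ∀ x : X, ∃ U ∈ T, x ∈ U.1 := by
  have : CompactSpace X := by
    have := QuasiCompact.isCompact_preimage (f := f) Set.univ isOpen_univ isCompact_univ
    exact isCompact_univ_iff.1 this
  obtain ⟨T, hT⟩ := isCompact_univ.elim_finite_subcover (fun U : X.affineOpens => (U.1 : Set X))
    (fun U => U.1.isOpen) (fun x _ => by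
      obtain ⟨_, ⟨V, hV, rfl⟩, hxV, -⟩ := X.isBasis_affineOpens.exists_subset_of_mem_open
        (Set.mem_univ x) isOpen_univ
      exact Set.mem_iUnion.2 ⟨⟨V, hV⟩, hxV⟩)
  refine ⟨T, fun x => ?_⟩
  obtain ⟨U, hU, hx⟩ := Set.mem_iUnion₂.1 (hT (Set.mem_univ x))
  exact ⟨U, hU, hx⟩

/-- The values of a differential form at a point over `x` are determined by its image in the
differentials of the residue field. -/
lemma Points.diffEval_residueMap (d : Derivation ℤ L L) (a : Points f L) {U : X.Opens}
    (ha : a.image ∈ U) (ω : Ω[Γ(X, U)⁄ℤ]) :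
    diffEval d a.residueMap (kaehlerMap (X.evaluation U a.image ha).hom ω) =
      diffEval d (valHom a.1 ha) ω :=
  diffEval_kaehlerMap d _ _ ω

end Field

variable [hp : Fact p.Prime] [NontriviallyNormedField L] [CharP L p] [Algebra K L]

lemma isProperPAnalyticSubset_empty [LocallyOfFiniteType f] (x : X) :
    IsProperPAnalyticSubset p L f x ∅ :=
  ⟨isPAnalyticSubset_empty p, Set.empty_subset _, fun _ _ h => Set.subset_empty_iff.1 h⟩

variable [CharP K p] [CompleteSpace L]

/-- The exceptional sets are indexed by an affine open of a finite cover, a bound on its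
coordinates, and a form with nonzero image in `Ω_{κ(x)}`; countability of `K` makes this index set
countable. -/
theorem PthDerivation.exists_properPAnalyticSubsets [Countable K] [IsSeparated f]
    [LocallyOfFiniteType f] [QuasiCompact f] (d : PthDerivation p K L) (D : FrobeniusDescent p f)
    (x : X) (hsep : IsSeparableExt p (residueStructure f x))
    (hpow : ¬ D.IsPthPower (X.fromSpecResidueField x)) (hne : (pointsOver f L x).Nonempty) :
    ∃ W : ℕ → Set (Points f L), (∀ i, IsProperPAnalyticSubset p L f x (W i)) ∧
      purePoints L D ∩ pointsOver f L x = pointsIn f L (closure {x}) \ ⋃ i, W i := by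
  obtain ⟨T, hT⟩ := exists_finset_affine (f := f)
  choose S hS using fun U : X.affineOpens => exists_generators (f := f) U.2
  let I := Σ U : {U : T // x ∈ U.1.1}, ℕ ×
    {ω : Ω[Γ(X, U.1.1.1)⁄ℤ] // kaehlerMap (X.evaluation U.1.1.1 x U.2).hom ω ≠ 0}
  have hI : Countable I := by
    have (U : {U : T // x ∈ U.1.1}) : Countable (Ω[Γ(X, U.1.1.1)⁄ℤ]) := by
      have : Countable Γ(X, U.1.1.1) :=
        countable_of_finiteType _ (finiteType_scalar (f := f) U.1.1.2)
      exact kaehler_countable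
    infer_instance
  let W₀ (i : I) : Set (Points f L) :=
    vanishingSet d.toDer f x (S i.1.1.1) ((i.2.1 : ℝ) + 1) i.2.2.1
  have hW₀ (i : I) : IsProperPAnalyticSubset p L f x (W₀ i) :=
    ⟨d.isPAnalyticSubset_vanishingSet i.1.1.1.2 i.1.2 (hS _) (Nat.cast_add_one_pos _).ne' _,
      fun a ha => ha.2.1, fun O hO h => d.inter_smoothLocusClosure_eq_empty i.1.2 i.2.2.2 hO h⟩
  have hmem (a : Points f L) (haZ : a.image ∈ closure {x}) (haW : ∀ i, a ∉ W₀ i) :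
      ∃ (U : X.Opens) (hU : IsAffineOpen U) (hx : x ∈ U) (ha : a.image ∈ U),
        ∀ ω : Ω[Γ(X, U)⁄ℤ], diffEval d.toDer (valHom a.1 ha) ω = 0 →
          kaehlerMap (X.evaluation U x hx).hom ω = 0 := by
    obtain ⟨U, hUT, haU⟩ := hT a.image
    have hxU : x ∈ U.1 := (specializes_iff_mem_closure.2 haZ).mem_open U.1.isOpen haU
    refine ⟨U.1, U.2, hxU, haU, fun ω hω => ?_⟩
    by_contra hne
    obtain ⟨n, hn⟩ := exists_nat_ge (∑ s ∈ S U, ‖a.eval haU s‖)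
    refine haW ⟨⟨⟨U, hUT⟩, hxU⟩, n, ω, hne⟩ ⟨⟨haU, fun s hs => ?_⟩, haZ, ?_⟩
    · exact (Finset.single_le_sum (f := fun s => ‖a.eval haU s‖)
        (fun _ _ => norm_nonneg _) hs).trans (hn.trans (le_add_of_nonneg_right zero_le_one))
    · exact (diffValue_eq _ _ _ haU).trans hω
  have key : purePoints L D ∩ pointsOver f L x = pointsIn f L (closure {x}) \ ⋃ i, W₀ i := by
    ext a
    constructor
    · rintro ⟨⟨⟨-, hws⟩, -⟩, rfl⟩
      refine ⟨subset_closure (Set.mem_singleton _), fun haW => ?_⟩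
      obtain ⟨⟨U, n, ω, hω⟩, haU⟩ := Set.mem_iUnion.1 haW
      refine hω ((d.isWeaklySeparableExt_iff _).1 hws _ ?_)
      rw [a.diffEval_residueMap, ← diffValue_eq _ _ a U.2]
      exact haU.2.2
    · rintro ⟨haZ, haW⟩
      obtain ⟨U, hU, hxU, haU, hω⟩ := hmem a haZ fun i hi => haW (Set.mem_iUnion.2 ⟨i, hi⟩)
      -- A point of `Z` not over `x` kills some `s` with `s(x) ≠ 0`, hence the form `s dt`. Since
      -- `a` avoids the exceptional sets, `dt` would be zero in `Ω_{κ(x)}`; but the given `L`-point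
      -- over `x` takes it to `1`.
      have hax : a.image = x := by
        by_contra hax
        have hx : x ∉ closure {a.image} := fun hx => hax
          ((specializes_iff_mem_closure.2 hx).antisymm (specializes_iff_mem_closure.2 haZ)).eq
        rw [mem_closure_iff_evaluation hU haU hxU] at hx
        push Not at hx
        obtain ⟨s, hs, hsx⟩ := hx
        have h1 := hω (s • KaehlerDifferential.D ℤ _ (scalar f U d.t)) (by
          have : valHom a.1 haU s = 0 := (congrArg a.residueMap hs).trans (map_zero _)
          rw [diffEval_smul, this, zero_mul])
        rw [kaehlerMap_smul, smul_eq_zero_iff_right hsx] at h1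
        obtain ⟨c, rfl⟩ := hne
        have h2 := c.diffEval_residueMap d.toDer hxU
          (KaehlerDifferential.D ℤ _ (scalar f U d.t))
        have h3 : valHom c.1 hxU (scalar f U d.t) = algebraMap K L d.t := c.eval_scalar hxU d.t
        rw [h1, map_zero, diffEval_D, h3, d.toDer_t] at h2
        exact zero_ne_one h2
      subst hax
      have hws : IsWeaklySeparableExt a.residueMap := by
        rw [d.isWeaklySeparableExt_iff]
        intro ω hω0
        obtain ⟨b, ω', hb, hω'⟩ := exists_smul_eq_kaehlerMap (X.evaluation U a.image haU).hom
          (fun w => exists_evaluation_mul_eq hU haU w) ω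
        rw [← smul_eq_zero_iff_right hb, hω']
        refine hω ω' ?_
        rw [← a.diffEval_residueMap, ← hω', diffEval_smul, hω0, mul_zero]
      exact ⟨⟨⟨hsep, hws⟩, a.not_isPthPower D hws hpow⟩, rfl⟩
  -- The extra index carries the empty set, so an enumeration by `ℕ` exists without knowing that `I`
  -- is nonempty.
  obtain ⟨e, he⟩ := exists_surjective_nat (Option I)
  let W (o : Option I) : Set (Points f L) := o.elim ∅ W₀
  have hW : ∀ o, IsProperPAnalyticSubset p L f x (W o)
    | none => isProperPAnalyticSubset_empty x
    | some i => hW₀ i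
  refine ⟨fun n => W (e n), fun n => hW _, ?_⟩
  rw [key, he.iUnion_comp W, Set.iUnion_option]
  simp [W]

end PureOver

/-! ### Density of the pure points over a complete field -/

section NotPower

variable {p : ℕ} [hp : Fact p.Prime] {K L : Type u} [Field K] [CharP K p]
  [NontriviallyNormedField L] [CharP L p] [Algebra K L] {X : Scheme.{u}}
  {f : X ⟶ Spec (.of K)}

/-- The elements of a subfield whose derivatives lie in the subfield. -/
def derivationSubfield {L : Type*} [Field L] (D : Derivation ℤ L L) (k : Subfield L) :
    Subfield L where
  carrier := {u | u ∈ k ∧ D u ∈ k}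
  mul_mem' := fun {a b} ha hb => ⟨mul_mem ha.1 hb.1, by
    rw [D.leibniz]
    exact add_mem (mul_mem ha.1 hb.2) (mul_mem hb.1 ha.2)⟩
  one_mem' := ⟨one_mem k, by rw [D.map_one_eq_zero]; exact zero_mem k⟩
  add_mem' := fun {a b} ha hb => ⟨add_mem ha.1 hb.1, by
    rw [map_add]
    exact add_mem ha.2 hb.2⟩
  zero_mem' := ⟨zero_mem k, by rw [map_zero]; exact zero_mem k⟩
  neg_mem' := fun {a} ha => ⟨neg_mem ha.1, by
    rw [map_neg]
    exact neg_mem ha.2⟩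
  inv_mem' a ha := ⟨inv_mem ha.1, by
    rw [D.leibniz_inv]
    exact mul_mem (neg_mem (pow_mem (inv_mem ha.1) 2)) ha.2⟩

/-- The coordinates of a `p`-power point have derivatives in the field of definition of the
point. -/
lemma PthDerivation.exists_residueMap_eq_of_isPthPower (d : PthDerivation p K L)
    (D : FrobeniusDescent p f) (a : Points f L) (h : D.IsPthPower a.1) {U : X.Opens}
    (ha : a.image ∈ U) (s : Γ(X, U)) : ∃ w, a.residueMap w = d.toDer (a.eval ha s) := by
  -- `S` contains `K` and the `p`-th powers of the coordinates of the model point. By the fibre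
  -- product description of `X` these determine the point, which is therefore defined over `S`.
  let S := derivationSubfield d.toDer a.residueMap.fieldRange
  obtain ⟨b, hb1, hb2⟩ := h
  obtain ⟨_, ⟨V, hV, rfl⟩, hbV, -⟩ := D.Y.isBasis_affineOpens.exists_subset_of_mem_open
    (Set.mem_univ (b (IsLocalRing.closedPoint L))) isOpen_univ
  replace hV : IsAffineOpen V := hV
  have haV : (a.1 ≫ D.proj) (IsLocalRing.closedPoint L) ∈ V := hb2 ▸ (D.valHom_proj b hbV 1).1
  have hval (s : Γ(D.Y, V)) : valHom (a.1 ≫ D.proj) haV s = valHom b hbV s ^ p := by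
    obtain ⟨h1, h2⟩ := D.valHom_proj b hbV s
    simp only [hb2] at h2
    exact h2
  have hpow (s : Γ(D.Y, V)) : valHom b hbV s ^ p ∈ S := by
    refine ⟨?_, ?_⟩
    · have h1 := a.specMap_residueMap
      have h2 : Spec.map (CommRingCat.ofHom a.residueMap) ≫
          (X.fromSpecResidueField a.image ≫ D.proj) = a.1 ≫ D.proj := by
        rw [← h1]
        exact (Category.assoc _ _ _).symm
      have h3 : (Spec.map (CommRingCat.ofHom a.residueMap) ≫
          (X.fromSpecResidueField a.image ≫ D.proj)) (IsLocalRing.closedPoint L) ∈ V := by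
        rw [h2]
        exact haV
      have h4 : (X.fromSpecResidueField a.image ≫ D.proj)
          (IsLocalRing.closedPoint (X.residueField a.image)) ∈ V := by
        rwa [← Subsingleton.elim (α := PrimeSpectrum (X.residueField a.image))
          (Spec.map (CommRingCat.ofHom a.residueMap) (IsLocalRing.closedPoint L))
          (IsLocalRing.closedPoint (X.residueField a.image))]
      refine ⟨valHom (X.fromSpecResidueField a.image ≫ D.proj) h4 s, ?_⟩
      rw [← hval]
      refine (valHom_specMap_comp a.residueMap _ h3 h4 s).symm.trans ?_
      simp only [h2]
    · rw [derivation_pow_char (p := p)]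
      exact zero_mem _
  have hKS (c : K) : algebraMap K L c ∈ S := by
    have hK (c : K) : algebraMap K L c ∈ a.residueMap.fieldRange :=
      ⟨residueStructure f a.image c, RingHom.congr_fun a.residueMap_residueStructure c⟩
    obtain ⟨w, hw, -⟩ := d.map_algebraMap c
    exact ⟨hK c, hw ▸ hK w⟩
  let γ : Γ(D.Y, V) →+* S := ((frobenius L p).comp (valHom b hbV)).codRestrict S hpow
  let ι : K →+* S := (algebraMap K L).codRestrict S hKS
  have hcomm : (Spec.map (CommRingCat.ofHom γ) ≫ hV.fromSpec) ≫ D.g =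
      Spec.map (CommRingCat.ofHom ι) ≫ Spec.map (CommRingCat.ofHom (frobenius K p)) := by
    rw [Category.assoc, fromSpec_comp_structure, ← Spec.map_comp, ← Spec.map_comp]
    congr 1
    ext c
    change valHom b hbV (scalar D.g V c) ^ p = algebraMap K L (c ^ p)
    rw [valHom_scalar D.g (algebraMap K L) b (hb1.trans a.2), map_pow]
  let c := D.isPullback.lift _ _ hcomm
  have hc : Spec.map (CommRingCat.ofHom S.subtype) ≫ c = a.1 := by
    refine D.isPullback.hom_ext ?_ ?_
    · rw [Category.assoc, D.isPullback.lift_fst, ← Category.assoc, ← Spec.map_comp,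
        ← specMap_valHom (a.1 ≫ D.proj) hV haV]
      congr 2
      ext s
      exact (hval s).symm
    · rw [Category.assoc, D.isPullback.lift_snd, a.2, ← Spec.map_comp]
      rfl
  have hcU : c (IsLocalRing.closedPoint S) ∈ U := by
    have h1 : c (Spec.map (CommRingCat.ofHom S.subtype) (IsLocalRing.closedPoint L)) = a.image :=
      congrArg (fun g : Spec (.of L) ⟶ X => g (IsLocalRing.closedPoint L)) hc
    rw [Subsingleton.elim (α := PrimeSpectrum S) (IsLocalRing.closedPoint S)
      (Spec.map (CommRingCat.ofHom S.subtype) (IsLocalRing.closedPoint L))]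
    exact h1 ▸ ha
  have hcU' : (Spec.map (CommRingCat.ofHom S.subtype) ≫ c) (IsLocalRing.closedPoint L) ∈ U :=
    hc.symm ▸ ha
  have key : a.eval ha s = (valHom c hcU s : S) := by
    rw [← S.subtype_apply, ← valHom_specMap_comp S.subtype c hcU' hcU]
    simp only [hc]
    rfl
  rw [key]
  exact (valHom c hcU s).2.2

end NotPower

/-! ### Points in general position -/

section Generic

variable {p : ℕ} [hp : Fact p.Prime] {K L : Type u} [Field K] [CharP K p]
  [NontriviallyNormedField L] [CompleteSpace L] [CharP L p] [Algebra K L]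

/-- In a local chart there are points in general position: their coordinates satisfy no differential
relation that does not hold identically. -/
lemma PthDerivation.exists_generic (d : PthDerivation p K L) {B : Type*} [CommRing B]
    [Countable B] [Algebra K B] {φ₀ : B →ₐ[K] L} (c : LocalChart φ₀) {O : Set (c.ι → L)}
    (hO : IsOpen O) (hne : O.Nonempty) (hOU : O ⊆ c.U) :
    ∃ y ∈ O, ∀ (a : B) (b : c.ι → B), c.ψ y a + ∑ i, c.ψ y (b i) * d.toDer (y i) = 0 →
      c.ψ y a = 0 ∧ ∀ i, c.ψ y (b i) = 0 := by
  have := hO.baireSpace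
  have := hne.to_subtype
  let Φ (r : B × (c.ι → B)) (y : O) : L :=
    c.ψ y r.1 + ∑ i, c.ψ y (r.2 i) * d.toDer (y.1 i)
  have hψ (s : B) : Continuous fun y : O => c.ψ y s :=
    continuousOn_iff_continuous_domRestrict.1 fun y hy =>
      (c.differentiableAt s y (hOU hy)).continuousAt.continuousWithinAt
  have hΦ (r) : Continuous (Φ r) := by
    refine (hψ r.1).add (continuous_finsetSum _ fun i _ => (hψ _).mul ?_)
    exact d.toCLM.continuous.comp ((continuous_apply i).comp continuous_subtype_val)
  have hcl (r) : IsClosed {y | Φ r y = 0} := isClosed_eq (hΦ r) continuous_const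
  -- The zero sets are closed and countable in number. Off the meagre union of their frontiers, a
  -- relation that holds at a point holds in a neighbourhood.
  have hdense : Dense (⋂ r, (frontier {y | Φ r y = 0})ᶜ) :=
    dense_iInter_of_isOpen (fun r => isClosed_frontier.isOpen_compl) fun r =>
      interior_eq_empty_iff_dense_compl.1 (interior_frontier (hcl r))
  obtain ⟨y, hy⟩ := hdense.nonempty
  refine ⟨y, y.2, fun a b hab => ?_⟩
  have hint : y ∈ interior {y | Φ (a, b) y = 0} := by
    by_contra hint
    exact Set.mem_iInter.1 hy (a, b) ⟨subset_closure hab, hint⟩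
  have hopen := hO.isOpenMap_subtype_val _ (isOpen_interior (s := {y | Φ (a, b) y = 0}))
  refine d.eq_zero_of_sum_eq_zero hopen (F₀ := fun y => c.ψ y a) (F := fun i y => c.ψ y (b i))
    ?_ ?_ ?_ y ⟨y, hint, rfl⟩
  · rintro _ ⟨z, -, rfl⟩
    exact c.differentiableAt _ _ (hOU z.2)
  · rintro i _ ⟨z, -, rfl⟩
    exact c.differentiableAt _ _ (hOU z.2)
  · rintro _ ⟨z, hz, rfl⟩
    have hz' : z ∈ {y | Φ (a, b) y = 0} := interior_subset hz
    exact hz'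

/-- Without differentials the ring of functions is finite over `K`, hence Artinian, and its spectrum
is discrete. -/
lemma isOpen_singleton_of_span_eq_top {X : Scheme.{u}} {f : X ⟶ Spec (.of K)}
    [LocallyOfFiniteType f] {V : X.Opens}
    (hV : IsAffineOpen V) {x : X} (hx : x ∈ V)
    (h : letI := (scalar f V).toAlgebra; Subsingleton (Ω[Γ(X, V)⁄K])) :
    IsOpen ({x} : Set X) := by
  let := (scalar f V).toAlgebra
  have : Algebra.FiniteType K Γ(X, V) := finiteType_scalar (f := f) hV
  have : Algebra.FormallyUnramified K Γ(X, V) := ⟨h⟩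
  have : Module.Finite K Γ(X, V) := Algebra.FormallyUnramified.finite_of_free K _
  have : IsArtinianRing Γ(X, V) := IsArtinianRing.of_finite K _
  obtain ⟨y, rfl⟩ := hV.range_fromSpec.ge hx
  rw [← Set.image_singleton]
  exact hV.fromSpec.isOpenEmbedding.isOpenMap _ (isOpen_discrete (α := PrimeSpectrum _) {y})

/-- Points in general position in a local chart are pure: a form of the residue field that vanishes
in `L` is, after clearing denominators, a differential relation among the coordinates, so its
coefficients vanish at the point. -/
theorem PthDerivation.dense_purePoints [Countable K] {X : Scheme.{u}} {f : X ⟶ Spec (.of K)}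
    [Smooth f] (hX : ∀ x : X, ¬ IsOpen ({x} : Set X)) (d : PthDerivation p K L)
    (D : FrobeniusDescent p f) : Dense (purePoints L D) := by
  refine dense_iff_inter_open.2 fun O hO ⟨a, haO⟩ => ?_
  obtain ⟨V, hV, haV, hs⟩ := exists_isStandardSmooth_scalar f a.image
  let := (scalar f V).toAlgebra
  obtain ⟨φ₀, c, τ, hτ, hτs, hτa, hτc⟩ := Points.exists_localChart hV hs a haV
  have : Nonempty c.ι := by
    by_contra hι
    rw [not_nonempty_iff] at hι
    have hspan := c.span_D
    rw [Set.range_eq_empty, Submodule.span_empty] at hspan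
    exact hX _ (isOpen_singleton_of_span_eq_top (f := f) hV haV
      ((Submodule.subsingleton_iff Γ(X, V)).1 (subsingleton_of_bot_eq_top hspan)))
  have hev : ∀ᶠ y in 𝓝 (fun i => φ₀ (c.g i)), y ∈ c.U ∧ τ y ∈ O :=
    (c.isOpen_U.eventually_mem c.mem_U).and
      ((hτc _ c.mem_U).eventually_mem (hO.mem_nhds (hτa ▸ haO)))
  obtain ⟨O', hO', hO'o, hmem⟩ := eventually_nhds_iff.1 hev
  have : Countable Γ(X, V) := countable_of_finiteType _ (finiteType_scalar (f := f) hV)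
  obtain ⟨y, hyO', hgen⟩ := d.exists_generic c hO'o ⟨_, hmem⟩ fun y hy => (hO' y hy).1
  refine ⟨τ y, (hO' y hyO').2, ?_⟩
  have hyU := (hO' y hyO').1
  generalize hb : τ y = b at *
  have hbV : b.image ∈ V := hb ▸ hτ y
  have hval (s) : valHom b.1 hbV s = c.ψ y s := by
    subst hb
    exact hτs y s
  have hzero (s) : c.ψ y s = 0 ↔ X.evaluation V b.image hbV s = 0 := by
    rw [← hval]
    exact map_eq_zero_iff (x := X.evaluation V b.image hbV s) b.residueMap b.residueMap.injective
  have hK (u : K) : ∃ w : K, KaehlerDifferential.D ℤ K u = w • KaehlerDifferential.D ℤ K d.t := by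
    obtain ⟨w, -, hw⟩ := d.map_algebraMap u
    exact ⟨w, hw⟩
  have hws : IsWeaklySeparableExt b.residueMap := by
    rw [d.isWeaklySeparableExt_iff]
    intro ω hω0
    obtain ⟨r, ω', hr, hω'⟩ := exists_smul_eq_kaehlerMap (X.evaluation V b.image hbV).hom
      (fun w => exists_evaluation_mul_eq hV hbV w) ω
    have h1 : diffEval d.toDer (valHom b.1 hbV) ω' = 0 := by
      rw [← b.diffEval_residueMap, ← hω', diffEval_smul, hω0, mul_zero]
    rw [← smul_eq_zero_iff_right hr, hω']
    obtain ⟨m, n, rfl⟩ := exists_eq_smul_add_sum hK c.span_D ω'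
    rw [map_add, map_sum, diffEval_smul, diffEval_D] at h1
    simp only [diffEval_smul, diffEval_D, hval, AlgHom.commutes, d.toDer_t, mul_one,
      c.ψ_g y hyU] at h1
    obtain ⟨h2, h3⟩ := hgen m n h1
    have h2' : (X.evaluation V b.image hbV).hom m = 0 := (hzero m).1 h2
    have h3' (i) : (X.evaluation V b.image hbV).hom (n i) = 0 := (hzero _).1 (h3 i)
    rw [map_add, map_sum, kaehlerMap_smul, h2', zero_smul, zero_add]
    refine Finset.sum_eq_zero fun i _ => ?_
    rw [kaehlerMap_smul, h3', zero_smul]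
  refine ⟨⟨d.isPBasis.isSeparableExt _ b.residueMap b.residueMap_residueStructure, hws⟩,
    fun hpow => ?_⟩
  obtain ⟨i₀⟩ := ‹Nonempty c.ι›
  obtain ⟨w, hw⟩ := d.exists_residueMap_eq_of_isPthPower D b hpow hbV (c.g i₀)
  -- For a `p`-power point the derivative of the coordinate `y_{i₀}` would be a fraction `m / n` in
  -- the residue field. Then `n ∂y_{i₀} - m = 0` is a relation with `n` nonzero at the point, which
  -- general position excludes.
  obtain ⟨m, n, hn, hmn⟩ := exists_evaluation_mul_eq hV hbV w
  have h1 := congrArg b.residueMap hmn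
  rw [map_mul, hw] at h1
  have h2 : d.toDer (y i₀) * c.ψ y n = c.ψ y m := by
    rw [← hval, ← hval, ← c.ψ_g y hyU i₀, ← hval]
    exact h1
  classical
  have h3 := (hgen (-m) (Pi.single i₀ n) (by
    rw [Finset.sum_eq_single i₀ (fun i _ hi => by rw [Pi.single_eq_of_ne hi, map_zero, zero_mul])
      (fun h => (h (Finset.mem_univ _)).elim), Pi.single_eq_same, map_neg, ← h2]
    ring)).2 i₀
  rw [Pi.single_eq_same] at h3
  exact hn ((hzero n).1 h3)

end Generic

/-! ### Density in the adelic points -/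

/-- Around `x`, the part of the restricted product integral at all indices where `x` is integral
carries the product topology. A component can thus be chosen at each index separately, in an open
set that contains `x i` and so meets `P i`. -/
lemma dense_setOf_forall_mem {ι : Type*} {R : ι → Type*} [∀ i, TopologicalSpace (R i)]
    {A : ∀ i, Set (R i)} (hA : ∀ i, IsOpen (A i)) {P : ∀ i, Set (R i)} (hP : ∀ i, Dense (P i)) :
    Dense {x : Πʳ i, [R i, A i] | ∀ i, x i ∈ P i} := by
  classical
  refine dense_iff_inter_open.2 fun O hO ⟨x, hxO⟩ => ?_
  let S : Set ι := {i | x i ∈ A i}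
  have hS : cofinite ≤ 𝓟 S := le_principal_iff.2 x.2
  let x' : Πʳ i, [R i, A i]_[𝓟 S] := ⟨x, fun _ h => h⟩
  have hO' := hO.preimage (RestrictedProduct.continuous_inclusion (R := R) (A := A) hS)
  rw [RestrictedProduct.isEmbedding_coe_of_principal.isOpen_iff] at hO'
  obtain ⟨G, hG, hGO⟩ := hO'
  have hxG : (x' : ∀ i, R i) ∈ G := by
    have : x' ∈ RestrictedProduct.inclusion R A hS ⁻¹' O := hxO
    rwa [← hGO] at this
  obtain ⟨I, w, hw, hwG⟩ := isOpen_pi_iff.1 hG _ hxG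
  have hy (i : ι) : ∃ y ∈ P i, (i ∈ I → y ∈ w i) ∧ (i ∈ S → y ∈ A i) := by
    have hopen : IsOpen ({y | i ∈ I → y ∈ w i} ∩ {y | i ∈ S → y ∈ A i}) := by
      refine IsOpen.inter ?_ ?_
      · by_cases hi : i ∈ I
        · simpa [hi] using (hw i hi).1
        · simp [hi]
      · by_cases hi : i ∈ S
        · simpa [hi] using hA i
        · simp [hi]
    obtain ⟨y, hy, hyP⟩ := (hP i).inter_open_nonempty _ hopen
      ⟨x i, fun hi => (hw i hi).2, fun hi => hi⟩
    exact ⟨y, hyP, hy⟩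
  choose y hyP hyw hyA using hy
  let y' : Πʳ i, [R i, A i]_[𝓟 S] := ⟨y, hyA⟩
  refine ⟨RestrictedProduct.inclusion R A hS y', ?_, hyP⟩
  have : y' ∈ (fun z : Πʳ i, [R i, A i]_[𝓟 S] => (z : ∀ i, R i)) ⁻¹' G :=
    hwG fun i hi => hyw i hi
  rw [hGO] at this
  exact this

lemma Atlas.isOpen_integralPoints {K : Type u} [Field K] {X : Scheme.{u}}
    {f : X ⟶ Spec (.of K)} (A : Atlas f) (v : Place K) [IsUltrametricDist v.Completion] :
    IsOpen (A.integralPoints v) := by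
  refine isOpen_iff_mem_nhds.2 fun a ⟨i, ha, h⟩ => ?_
  have h1 : ∀ᶠ b : Points f v.Completion in 𝓝 a, ∀ s ∈ A.coord i, ∃ hb : b.image ∈ A.U i,
      b.eval hb s ∈ Metric.closedBall 0 1 :=
    (Filter.eventually_all_finset _).2 fun s hs =>
      (Points.isOpen_setOf_eval_mem s
        (IsUltrametricDist.isOpen_closedBall 0 one_ne_zero)).mem_nhds
          ⟨ha, mem_closedBall_zero_iff.2 (h s hs)⟩
  filter_upwards [h1, (Points.isOpen_setOf_image_mem f v.Completion (A.U i)).mem_nhds ha]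
    with b h1 hb
  exact ⟨i, hb, fun s hs => mem_closedBall_zero_iff.1 (h1 s hs).2⟩

lemma countable_of_functionField (F K : Type*) [Field F] [Finite F] [Field K]
    [Algebra (RatFunc F) K] [FunctionField F K] : Countable K := by
  have h1 : Countable (Polynomial F) := countable_of_finiteType (algebraMap F (Polynomial F))
    (RingHom.finiteType_algebraMap.2 inferInstance)
  have h2 : Countable (RatFunc F) := by
    have h : Function.Surjective fun x : Polynomial F × Polynomial F =>
        algebraMap (Polynomial F) (RatFunc F) x.1 / algebraMap (Polynomial F) (RatFunc F) x.2 := by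
      intro x
      exact ⟨(x.num, x.denom), x.num_div_denom⟩
    exact h.countable
  have : Module.Finite (RatFunc F) K := (inferInstance : FiniteDimensional (RatFunc F) K)
  exact countable_of_finiteType (algebraMap (RatFunc F) K)
    (RingHom.finiteType_algebraMap.2 inferInstance)

end PurePoints

end

theorem mainTheorem9
    (p : ℕ) [Fact p.Prime]
    (F : Type*) [Field F] [Finite F]
    (K : Type u) [Field K] [CharP K p] [Algebra (RatFunc F) K] [FunctionField F K]
    (X : Scheme.{u}) (f : X ⟶ Spec (.of K)) [Smooth f] [IsSeparated f] [QuasiCompact f]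
    (D : PurePoints.FrobeniusDescent p f) :
    (∀ (v : PurePoints.Place K) (x : X),
      PurePoints.IsSeparableExt p (PurePoints.residueStructure f x) →
      ¬ D.IsPthPower (X.fromSpecResidueField x) →
      (PurePoints.pointsOver f v.Completion x).Nonempty →
      ∃ W : ℕ → Set (PurePoints.Points f v.Completion),
        (∀ i, PurePoints.IsProperPAnalyticSubset p v.Completion f x (W i)) ∧
        PurePoints.purePoints v.Completion D ∩ PurePoints.pointsOver f v.Completion x =
          PurePoints.pointsIn f v.Completion (closure {x}) \ ⋃ i, W i) ∧
    ((∀ x : X, ¬ IsOpen ({x} : Set X)) →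
      ∀ A : PurePoints.Atlas f, Nonempty (PurePoints.AdelicPoints A) →
        Dense (PurePoints.pureAdelicPoints D A)) := by
  have hK : Countable K := PurePoints.countable_of_functionField F K
  refine ⟨fun v x hsep hpow hne => ?_, fun hX A _ => ?_⟩
  · obtain ⟨-, t, ht⟩ := PurePoints.Place.exists_isPBasis p F K v
    obtain ⟨d, -⟩ := ht.exists_pthDerivation
    exact d.exists_properPAnalyticSubsets D x hsep hpow hne
  · refine PurePoints.dense_setOf_forall_mem (fun v => ?_) fun v => ?_
    · have := PurePoints.isUltrametricDist_of_charP p v.Completion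
      exact A.isOpen_integralPoints v
    · obtain ⟨-, t, ht⟩ := PurePoints.Place.exists_isPBasis p F K v
      obtain ⟨d, -⟩ := ht.exists_pthDerivation
      exact d.dense_purePoints hX D
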